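/- **Setup.** Let $\mathcal A=\{\left[{k\atop d}\right] : k\ge 1,\ d\ge 0\}$ and write $\left[{k_1,\dots,k_r\atop d_1,\dots,d_r}\right]$ for the word $\left[{k_1\atop d_1}\right]\cdots\left[{k_r\atop d_r}\right]$ in $\mathbb Q\langle\mathcal A\rangle$. The stuffle product $*$ is the $\mathbb Q$-bilinear product on $\mathbb Q\langle\mathcal A\rangle$ with $1*w=w*1=w$ and $$\left[{k_1\atop d_1}\right]w*\left[{k_2\atop d_2}\right]v=\left[{k_1\atop d_1}\right]\Bigl(w*\left[{k_2\atop d_2}\right]v\Bigr)+\left[{k_2\atop d_2}\right]\Bigl(\left[{k_1\atop d_1}\right]w*v\Bigr)+\left[{k_1+k_2\atop d_1+d_2}\right](w*v).$$ It makes $\mathbb Q\langle\mathcal A\rangle$ a commutative $\mathbb Q$-algebra. Consider families $f=(f_r)_{r\ge0}$ with $f_r\in\mathbb Q\langle\mathcal A\rangle[[X_1,Y_1,\dots,X_r,Y_r]]$, in particular $\mathfrak A=(\mathfrak A_r)_{r\ge 0}$ with $\mathfrak A_0=1$ and $$\mathfrak A_r=\sum_{k_i\ge1,\,d_i\ge0}\left[{k_1,\dots,k_r\atop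 d_1,\dots,d_r}\right]\prod_{i=1}^r X_i^{k_i-1}\frac{Y_i^{d_i}}{d_i!}.$$ A linear map $\rho$ on such families induces a $\mathbb Q$-linear map, again denoted $\rho$, on $\mathbb Q\langle\mathcal A\rangle$: $\rho\left[{k_1,\dots,k_r\atop d_1,\dots,d_r}\right]$ is the coefficient of $\prod_i X_i^{k_i-1}Y_i^{d_i}/d_i!$ in $(\rho\,\mathfrak A)_r$. Put $X_{r+1}=Y_{r+1}=0$ (as well as $X_0=0$) and define: * the swap $\sigma$: $(\sigma f)_r=f_r(Y_1+\dots+Y_r,\dots,Y_1+Y_2,Y_1;\ X_r,X_{r-1}-X_r,\dots,X_1-X_2)$; * $(Df)_r=\sum_{j=1}^r\frac{\partial}{\partial X_j}\frac{\partial}{\partial Y_j}f_r$ and $(Wf)_r=\sum_{j=1}^r\bigl(\frac{\partial}{\partial X_j}X_j+Y_j\frac{\partial}{\partial Y_j}\bigr)f_r$; * for $1\le j\le r$, $(\varphi_j^+f)_r=f_{r-1}(X_1,\dots,X_{j-1},X_{j+1},\dots,X_r;\ Y_1,\dots,Y_{j-1},Y_j+Y_{j+1},Y_{j+2},\dots,Y_r)$,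 where for $j=r$ the $Y$-arguments are $Y_1,\dots,Y_{r-1}$; for $2\le j\le r$, $(\varphi_j^-f)_r=f_{r-1}(X_1,\dots,X_{j-1},X_{j+1},\dots,X_r;\ Y_1,\dots,Y_{j-2},Y_{j-1}+Y_j,Y_{j+1},\dots,Y_r)$; for all other $j$ these are $0$; * $(\delta f)_r=\sum_{j=1}^r X_jY_j\,f_r+\sum_{j\ge1}\Bigl(-\tfrac12(X_j-X_{j+1}+Y_j)\,\varphi_j^+-\tfrac12(X_{j-1}-X_j+Y_j)\,\varphi_j^-+\tfrac14(\varphi_j^+)^2-\tfrac14(\varphi_j^-)^2\Bigr)f_r$. Let $\mathcal I$ be the ideal of $(\mathbb Q\langle\mathcal A\rangle,*)$ generated by all $\sigma(w)-w$ with $w\in\mathbb Q\langle\mathcal A\rangle$, and let $\mathrm{FMES}=(\mathbb Q\langle\mathcal A\rangle,*)/\mathcal I$ be the algebra of formal multiple Eisenstein series. **Theorem.** 1. The maps $D$, $W$, $\delta$ on $\mathbb Q\langle\mathcal A\rangle$ are derivations of $(\mathbb Q\langle\mathcal A\rangle,*)$ and commute with $\sigma$. 2. On words, $$D\left[{k_1,\dots,k_r\atop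 d_1,\dots,d_r}\right]=\sum_{j=1}^r k_j\left[{k_1,\dots,k_j+1,\dots,k_r\atop d_1,\dots,d_j+1,\dots,d_r}\right],\qquad W\left[{k_1,\dots,k_r\atop d_1,\dots,d_r}\right]=\sum_{i=1}^r(k_i+d_i)\left[{k_1,\dots,k_r\atop d_1,\dots,d_r}\right],$$ and $\delta=\delta^1-\frac12(\delta^2+\delta^3+\delta^4+\delta^5)$, where each of the following linear maps $\delta^1,\dots,\delta^5$ is a derivation of $(\mathbb Q\langle\mathcal A\rangle,*)$: $$\begin{aligned} \delta^1\left[{k_1,\dots,k_r\atop d_1,\dots,d_r}\right]&=\sum_{j=1}^r\mathbf 1_{k_j>1}\,d_j\left[{k_1,\dots,k_j-1,\dots,k_r\atop d_1,\dots,d_j-1,\dots,d_r}\right]-\tfrac12\sum_{j=1}^{r-1}\mathbf 1_{k_{j+1}=1}\,d_{j+1}\left[{k_1,\dots,k_j,k_{j+2},\dots,k_r\atop d_1,\dots,d_j+d_{j+1}-1,d_{j+2},\dots,d_r}\right]\\ &\quad-\tfrac12\sum_{j=1}^{r-1}\mathbf 1_{k_j=1}\,d_j\left[{k_1,\dots,k_{j-1},k_{j+1},\dots,k_r\atop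 d_1,\dots,d_{j-1},d_j+d_{j+1}-1,\dots,d_r}\right],\\ \delta^2\left[{k_1,\dots,k_r\atop d_1,\dots,d_r}\right]&=\mathbf 1_{(k_r,d_r)=(2,0)}\left[{k_1,\dots,k_{r-1}\atop d_1,\dots,d_{r-1}}\right]-\tfrac12\,\mathbf 1_{(k_{r-1},d_{r-1})=(k_r,d_r)=(1,0)}\left[{k_1,\dots,k_{r-2}\atop d_1,\dots,d_{r-2}}\right],\\ \delta^3\left[{k_1,\dots,k_r\atop d_1,\dots,d_r}\right]&=\mathbf 1_{(k_r,d_r)=(1,1)}\left[{k_1,\dots,k_{r-1}\atop d_1,\dots,d_{r-1}}\right],\\ \delta^4\left[{k_1,\dots,k_r\atop d_1,\dots,d_r}\right]&=\sum_{j=2}^r\mathbf 1_{k_j=1,\,k_{j-1}>1}\left[{k_1,\dots,k_{j-1}-1,k_{j+1},\dots,k_r\atop d_1,\dots,d_{j-1}+d_j,d_{j+1},\dots,d_r}\right]-\sum_{j=1}^{r-1}\mathbf 1_{k_j=1,\,k_{j+1}>1}\left[{k_1,\dots,k_{j-1},k_{j+1}-1,\dots,k_r\atop d_1,\dots,d_{j-1},d_j+d_{j+1},\dots,d_r}\right],\\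 \delta^5\left[{k_1,\dots,k_r\atop d_1,\dots,d_r}\right]&=\sum_{j=1}^{r-1}\mathbf 1_{k_j=2}\left[{k_1,\dots,k_{j-1},k_{j+1},\dots,k_r\atop d_1,\dots,d_{j-1},d_j+d_{j+1},\dots,d_r}\right]-\sum_{j=1}^{r-1}\mathbf 1_{k_{j+1}=2}\left[{k_1,\dots,k_j,k_{j+2},\dots,k_r\atop d_1,\dots,d_j+d_{j+1},d_{j+2},\dots,d_r}\right]\\ &\quad+\tfrac12\sum_{j=1}^{r-2}\mathbf 1_{k_{j+1}=k_{j+2}=1}\left[{k_1,\dots,k_j,k_{j+3},\dots,k_r\atop d_1,\dots,d_j+d_{j+1}+d_{j+2},d_{j+3},\dots,d_r}\right]\\ &\quad-\tfrac12\sum_{j=1}^{r-2}\mathbf 1_{k_j=k_{j+1}=1}\left[{k_1,\dots,k_{j-1},k_{j+2},\dots,k_r\atop d_1,\dots,d_{j-1},d_j+d_{j+1}+d_{j+2},\dots,d_r}\right]. \end{aligned}$$ 3. $D$, $W$, $\delta$ induce derivations of $\mathrm{FMES}$ which satisfy $$[W,D]=2D,\qquad[W,\delta]=-2\delta,\qquad[\delta,D]=W.$$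 Hence $\mathrm{FMES}$ is an $\mathfrak{sl}_2$-algebra: $\left(\begin{smallmatrix}a&b\\c&-a\end{smallmatrix}\right)\mapsto aW+bD-c\,\delta$ is a Lie algebra homomorphism $\mathfrak{sl}_2(\mathbb Q)\to\operatorname{Der}_{\mathbb Q}(\mathrm{FMES})$. -/

import Mathlib

namespace FormalMES

/-! ### Words and the stuffle algebra -/

/-- The alphabet: the pair `(k, d)` with `k ≥ 1`, `d ≥ 0` is the letter `[k; d]`. -/
abbrev Letter : Type := ℕ+ × ℕ

/-- Words in the alphabet, `[(k₁, d₁), …, (k_r, d_r)]`. -/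
abbrev Word : Type := List Letter

/-- The `ℚ`-vector space with basis the words, the underlying space of `ℚ⟨𝓐⟩`.
Its multiplication `*` below is the stuffle product. -/
def QA : Type := Word →₀ ℚ

noncomputable section

instance : AddCommGroup QA := inferInstanceAs (AddCommGroup (Word →₀ ℚ))

instance : Module ℚ QA := inferInstanceAs (Module ℚ (Word →₀ ℚ))

/-- The word `w` as an element of `ℚ⟨𝓐⟩`. -/
def word (w : Word) : QA := Finsupp.single w (1 : ℚ)

/-- Linear extension of a map defined on words. -/
def linExt {M : Type} [AddCommGroup M] [Module ℚ M] (f : Word → M) : QA →ₗ[ℚ] M :=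
  (Finsupp.lift M ℚ Word f : (Word →₀ ℚ) →ₗ[ℚ] M)

theorem linExt_word {M : Type} [AddCommGroup M] [Module ℚ M] (f : Word → M) (w : Word) :
    linExt f (word w) = f w := by
  have h : Finsupp.lift M ℚ Word f (Finsupp.single w (1 : ℚ)) = f w := by
    simp [Finsupp.lift_apply]
  exact h

theorem hom_ext {M : Type} [AddCommGroup M] [Module ℚ M] {f g : QA →ₗ[ℚ] M}
    (h : ∀ w, f (word w) = g (word w)) : f = g := by
  have key : ∀ f' g' : (Word →₀ ℚ) →ₗ[ℚ] M,
      (∀ w, f' (Finsupp.single w 1) = g' (Finsupp.single w 1)) → f' = g' := by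
    intro f' g' h'
    exact Finsupp.lhom_ext' fun w => LinearMap.ext_ring (h' w)
  exact key f g h

/-- Concatenation with a letter on the left, `x ↦ a x`. -/
def consL (a : Letter) : QA →ₗ[ℚ] QA := linExt fun w => word (a :: w)

/-- The stuffle product of two words. -/
def stuffle : Word → Word → QA
  | [], v => word v
  | a :: u, [] => word (a :: u)
  | a :: u, b :: v =>
      consL a (stuffle u (b :: v)) + consL b (stuffle (a :: u) v)
        + consL (a.1 + b.1, a.2 + b.2) (stuffle u v)
termination_by u v => u.length + v.length

/-- The stuffle product as a bilinear map. -/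
def stuffleL : QA →ₗ[ℚ] QA →ₗ[ℚ] QA := linExt fun u => linExt fun v => stuffle u v

instance : Mul QA := ⟨fun x y => stuffleL x y⟩

instance : One QA := ⟨word []⟩

theorem mul_def' (x y : QA) : x * y = stuffleL x y := rfl

theorem one_def' : (1 : QA) = word [] := rfl

theorem word_mul_word (u v : Word) : word u * word v = stuffle u v := by
  rw [mul_def', stuffleL, linExt_word, linExt_word]

theorem consL_word (a : Letter) (w : Word) : consL a (word w) = word (a :: w) :=
  linExt_word _ _

theorem mul_add' (x y z : QA) : x * (y + z) = x * y + x * z := by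
  simp only [mul_def', map_add]

theorem add_mul' (x y z : QA) : (x + y) * z = x * z + y * z := by
  simp only [mul_def', map_add, LinearMap.add_apply]

theorem smul_mul' (q : ℚ) (x y : QA) : (q • x) * y = q • (x * y) := by
  simp only [mul_def', map_smul, LinearMap.smul_apply]

theorem mul_smul' (q : ℚ) (x y : QA) : x * (q • y) = q • (x * y) := by
  simp only [mul_def', map_smul]

theorem one_mul' (x : QA) : 1 * x = x := by
  have h : stuffleL (word []) = LinearMap.id := hom_ext fun w => by
    rw [← mul_def', word_mul_word, stuffle]; rfl
  rw [mul_def', one_def', h]; rfl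

theorem stuffle_comm (u v : Word) : stuffle u v = stuffle v u := by
  induction u, v using stuffle.induct with
  | case1 v => cases v <;> simp [stuffle]
  | case2 a u => simp [stuffle]
  | case3 a u b v h1 h2 h3 =>
    rw [stuffle, stuffle, h1, h2, h3, add_comm a.1, add_comm a.2]
    abel

theorem mul_comm' (x y : QA) : x * y = y * x := by
  have h : stuffleL = stuffleL.flip := hom_ext fun u => hom_ext fun v => by
    rw [LinearMap.flip_apply, ← mul_def', ← mul_def', word_mul_word, word_mul_word, stuffle_comm]
  rw [mul_def', h]; rfl

theorem consL_mul_consL (a b : Letter) (x y : QA) :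
    consL a x * consL b y = consL a (x * consL b y) + consL b (consL a x * y)
      + consL (a.1 + b.1, a.2 + b.2) (x * y) := by
  have h : (stuffleL.compl₂ (consL b)).comp (consL a)
      = (stuffleL.compl₂ (consL b)).compr₂ (consL a)
        + (stuffleL.comp (consL a)).compr₂ (consL b)
        + stuffleL.compr₂ (consL (a.1 + b.1, a.2 + b.2)) :=
    hom_ext fun u => hom_ext fun v => by
      simp only [LinearMap.comp_apply, LinearMap.compl₂_apply, LinearMap.compr₂_apply,
        LinearMap.add_apply, consL_word, ← mul_def', word_mul_word]
      rw [stuffle]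
  have h' := congrArg (fun F => F x y) h
  exact h'

theorem assoc_step (a b c : Letter) (x y z : QA)
    (e1 : x * consL b y * consL c z = x * (consL b y * consL c z))
    (e2 : consL a x * y * consL c z = consL a x * (y * consL c z))
    (e3 : consL a x * consL b y * z = consL a x * (consL b y * z))
    (e4 : x * y * consL c z = x * (y * consL c z))
    (e5 : x * consL b y * z = x * (consL b y * z))
    (e6 : consL a x * y * z = consL a x * (y * z))
    (e7 : x * y * z = x * (y * z)) :
    consL a x * consL b y * consL c z = consL a x * (consL b y * consL c z) := by
  have hl : consL a x * consL b y * consL c z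
      = consL a (x * consL b y * consL c z) + consL b (consL a x * y * consL c z)
        + consL c (consL a x * consL b y * z)
        + consL (a.1 + b.1, a.2 + b.2) (x * y * consL c z)
        + consL (a.1 + c.1, a.2 + c.2) (x * consL b y * z)
        + consL (b.1 + c.1, b.2 + c.2) (consL a x * y * z)
        + consL (a.1 + b.1 + c.1, a.2 + b.2 + c.2) (x * y * z) := by
    rw [consL_mul_consL a b x y]
    simp only [add_mul', consL_mul_consL _ c, map_add]
    abel
  have hr : consL a x * (consL b y * consL c z)
      = consL a (x * (consL b y * consL c z)) + consL b (consL a x * (y * consL c z))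
        + consL c (consL a x * (consL b y * z))
        + consL (a.1 + b.1, a.2 + b.2) (x * (y * consL c z))
        + consL (a.1 + c.1, a.2 + c.2) (x * (consL b y * z))
        + consL (b.1 + c.1, b.2 + c.2) (consL a x * (y * z))
        + consL (a.1 + b.1 + c.1, a.2 + b.2 + c.2) (x * (y * z)) := by
    rw [consL_mul_consL b c y z]
    simp only [mul_add', consL_mul_consL a, map_add, add_assoc a.1, add_assoc a.2]
    abel
  rw [hl, hr, e1, e2, e3, e4, e5, e6, e7]

theorem assoc_word (n : ℕ) : ∀ u v w : Word, u.length + v.length + w.length ≤ n →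
    word u * word v * word w = word u * (word v * word w) := by
  induction n with
  | zero =>
    intro u v w h
    have hu : u = [] := List.length_eq_zero_iff.1 (by omega)
    subst hu
    rw [← one_def', one_mul', one_mul']
  | succ n ih =>
    intro u v w h
    match u, v, w, h with
    | [], v, w, _ => rw [← one_def', one_mul', one_mul']
    | a :: u, [], w, _ =>
      rw [← one_def', one_mul', mul_comm' _ 1, one_mul']
    | a :: u, b :: v, [], _ =>
      rw [← one_def', mul_comm' _ 1, mul_comm' _ 1, one_mul', one_mul']
    | a :: u, b :: v, c :: w, h =>
      simp only [List.length_cons] at h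
      have e1 := ih u (b :: v) (c :: w) (by simp only [List.length_cons]; omega)
      have e2 := ih (a :: u) v (c :: w) (by simp only [List.length_cons]; omega)
      have e3 := ih (a :: u) (b :: v) w (by simp only [List.length_cons]; omega)
      have e4 := ih u v (c :: w) (by simp only [List.length_cons]; omega)
      have e5 := ih u (b :: v) w (by simp only [List.length_cons]; omega)
      have e6 := ih (a :: u) v w (by simp only [List.length_cons]; omega)
      have e7 := ih u v w (by omega)
      simp only [← consL_word] at e1 e2 e3 e4 e5 e6 ⊢
      exact assoc_step a b c _ _ _ e1 e2 e3 e4 e5 e6 e7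

theorem QA.induction {P : QA → Prop} (hw : ∀ w, P (word w))
    (ha : ∀ x y, P x → P y → P (x + y)) (hs : ∀ (q : ℚ) x, P x → P (q • x)) (x : QA) : P x := by
  have key : ∀ y : Word →₀ ℚ, P y := by
    intro y
    induction y using Finsupp.induction_linear with
    | zero =>
      have h0 := hs 0 _ (hw [])
      rw [zero_smul] at h0
      exact h0
    | add f g hf hg => exact ha f g hf hg
    | single w q =>
      have h1 := hs q _ (hw w)
      have h2 : q • word w = (Finsupp.single w q : Word →₀ ℚ) := by
        have h3 : q • (Finsupp.single w (1 : ℚ)) = Finsupp.single w q := by simp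
        exact h3
      rw [h2] at h1
      exact h1
  exact key x

theorem mul_assoc' (x y z : QA) : x * y * z = x * (y * z) := by
  induction x using QA.induction with
  | ha x x' h h' => simp only [add_mul', h, h']
  | hs q x h => simp only [smul_mul', h]
  | hw u =>
    induction y using QA.induction with
    | ha y y' h h' => simp only [add_mul', mul_add', h, h']
    | hs q y h => simp only [smul_mul', mul_smul', h]
    | hw v =>
      induction z using QA.induction with
      | ha z z' h h' => simp only [mul_add', h, h']
      | hs q z h => simp only [mul_smul', h]
      | hw w => exact assoc_word _ u v w le_rfl

/-- `(ℚ⟨𝓐⟩, *)` is a commutative ring under the stuffle product. -/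
instance : CommRing QA :=
  { (inferInstance : AddCommGroup QA) with
    mul := (· * ·)
    one := 1
    left_distrib := mul_add'
    right_distrib := add_mul'
    zero_mul := fun x => by
      have h := smul_mul' 0 0 x
      rwa [zero_smul, zero_smul] at h
    mul_zero := fun x => by
      have h := mul_smul' 0 x 0
      rwa [zero_smul, zero_smul] at h
    mul_assoc := mul_assoc'
    one_mul := one_mul'
    mul_one := fun x => by rw [mul_comm', one_mul']
    mul_comm := mul_comm' }

instance : Algebra ℚ QA := Algebra.ofModule smul_mul' fun q x y => mul_smul' q x y

/-! ### Generating series -/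

/-- The power series ring `𝓑_r = ℚ⟨𝓐⟩⟦X₁, Y₁, …, X_r, Y_r⟧`; the index `Sum.inl i` stands for
`X_{i+1}` and `Sum.inr i` for `Y_{i+1}`. -/
abbrev BB (r : ℕ) : Type := MvPowerSeries (Fin r ⊕ Fin r) QA

/-- Families `(f_r)_{r ≥ 0}` with `f_r ∈ 𝓑_r`. -/
abbrev Bimould : Type := ∀ r : ℕ, BB r

/-- The variable `X_j` in `𝓑_r` for `1 ≤ j ≤ r`, and `0` for all other `j`. -/
def varX (r j : ℕ) : BB r :=
  if h : 1 ≤ j ∧ j ≤ r then MvPowerSeries.X (Sum.inl ⟨j - 1, by omega⟩) else 0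

/-- The variable `Y_j` in `𝓑_r` for `1 ≤ j ≤ r`, and `0` for all other `j`. -/
def varY (r j : ℕ) : BB r :=
  if h : 1 ≤ j ∧ j ≤ r then MvPowerSeries.X (Sum.inr ⟨j - 1, by omega⟩) else 0

/-- `subs r s x y f = f(x 1, …, x s; y 1, …, y s)`, the substitution of `x j` for `X_j` and of
`y j` for `Y_j` in `f ∈ 𝓑_s`. -/
def subs (r s : ℕ) (x y : ℕ → BB r) (f : BB s) : BB r :=
  MvPowerSeries.subst (Sum.elim (fun i : Fin s => x (i + 1)) (fun i : Fin s => y (i + 1))) f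

/-- The generating series `𝔄_r` of all words of length `r`: the coefficient of
`∏ X_j ^ (k_j - 1) Y_j ^ d_j / d_j!` is the word `[(k₁, d₁), …, (k_r, d_r)]`. -/
def genA : Bimould := fun r n =>
  (∏ i : Fin r, ((n (Sum.inr i)).factorial : ℚ))⁻¹ •
    word (List.ofFn fun i : Fin r => ((n (Sum.inl i)).succPNat, n (Sum.inr i)))

/-- The exponent of `∏ X_j ^ (k_j - 1) Y_j ^ d_j` for the word `[(k₁, d₁), …, (k_r, d_r)]`. -/
def expo (w : Word) : (Fin w.length ⊕ Fin w.length) →₀ ℕ :=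
  Finsupp.equivFunOnFinite.symm
    (Sum.elim (fun i => (w.get i).1.natPred) (fun i => (w.get i).2))

/-- The linear map on `ℚ⟨𝓐⟩` induced by a map `ρ` on bimoulds: it sends the word
`[(k₁, d₁), …, (k_r, d_r)]` to the coefficient of `∏ X_j ^ (k_j - 1) Y_j ^ d_j / d_j!`
in `(ρ 𝔄)_r`. -/
def wordMap (ρ : Bimould → Bimould) : QA →ₗ[ℚ] QA :=
  linExt fun w =>
    ((w.map fun a => (a.2.factorial : ℚ)).prod) •
      MvPowerSeries.coeff (expo w) (ρ genA w.length)

/-- The swap on bimoulds: in `f_r` one substitutes `Y_1 + ⋯ + Y_{r-j+1}` for `X_j`, and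
`X_{r-j+1} - X_{r-j+2}` for `Y_j` (where `X_{r+1} = 0`). -/
def swapB : Bimould → Bimould := fun f r =>
  subs r r (fun j => ∑ i ∈ Finset.Icc 1 (r + 1 - j), varY r i)
    (fun j => varX r (r + 1 - j) - varX r (r + 2 - j)) (f r)

/-- `D f_r = ∑_j ∂/∂X_j ∂/∂Y_j f_r`. -/
def derDB : Bimould → Bimould := fun f r =>
  ∑ i : Fin r, MvPowerSeries.pderiv QA (Sum.inl i) (MvPowerSeries.pderiv QA (Sum.inr i) (f r))

/-- `W f_r = ∑_j (∂/∂X_j X_j + Y_j ∂/∂Y_j) f_r`. -/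
def derWB : Bimould → Bimould := fun f r =>
  ∑ i : Fin r,
    (MvPowerSeries.pderiv QA (Sum.inl i) (MvPowerSeries.X (Sum.inl i) * f r)
      + MvPowerSeries.X (Sum.inr i) * MvPowerSeries.pderiv QA (Sum.inr i) (f r))

/-- `φ_j⁺ f_r = f_{r-1}(X_1, …, X_{j-1}, X_{j+1}, …, X_r;
Y_1, …, Y_{j-1}, Y_j + Y_{j+1}, Y_{j+2}, …, Y_r)` for `1 ≤ j ≤ r` (where `Y_{r+1} = 0`), and `0`
for all other `j`. -/
def phiPlus (j : ℕ) : Bimould → Bimould := fun f r =>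
  if 1 ≤ j ∧ j ≤ r then
    subs r (r - 1)
      (fun i => if i < j then varX r i else varX r (i + 1))
      (fun i => if i < j then varY r i
        else if i = j then varY r j + varY r (j + 1) else varY r (i + 1))
      (f (r - 1))
  else 0

/-- `φ_j⁻ f_r = f_{r-1}(X_1, …, X_{j-1}, X_{j+1}, …, X_r;
Y_1, …, Y_{j-2}, Y_{j-1} + Y_j, Y_{j+1}, …, Y_r)` for `2 ≤ j ≤ r`, and `0` for all other `j`. -/
def phiMinus (j : ℕ) : Bimould → Bimould := fun f r =>
  if 2 ≤ j ∧ j ≤ r then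
    subs r (r - 1)
      (fun i => if i < j then varX r i else varX r (i + 1))
      (fun i => if i < j - 1 then varY r i
        else if i = j - 1 then varY r (j - 1) + varY r j else varY r (i + 1))
      (f (r - 1))
  else 0

/-- The map `δ` on bimoulds. The sum over `j ≥ 1` stops at `r`, since `φ_j⁺ f_r = φ_j⁻ f_r = 0`
for `j > r`. -/
def derDeltaB : Bimould → Bimould := fun f r =>
  (∑ j ∈ Finset.Icc 1 r, varX r j * varY r j) * f r
    + ∑ j ∈ Finset.Icc 1 r,
      (-((varX r j - varX r (j + 1) + varY r j) * ((1 / 2 : ℚ) • phiPlus j f r))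
        - (varX r (j - 1) - varX r j + varY r j) * ((1 / 2 : ℚ) • phiMinus j f r)
        + (1 / 4 : ℚ) • phiPlus j (phiPlus j f) r
        - (1 / 4 : ℚ) • phiMinus j (phiMinus j f) r)

/-- The swap `σ` on `ℚ⟨𝓐⟩`. -/
def swap : QA →ₗ[ℚ] QA := wordMap swapB

/-- The map `D` on `ℚ⟨𝓐⟩`. -/
def derD : QA →ₗ[ℚ] QA := wordMap derDB

/-- The map `W` on `ℚ⟨𝓐⟩`. -/
def derW : QA →ₗ[ℚ] QA := wordMap derWB

/-- The map `δ` on `ℚ⟨𝓐⟩`. -/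
def derDelta : QA →ₗ[ℚ] QA := wordMap derDeltaB

/-! ### The algebra of formal multiple Eisenstein series -/

/-- The ideal of `(ℚ⟨𝓐⟩, *)` generated by all `σ(w) - w`. -/
def swapIdeal : Ideal QA := Ideal.span (Set.range fun w : QA => swap w - w)

/-- The algebra of formal multiple Eisenstein series. -/
abbrev FMES : Type := QA ⧸ swapIdeal

/-! ### Explicit formulas on words

In the next definitions `kk w j` and `dd w j` are the entries `k`, `d` of the letter of `w` at
position `j`, counted from `0`. -/

/-- The upper entry at position `j`, with value `0` if there is no such position. -/
def kk (w : Word) (j : ℕ) : ℕ := (w[j]?.map fun a => (a.1 : ℕ)).getD 0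

/-- The lower entry at position `j`, with value `0` if there is no such position. -/
def dd (w : Word) (j : ℕ) : ℕ := (w[j]?.map fun a => a.2).getD 0

/-- `repl w j m k d` is the word obtained from `w` by replacing the `m` consecutive letters
at positions `j, …, j + m - 1` by the single letter `(k, d)`; it is used for `k ≥ 1` only. -/
def repl (w : Word) (j m k d : ℕ) : QA :=
  word (w.take j ++ (k.toPNat', d) :: w.drop (j + m))

/-- The weight of a word. -/
def wt (w : Word) : ℕ := (w.map fun a => (a.1 : ℕ) + a.2).sum

def delta1 : QA →ₗ[ℚ] QA := linExt fun w =>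
  (∑ j ∈ Finset.range w.length,
      if 1 < kk w j then (dd w j : ℚ) • repl w j 1 (kk w j - 1) (dd w j - 1) else 0)
    - (1 / 2 : ℚ) • (∑ j ∈ Finset.range (w.length - 1),
      if kk w (j + 1) = 1 then
        (dd w (j + 1) : ℚ) • repl w j 2 (kk w j) (dd w j + dd w (j + 1) - 1) else 0)
    - (1 / 2 : ℚ) • (∑ j ∈ Finset.range (w.length - 1),
      if kk w j = 1 then
        (dd w j : ℚ) • repl w j 2 (kk w (j + 1)) (dd w j + dd w (j + 1) - 1) else 0)

def delta2 : QA →ₗ[ℚ] QA := linExt fun w =>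
  (if [((2 : ℕ+), 0)] <:+ w then word (w.take (w.length - 1)) else 0)
    - (1 / 2 : ℚ) •
      (if [((1 : ℕ+), 0), ((1 : ℕ+), 0)] <:+ w then word (w.take (w.length - 2)) else 0)

def delta3 : QA →ₗ[ℚ] QA := linExt fun w =>
  if [((1 : ℕ+), 1)] <:+ w then word (w.take (w.length - 1)) else 0

def delta4 : QA →ₗ[ℚ] QA := linExt fun w =>
  (∑ j ∈ Finset.range (w.length - 1),
      if kk w (j + 1) = 1 ∧ 1 < kk w j then
        repl w j 2 (kk w j - 1) (dd w j + dd w (j + 1)) else 0)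
    - ∑ j ∈ Finset.range (w.length - 1),
      if kk w j = 1 ∧ 1 < kk w (j + 1) then
        repl w j 2 (kk w (j + 1) - 1) (dd w j + dd w (j + 1)) else 0

def delta5 : QA →ₗ[ℚ] QA := linExt fun w =>
  (∑ j ∈ Finset.range (w.length - 1),
      if kk w j = 2 then repl w j 2 (kk w (j + 1)) (dd w j + dd w (j + 1)) else 0)
    - (∑ j ∈ Finset.range (w.length - 1),
      if kk w (j + 1) = 2 then repl w j 2 (kk w j) (dd w j + dd w (j + 1)) else 0)
    + (1 / 2 : ℚ) • (∑ j ∈ Finset.range (w.length - 2),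
      if kk w (j + 1) = 1 ∧ kk w (j + 2) = 1 then
        repl w j 3 (kk w j) (dd w j + dd w (j + 1) + dd w (j + 2)) else 0)
    - (1 / 2 : ℚ) • (∑ j ∈ Finset.range (w.length - 2),
      if kk w j = 1 ∧ kk w (j + 1) = 1 then
        repl w j 3 (kk w (j + 2)) (dd w j + dd w (j + 1) + dd w (j + 2)) else 0)

/-- `T` is a derivation of `(ℚ⟨𝓐⟩, *)`. -/
def IsStuffleDerivation (T : QA →ₗ[ℚ] QA) : Prop :=
  ∀ x y : QA, T (x * y) = T x * y + x * T y

/-- `T` commutes with the swap `σ`. -/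
def IsSwapEquivariant (T : QA →ₗ[ℚ] QA) : Prop :=
  ∀ x : QA, T (swap x) = swap (T x)

end

end FormalMES

/-! The derivation property comes from a bialgebra structure. Deconcatenation is multiplicative for
the stuffle product (`deconcat_mul`). A coderivation for it replaces a factor `v` of a word by a
combination `t(v)` of letters, in all possible ways, so it is determined by the projection `t` to
the letters. It is a stuffle derivation as soon as `t` kills `1` and satisfies a Leibniz rule in
which the other factor is evaluated by the counit, or merged as a single letter
(`coder_isStuffleDerivation`). The maps `D`, `W`, `δ¹`, `δ⁴`, `δ⁵` are such coderivations, and their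
`t` lives on words of length at most three; what remains is a finite check
(`isLetterDerivation_of_short`). The maps `δ²` and `δ³` are different: they strip a suffix `v` with
weight `ε(v)`, and are derivations because `ε` vanishes on products of nonempty words
(`suffixOp_isStuffleDerivation`).

The `sl₂`-relations use the same description. The commutator of a coderivation with a letterwise
derivation such as `D` or `W` is the coderivation attached to an explicit bracket of projections
(`coder_comp_letterOp`), and similarly for suffix operators. All relations therefore reduce to words
with at most three letters. The relation `[δ, D] = W` comes from `(d + 1)k - d(k - 1) = k + d`;
everything else in `δ` commutes with `D`.

Equivariance under the swap is proved on generating series. An operation on bimoulds that commutes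
with linear maps of the coefficients can be interchanged with the swap on words if it can be
interchanged with the swap of variables (`isSwapEquivariant_wordMap`). For `δ`, the swap fixes `∑
X_j Y_j`, and it turns the deletion of an `X` into the merging of two neighbouring `Y`s and
conversely (`subs_swap_merge`). This permutes the operators `φ_j⁺` among themselves, and likewise
the `φ_j⁻`. For `D`, pairing with polynomials by `n! c_n` transposes a linear substitution
(`borel_subst`) and turns `D` into multiplication by `∑ X_j Y_j`, which the transposed swap fixes as
well. For `W` nothing needs to be done, since `W = [δ, D]`.

The link between the two sides is the formula for `δ` on words (`derDelta_eq`). It is obtained by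
transporting each elementary operation on bimoulds to words; the transport reverses the order of
composition (`wordMap_comp`). -/

namespace FormalMES

open scoped TensorProduct

noncomputable section

/-! ### Deconcatenation -/

/-- The linear span of the letters. -/
abbrev LetterSpan : Type := Letter →₀ ℚ

/-- Concatenation with a linear combination of letters on the left. -/
def consM : LetterSpan →ₗ[ℚ] QA →ₗ[ℚ] QA :=
  Finsupp.lift (QA →ₗ[ℚ] QA) ℚ Letter consL

theorem consM_single (a : Letter) : consM (Finsupp.single a 1) = consL a := by
  simp [consM]

theorem consM_single_smul (a : Letter) (q : ℚ) : consM (Finsupp.single a q) = q • consL a := by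
  simp [consM]

/-- Letterwise multiplication by the letter `b`. -/
def shift (b : Letter) : LetterSpan →ₗ[ℚ] LetterSpan := Finsupp.lmapDomain ℚ ℚ (· + b)

theorem shift_single (a b : Letter) (q : ℚ) :
    shift b (Finsupp.single a q) = Finsupp.single (a + b) q := by
  simp [shift]

theorem consM_mul_consL (ℓ : LetterSpan) (b : Letter) (z y : QA) :
    consM ℓ z * consL b y = consM ℓ (z * consL b y) + consL b (consM ℓ z * y)
      + consM (shift b ℓ) (z * y) := by
  induction ℓ using Finsupp.induction_linear with
  | zero => simp
  | add f g hf hg =>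
    simp only [map_add, LinearMap.add_apply, add_mul, hf, hg]
    abel
  | single a q =>
    rw [shift_single, consM_single_smul, consM_single_smul]
    simp only [LinearMap.smul_apply, smul_mul_assoc, consL_mul_consL, smul_add, map_smul]
    rfl

/-- The counit: the coefficient of the empty word. -/
def counit : QA →ₗ[ℚ] ℚ := linExt fun w => if w = [] then 1 else 0

theorem counit_one : counit 1 = 1 := by
  rw [one_def', counit, linExt_word, if_pos rfl]

theorem counit_consL (a : Letter) (x : QA) : counit (consL a x) = 0 := by
  have h : counit ∘ₗ consL a = 0 := hom_ext fun w => by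
    simp [consL_word, counit, linExt_word]
  exact congrArg (fun F => F x) h

/-- The deconcatenation of a word. -/
def deconcatWord : Word → QA ⊗[ℚ] QA
  | [] => 1 ⊗ₜ 1
  | a :: w => 1 ⊗ₜ word (a :: w) + TensorProduct.map (consL a) LinearMap.id (deconcatWord w)

/-- The deconcatenation coproduct. -/
def deconcat : QA →ₗ[ℚ] QA ⊗[ℚ] QA := linExt deconcatWord

theorem deconcat_one : deconcat 1 = 1 ⊗ₜ 1 := linExt_word _ _

theorem deconcat_consL (a : Letter) (x : QA) : deconcat (consL a x) =
    1 ⊗ₜ consL a x + TensorProduct.map (consL a) LinearMap.id (deconcat x) := by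
  have h : deconcat ∘ₗ consL a = TensorProduct.mk ℚ QA QA 1 ∘ₗ consL a
      + TensorProduct.map (consL a) LinearMap.id ∘ₗ deconcat := hom_ext fun w => by
    simp [consL_word, deconcat, linExt_word, deconcatWord]
  exact congrArg (fun F => F x) h

/-- Prefixing acts in the left tensor factor only, so the stuffle recursion carries over to the
tensor square, with the right factors simply multiplied. -/
theorem map_consL_mul_map_consL (a b : Letter) (X Y : QA ⊗[ℚ] QA) :
    TensorProduct.map (consL a) LinearMap.id X * TensorProduct.map (consL b) LinearMap.id Y
      = TensorProduct.map (consL a) LinearMap.id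
          (X * TensorProduct.map (consL b) LinearMap.id Y)
        + TensorProduct.map (consL b) LinearMap.id
          (TensorProduct.map (consL a) LinearMap.id X * Y)
        + TensorProduct.map (consL (a + b)) LinearMap.id (X * Y) := by
  induction X using TensorProduct.induction_on with
  | zero => simp
  | add X X' h h' =>
    simp only [map_add, add_mul, h, h']
    abel
  | tmul x₁ x₂ =>
    induction Y using TensorProduct.induction_on with
    | zero => simp
    | add Y Y' h h' =>
      simp only [map_add, mul_add, h, h']
      abel
    | tmul y₁ y₂ =>
      simp only [TensorProduct.map_tmul, Algebra.TensorProduct.tmul_mul_tmul, LinearMap.id_apply,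
        consL_mul_consL, TensorProduct.add_tmul]
      rfl

theorem one_tmul_mul_map_consL (b : Letter) (z : QA) (Y : QA ⊗[ℚ] QA) :
    (1 ⊗ₜ z) * TensorProduct.map (consL b) LinearMap.id Y
      = TensorProduct.map (consL b) LinearMap.id ((1 ⊗ₜ z) * Y) := by
  induction Y using TensorProduct.induction_on with
  | zero => simp
  | add Y Y' h h' => simp only [map_add, mul_add, h, h']
  | tmul y₁ y₂ => simp [Algebra.TensorProduct.tmul_mul_tmul]

/-- The induction principle for bilinear statements about stuffle products. -/
theorem stuffle_induction {P : QA → QA → Prop}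
    (hadd : ∀ x x' y, P x y → P x' y → P (x + x') y) (hsmul : ∀ (q : ℚ) x y, P x y → P (q • x) y)
    (hadd' : ∀ x y y', P x y → P x y' → P x (y + y')) (hsmul' : ∀ (q : ℚ) x y, P x y → P x (q • y))
    (hl : ∀ y, P 1 y) (hr : ∀ x, P x 1)
    (hc : ∀ a b x y, P x (consL b y) → P (consL a x) y → P x y → P (consL a x) (consL b y))
    (x y : QA) : P x y := by
  induction x using QA.induction with
  | ha x x' h h' => exact hadd _ _ _ h h'
  | hs q x h => exact hsmul _ _ _ h
  | hw u =>
    induction y using QA.induction with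
    | ha y y' h h' => exact hadd' _ _ _ h h'
    | hs q y h => exact hsmul' _ _ _ h
    | hw v =>
      induction u, v using stuffle.induct with
      | case1 v => exact hl _
      | case2 a u => exact hr _
      | case3 a u b v h1 h2 h3 =>
        rw [← consL_word, ← consL_word]
        rw [← consL_word] at h1 h2
        exact hc _ _ _ _ h1 h2 h3

/-- Compatibility of deconcatenation with the stuffle product, by induction along the stuffle
recursion: both sides satisfy the same recursion, apart from the terms with empty left part. -/
theorem deconcat_mul (x y : QA) : deconcat (x * y) = deconcat x * deconcat y := by
  induction x, y using stuffle_induction with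
  | hadd x x' y h h' => simp only [add_mul, map_add, h, h']
  | hadd' x y y' h h' => simp only [mul_add, map_add, h, h']
  | hsmul q x y h => simp only [smul_mul_assoc, map_smul, h]
  | hsmul' q x y h => simp only [mul_smul_comm, map_smul, h]
  | hl y => rw [one_mul, deconcat_one, ← Algebra.TensorProduct.one_def, one_mul]
  | hr x => rw [mul_one, deconcat_one, ← Algebra.TensorProduct.one_def, mul_one]
  | hc a b x y h1 h2 h3 =>
    have e1 := deconcat_consL a x
    have e2 := deconcat_consL b y
    have e3 : deconcat (consL a x * consL b y) = 1 ⊗ₜ (consL a x * consL b y)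
        + TensorProduct.map (consL a) LinearMap.id (deconcat x * deconcat (consL b y))
        + TensorProduct.map (consL b) LinearMap.id (deconcat (consL a x) * deconcat y)
        + TensorProduct.map (consL (a + b)) LinearMap.id (deconcat x * deconcat y) := by
      rw [consL_mul_consL, ← h1, ← h2, ← h3]
      simp only [map_add, deconcat_consL, TensorProduct.tmul_add]
      change _ + (_ + TensorProduct.map (consL (a.1 + b.1, a.2 + b.2)) _ _) = _
      abel_nf
      rfl
    -- The product of the two expansions has four parts. The part with both prefixes nonempty
    -- follows the three-term recursion. The mixed parts, with one prefix empty, supply the terms `1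
    -- ⊗ b y` of `deconcat (b y)` and `1 ⊗ a x` of `deconcat (a x)` that occur on the other side.
    rw [e3, e1, e2]
    simp only [add_mul, mul_add, map_add, map_consL_mul_map_consL, one_tmul_mul_map_consL,
      mul_comm _ ((1 : QA) ⊗ₜ[ℚ] consL b y), Algebra.TensorProduct.tmul_mul_tmul, mul_one,
      mul_comm (consL b y) (consL a x)]
    abel

/-- `prefixOp t w = ∑ t(u) v`, the sum over all factorizations `w = u v`. -/
def prefixOp (t : QA →ₗ[ℚ] LetterSpan) : QA →ₗ[ℚ] QA :=
  TensorProduct.lift (consM ∘ₗ t) ∘ₗ deconcat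

theorem prefixOp_one (t : QA →ₗ[ℚ] LetterSpan) : prefixOp t 1 = consM (t 1) 1 := by
  simp [prefixOp, deconcat_one]

/-- A prefix of `a x` is empty or begins with `a`; in the second case it is a prefix of `x`
evaluated by `t ∘ₗ consL a`. Because `t` changes in this step, inductions on words have to quantify
over `t`. -/
theorem prefixOp_consL (t : QA →ₗ[ℚ] LetterSpan) (a : Letter) (x : QA) :
    prefixOp t (consL a x) = consM (t 1) (consL a x) + prefixOp (t ∘ₗ consL a) x := by
  simp only [prefixOp, LinearMap.comp_apply, deconcat_consL, map_add, TensorProduct.lift.tmul]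
  congr 1
  generalize deconcat x = X
  induction X using TensorProduct.induction_on with
  | zero => simp
  | add X X' h h' => simp only [map_add, h, h']
  | tmul x₁ x₂ => simp

theorem prefixOp_zero : prefixOp 0 = 0 := by
  simp only [prefixOp, LinearMap.comp_zero]
  ext x
  have : TensorProduct.lift (0 : QA →ₗ[ℚ] QA →ₗ[ℚ] QA) = 0 := by ext; simp
  rw [this]
  simp

/-- The coderivation `w ↦ ∑ u t(v) w'` over all factorizations `w = u v w'`, on words. -/
def coderWord (t : QA →ₗ[ℚ] LetterSpan) : Word → QA
  | [] => 0
  | a :: w => prefixOp t (word (a :: w)) + consL a (coderWord t w)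

/-- The coderivation `w ↦ ∑ u t(v) w'` over all factorizations `w = u v w'`. -/
def coder (t : QA →ₗ[ℚ] LetterSpan) : QA →ₗ[ℚ] QA := linExt (coderWord t)

/-- The recursion stops with `0` at the empty word, so an insertion of `t 1` at the end of a word is
not counted. This is immaterial when `t 1 = 0`, as for every letter derivation. -/
theorem coder_one (t : QA →ₗ[ℚ] LetterSpan) : coder t 1 = 0 := linExt_word _ _

theorem coder_consL (t : QA →ₗ[ℚ] LetterSpan) (a : Letter) (x : QA) :
    coder t (consL a x) = prefixOp t (consL a x) + consL a (coder t x) := by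
  have h : coder t ∘ₗ consL a = prefixOp t ∘ₗ consL a + consL a ∘ₗ coder t := hom_ext fun w => by
    simp [consL_word, coder, linExt_word, coderWord]
  exact congrArg (fun F => F x) h

/-- `t` satisfies the Leibniz rule with respect to the projection onto the letters. -/
def IsLetterDerivation (t : QA →ₗ[ℚ] LetterSpan) : Prop :=
  t 1 = 0 ∧ ∀ a b x y, t (consL a x * consL b y) =
    counit y • shift b (t (consL a x)) + counit x • shift a (t (consL b y))

/-- `∑ ε(u) v`. -/
def counitLeft : QA ⊗[ℚ] QA →ₗ[ℚ] QA :=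
  TensorProduct.lift (LinearMap.lsmul ℚ QA ∘ₗ counit)

theorem counitLeft_tmul (x y : QA) : counitLeft (x ⊗ₜ y) = counit x • y := by
  simp [counitLeft]

theorem counitLeft_deconcat (x : QA) : counitLeft (deconcat x) = x := by
  have h : counitLeft ∘ₗ deconcat = LinearMap.id := hom_ext fun w => by
    cases w with
    | nil =>
      rw [← one_def', LinearMap.comp_apply, deconcat_one, counitLeft_tmul, counit_one, one_smul]
      rfl
    | cons a w =>
      rw [← consL_word, LinearMap.comp_apply, deconcat_consL, map_add, counitLeft_tmul, counit_one,
        one_smul, LinearMap.id_apply, add_eq_left]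
      generalize deconcat (word w) = X
      induction X using TensorProduct.induction_on with
      | zero => simp
      | add X X' h h' => simp only [map_add, h, h', add_zero]
      | tmul x₁ x₂ => simp [counitLeft_tmul, counit_consL]
  exact congrArg (fun F => F x) h

/-- The stuffle recursion for `t(u) v * b y`, summed over `u ⊗ v`: in front stands a letter of
`t(u)`, or `b`, or the two merged. -/
theorem lift_mul_consL (t : QA →ₗ[ℚ] LetterSpan) (X : QA ⊗[ℚ] QA) (b : Letter) (y : QA) :
    TensorProduct.lift (consM ∘ₗ t) X * consL b y
      = TensorProduct.lift (consM ∘ₗ t) (X * (1 ⊗ₜ consL b y))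
        + consL b (TensorProduct.lift (consM ∘ₗ t) X * y)
        + TensorProduct.lift (consM ∘ₗ shift b ∘ₗ t) (X * (1 ⊗ₜ y)) := by
  induction X using TensorProduct.induction_on with
  | zero => simp
  | add X X' h h' =>
    simp only [map_add, add_mul, h, h']
    abel
  | tmul x₁ x₂ => simp [Algebra.TensorProduct.tmul_mul_tmul, consM_mul_consL]

/-- The only place where the Leibniz rule for `t` enters. It is applied to a product of two nonempty
prefixes; the counit in it forces one of them to be a single letter, so the corresponding remainder
is the whole tail, which `counitLeft` extracts. -/
theorem lift_map_mul_map {t : QA →ₗ[ℚ] LetterSpan} (ht : IsLetterDerivation t) (a b : Letter)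
    (X Y : QA ⊗[ℚ] QA) :
    TensorProduct.lift (consM ∘ₗ t)
        (TensorProduct.map (consL a) LinearMap.id X * TensorProduct.map (consL b) LinearMap.id Y)
      = TensorProduct.lift (consM ∘ₗ shift b ∘ₗ t)
          (TensorProduct.map (consL a) LinearMap.id X * (1 ⊗ₜ counitLeft Y))
        + TensorProduct.lift (consM ∘ₗ shift a ∘ₗ t)
          (TensorProduct.map (consL b) LinearMap.id Y * (1 ⊗ₜ counitLeft X)) := by
  induction X using TensorProduct.induction_on with
  | zero => simp
  | add X X' h h' =>
    simp only [map_add, add_mul, h, h', TensorProduct.tmul_add, mul_add]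
    abel
  | tmul x₁ x₂ =>
    induction Y using TensorProduct.induction_on with
    | zero => simp
    | add Y Y' h h' =>
      simp only [map_add, add_mul, h, h', TensorProduct.tmul_add, mul_add]
      abel
    | tmul y₁ y₂ =>
      simp only [TensorProduct.map_tmul, Algebra.TensorProduct.tmul_mul_tmul, ht.2,
        counitLeft_tmul, LinearMap.id_apply, TensorProduct.lift.tmul, LinearMap.comp_apply, mul_one,
        map_add, map_smul, mul_smul_comm, LinearMap.add_apply, LinearMap.smul_apply, mul_comm y₂ x₂]

/-- By `deconcat_mul`, a prefix of the product is a product of prefixes. If one is empty, the image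
under `t` of the other stands in front. If neither is empty, the Leibniz rule merges the image of
one with the first letter of the other word. These are exactly the terms of `prefixOp t (a x) * b y`
that do not begin with `b` alone, and symmetrically those of `a x * prefixOp t (b y)` that do not
begin with `a` alone. -/
theorem prefixOp_mul {t : QA →ₗ[ℚ] LetterSpan} (ht : IsLetterDerivation t) (a b : Letter)
    (x y : QA) : prefixOp t (consL a x * consL b y) =
      prefixOp t (consL a x) * consL b y - consL b (prefixOp t (consL a x) * y)
      + (consL a x * prefixOp t (consL b y) - consL a (x * prefixOp t (consL b y))) := by
  have key : ∀ (c : Letter) (z : QA), prefixOp t (consL c z)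
      = TensorProduct.lift (consM ∘ₗ t) (TensorProduct.map (consL c) LinearMap.id (deconcat z)) :=
    fun c z => by
      simp [prefixOp, deconcat_consL, ht.1]
  rw [mul_comm (consL a x) (prefixOp _ _), mul_comm x (prefixOp _ _), key, key, lift_mul_consL,
    lift_mul_consL, prefixOp, LinearMap.comp_apply, deconcat_mul, deconcat_consL, deconcat_consL]
  simp only [add_mul, mul_add, map_add, lift_map_mul_map ht, counitLeft_deconcat,
    Algebra.TensorProduct.tmul_mul_tmul, one_mul, TensorProduct.lift.tmul, LinearMap.comp_apply,
    ht.1, map_zero, LinearMap.zero_apply, mul_comm ((1 : QA) ⊗ₜ[ℚ] consL a x)]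
  abel

/-- `coder t` commutes with prefixing a letter up to `prefixOp t`. In the induction along the
stuffle recursion only these defects have to be compared, and `prefixOp_mul` says that they match.
-/
theorem coder_isStuffleDerivation {t : QA →ₗ[ℚ] LetterSpan} (ht : IsLetterDerivation t) :
    IsStuffleDerivation (coder t) := by
  intro x y
  induction x, y using stuffle_induction with
  | hadd x x' y h h' => simp only [add_mul, map_add, h, h']; abel
  | hadd' x y y' h h' => simp only [mul_add, map_add, h, h']; abel
  | hsmul q x y h => simp only [smul_mul_assoc, map_smul, h, smul_add]
  | hsmul' q x y h => simp only [mul_smul_comm, map_smul, h, smul_add]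
  | hl y => simp [coder_one]
  | hr x => simp [coder_one]
  | hc a b x y h1 h2 h3 =>
    have e : coder t (consL a x * consL b y) = prefixOp t (consL a x * consL b y)
        + consL a (coder t (x * consL b y)) + consL b (coder t (consL a x * y))
        + consL (a.1 + b.1, a.2 + b.2) (coder t (x * y)) := by
      rw [consL_mul_consL]
      simp only [map_add, coder_consL]
      abel
    rw [e, prefixOp_mul ht, h1, h2, h3]
    simp only [coder_consL, add_mul, mul_add, map_add, consL_mul_consL]
    abel

/-! ### Operators that strip a suffix -/

/-- The operator `w ↦ ∑ u ε(v)` over all factorizations `w = u v` with `v ≠ 1`, on words. -/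
def suffixWord (ε : QA →ₗ[ℚ] ℚ) : Word → QA
  | [] => 0
  | a :: w => ε (word (a :: w)) • 1 + consL a (suffixWord ε w)

/-- The operator `w ↦ ∑ u ε(v)` over all factorizations `w = u v` with `v ≠ 1`. -/
def suffixOp (ε : QA →ₗ[ℚ] ℚ) : QA →ₗ[ℚ] QA := linExt (suffixWord ε)

theorem suffixOp_one (ε : QA →ₗ[ℚ] ℚ) : suffixOp ε 1 = 0 := linExt_word _ _

theorem suffixOp_consL (ε : QA →ₗ[ℚ] ℚ) (a : Letter) (x : QA) :
    suffixOp ε (consL a x) = ε (consL a x) • 1 + consL a (suffixOp ε x) := by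
  have h : suffixOp ε ∘ₗ consL a = (ε ∘ₗ consL a).smulRight 1 + consL a ∘ₗ suffixOp ε :=
    hom_ext fun w => by
      simp [consL_word, suffixOp, linExt_word, suffixWord]
  exact congrArg (fun F => F x) h

/-- Here the defect of commuting with prefixing is the scalar `ε` of the whole word. The hypothesis
makes it vanish on products, while on the right-hand side the scalar terms are precisely those
produced by the two factors. -/
theorem suffixOp_isStuffleDerivation {ε : QA →ₗ[ℚ] ℚ}
    (hε : ∀ a b x y, ε (consL a x * consL b y) = 0) :
    IsStuffleDerivation (suffixOp ε) := by
  intro x y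
  induction x, y using stuffle_induction with
  | hadd x x' y h h' => simp only [add_mul, map_add, h, h']; abel
  | hadd' x y y' h h' => simp only [mul_add, map_add, h, h']; abel
  | hsmul q x y h => simp only [smul_mul_assoc, map_smul, h, smul_add]
  | hsmul' q x y h => simp only [mul_smul_comm, map_smul, h, smul_add]
  | hl y => simp [suffixOp_one]
  | hr x => simp [suffixOp_one]
  | hc a b x y h1 h2 h3 =>
    have e : suffixOp ε (consL a x * consL b y) = ε (consL a x * consL b y) • 1
        + consL a (suffixOp ε (x * consL b y)) + consL b (suffixOp ε (consL a x * y))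
        + consL (a.1 + b.1, a.2 + b.2) (suffixOp ε (x * y)) := by
      rw [consL_mul_consL]
      simp only [map_add, suffixOp_consL, add_smul]
      abel
    rw [e, hε, h1, h2, h3]
    simp only [suffixOp_consL, add_mul, mul_add, map_add, consL_mul_consL, smul_mul_assoc,
      mul_smul_comm, one_mul, mul_one, map_smul]
    module

/-! ### Letter derivations supported on short words -/

/-- Every word in a stuffle product is at least as long as each factor. The map `t` and the bound
`n` vary because the induction passes to `t ∘ₗ consL a` and `n - 1`. -/
theorem map_stuffle_eq_zero {M : Type} [AddCommGroup M] [Module ℚ M] (u v : Word) :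
    ∀ (t : QA →ₗ[ℚ] M) (n : ℕ), (∀ w : Word, n ≤ w.length → t (word w) = 0) → n ≤ u.length →
      t (stuffle u v) = 0 := by
  induction u, v using stuffle.induct with
  | case1 v =>
    intro t n ht hn
    simp only [List.length_nil, nonpos_iff_eq_zero] at hn
    rw [stuffle, ht v (by omega)]
  | case2 a u =>
    intro t n ht hn
    rw [stuffle, ht _ hn]
  | case3 a u b v h1 h2 h3 =>
    intro t n ht hn
    have hc : ∀ (c : Letter) (w : Word), n - 1 ≤ w.length → (t ∘ₗ consL c) (word w) = 0 := by
      intro c w hw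
      rw [LinearMap.comp_apply, consL_word, ht]
      simp only [List.length_cons]
      omega
    simp only [List.length_cons] at hn
    have e1 := h1 (t ∘ₗ consL a) (n - 1) (hc a) (by omega)
    have e2 := h2 (t ∘ₗ consL b) (n - 1) (hc b) (by simp only [List.length_cons]; omega)
    have e3 := h3 (t ∘ₗ consL (a.1 + b.1, a.2 + b.2)) (n - 1) (hc _) (by omega)
    rw [LinearMap.comp_apply] at e1 e2 e3
    rw [stuffle, map_add, map_add, e1, e2, e3, add_zero, add_zero]

/-- Reduces the Leibniz rule to finitely many lengths: by bilinearity to words, by commutativity to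
the case where the first word is not longer, and by the support of `t` to words of length less than
`n`. -/
theorem isLetterDerivation_of_short {t : QA →ₗ[ℚ] LetterSpan} (n : ℕ) (h0 : t 1 = 0)
    (ht : ∀ w : Word, n ≤ w.length → t (word w) = 0)
    (h : ∀ a b u v, u.length ≤ v.length → v.length + 1 < n → t (stuffle (a :: u) (b :: v)) =
      counit (word v) • shift b (t (word (a :: u)))
        + counit (word u) • shift a (t (word (b :: v)))) :
    IsLetterDerivation t := by
  refine ⟨h0, fun a b x y => ?_⟩
  have hc : ∀ v : Word, v ≠ [] → counit (word v) = 0 := fun v hv => by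
    rw [counit, linExt_word, if_neg hv]
  have h' : ∀ a b u v, u.length ≤ v.length → t (stuffle (a :: u) (b :: v)) =
      counit (word v) • shift b (t (word (a :: u)))
        + counit (word u) • shift a (t (word (b :: v))) := by
    intro a b u v huv
    by_cases hv : v.length + 1 < n
    · exact h a b u v huv hv
    · rw [ht (b :: v) (by simp only [List.length_cons]; omega), stuffle_comm,
        map_stuffle_eq_zero _ _ t n ht (by simp only [List.length_cons]; omega)]
      -- Only the term with `counit (word v)` is left. It is zero unless `v` is empty; then `u` is
      -- empty too and `n ≤ 1`, so `t` kills the letter `a`.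
      by_cases hv0 : v = []
      · subst hv0
        simp only [List.length_nil, nonpos_iff_eq_zero, List.length_eq_zero_iff] at huv
        rw [ht (a :: u) (by simp only [List.length_cons, List.length_nil, huv] at hv ⊢; omega)]
        simp
      · rw [hc v hv0]
        simp
  induction x using QA.induction with
  | ha x x' h1 h2 => simp only [map_add, add_mul, h1, h2, smul_add, add_smul]; abel
  | hs q x h1 =>
    simp only [map_smul, smul_mul_assoc, h1, smul_add, smul_eq_mul, mul_smul]
    simp only [smul_comm q]
  | hw u =>
    induction y using QA.induction with
    | ha y y' h1 h2 => simp only [map_add, mul_add, h1, h2, smul_add, add_smul]; abel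
    | hs q y h1 =>
      simp only [map_smul, mul_smul_comm, h1, smul_add, smul_eq_mul, mul_smul]
      simp only [smul_comm q]
    | hw v =>
      rw [consL_word, consL_word, word_mul_word]
      rcases le_total u.length v.length with huv | huv
      · exact h' a b u v huv
      · rw [stuffle_comm, h' b a v u huv, add_comm]

/-- The indicator of `k = 1`. -/
def isOne (a : Letter) : ℚ := if (a.1 : ℕ) = 1 then 1 else 0

/-- The indicator of `k = 2`. -/
def isTwo (a : Letter) : ℚ := if (a.1 : ℕ) = 2 then 1 else 0

theorem isOne_add (a b : Letter) : isOne (a.1 + b.1, a.2 + b.2) = 0 := by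
  have := a.1.pos
  have := b.1.pos
  rw [isOne, if_neg]
  simp only [PNat.add_coe]
  omega

theorem isTwo_add (a b : Letter) : isTwo (a.1 + b.1, a.2 + b.2) = isOne a * isOne b := by
  have := a.1.pos
  have := b.1.pos
  have h : (a.1 : ℕ) + b.1 = 2 ↔ (a.1 : ℕ) = 1 ∧ (b.1 : ℕ) = 1 := by omega
  simp only [isOne, isTwo, PNat.add_coe, h, ite_and, ite_mul, one_mul, zero_mul]

/-- The letter `(k - 1, d)` if `k > 1`, and `0` otherwise. -/
def lowerK (a : Letter) : LetterSpan :=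
  if 1 < (a.1 : ℕ) then Finsupp.single (((a.1 : ℕ) - 1).toPNat', a.2) 1 else 0

theorem toPNat'_sub_one_add (a b : ℕ+) (h : 1 < (a : ℕ)) :
    ((a : ℕ) - 1).toPNat' + b = ((a + b : ℕ+) - 1 : ℕ).toPNat' := by
  have := b.pos
  apply PNat.eq
  rw [PNat.add_coe, Nat.toPNat'_coe, Nat.toPNat'_coe, PNat.add_coe, if_pos, if_pos] <;> omega

theorem toPNat'_one_add_sub_one (a b : ℕ+) (h : (a : ℕ) = 1) :
    ((a + b : ℕ+) - 1 : ℕ).toPNat' = b := by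
  have := b.pos
  apply PNat.eq
  rw [Nat.toPNat'_coe, PNat.add_coe, if_pos] <;> omega

/-- `lowerK` of a product of letters, with independent lower entries. -/
theorem lowerK_add (a b : Letter) (d : ℕ) : lowerK (a.1 + b.1, a.2 + d)
    = shift a (lowerK (b.1, d)) + isOne b • Finsupp.single (a.1, a.2 + d) 1 := by
  have ha := a.1.pos
  have hb := b.1.pos
  rw [lowerK, if_pos (by simp only [PNat.add_coe]; omega), lowerK, isOne]
  by_cases h : (b.1 : ℕ) = 1
  · rw [if_neg (by simp only; omega), if_pos h]
    simp only [map_zero, zero_add, one_smul]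
    rw [add_comm a.1 b.1, toPNat'_one_add_sub_one _ _ h]
  · rw [if_pos (by simp only; omega), if_neg h, shift_single]
    simp only [zero_smul, add_zero]
    rw [add_comm a.1 b.1, ← toPNat'_sub_one_add _ _ (by omega), add_comm a.2]
    rfl

/-- Guards truncated subtraction: an entry such as `d - 1` only occurs with the coefficient `d`, so
identities between letters are needed for `d ≠ 0` only. -/
theorem mul_natCast_smul_congr {M : Type} [AddCommGroup M] [Module ℚ M] {n : ℕ} {c : ℚ} {x y : M}
    (h : n ≠ 0 → x = y) : (c * n) • x = (c * n) • y := by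
  by_cases hn : n = 0
  · simp [hn]
  · rw [h hn]

theorem smul_lowerK_add (a b : Letter) (n : ℕ) :
    (n : ℚ) • lowerK (a.1 + b.1, a.2 + n - 1) = (n : ℚ) • shift a (lowerK (b.1, n - 1))
      + (isOne b * n) • Finsupp.single (a.1, a.2 + n - 1) 1 := by
  rcases n with _ | n
  · simp
  · have h := lowerK_add a b n
    simp only [Nat.add_sub_cancel, ← add_assoc] at h ⊢
    rw [h]
    module

/-- The one- and two-letter part of `δ¹`. -/
def letter1 : QA →ₗ[ℚ] LetterSpan := linExt fun w =>
  match w with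
  | [a] => (a.2 : ℚ) • lowerK (a.1, a.2 - 1)
  | [a, b] => -(1 / 2 : ℚ) • ((isOne b * b.2) • Finsupp.single (a.1, a.2 + b.2 - 1) 1
      + (isOne a * a.2) • Finsupp.single (b.1, a.2 + b.2 - 1) 1)
  | _ => 0

/-- The two-letter part of `δ⁴`. -/
def letter4 : QA →ₗ[ℚ] LetterSpan := linExt fun w =>
  match w with
  | [a, b] => isOne b • lowerK (a.1, a.2 + b.2) - isOne a • lowerK (b.1, a.2 + b.2)
  | _ => 0

/-- The two- and three-letter part of `δ⁵`. -/
def letter5 : QA →ₗ[ℚ] LetterSpan := linExt fun w =>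
  match w with
  | [a, b] => isTwo a • Finsupp.single (b.1, a.2 + b.2) 1
      - isTwo b • Finsupp.single (a.1, a.2 + b.2) 1
  | [a, b, c] => (1 / 2 : ℚ) •
      ((isOne b * isOne c) • Finsupp.single (a.1, a.2 + b.2 + c.2) 1
        - (isOne a * isOne b) • Finsupp.single (c.1, a.2 + b.2 + c.2) 1)
  | _ => 0

theorem counit_word_nil : counit (word []) = 1 := counit_one

theorem counit_word_cons (a : Letter) (w : Word) : counit (word (a :: w)) = 0 := by
  rw [← consL_word, counit_consL]

/-- The upper entry of a merged letter can always be lowered, that of `b` only if it exceeds `1`;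
the excess for upper entry `1` is recorded in `smul_lowerK_add`. The two-letter part cancels it. It
is evaluated on both `a b` and `b a`, whence the factor `-1/2`. -/
theorem letter1_isLetterDerivation : IsLetterDerivation letter1 := by
  refine isLetterDerivation_of_short 3 (linExt_word _ _) ?_ ?_
  · rintro (_ | ⟨a, _ | ⟨b, _ | ⟨c, w⟩⟩⟩) h <;>
      simp only [List.length_cons, List.length_nil] at h <;> try omega
    exact linExt_word _ _
  · rintro a b (_ | ⟨c, _ | ⟨c', u⟩⟩) (_ | ⟨d, _ | ⟨e, v⟩⟩) h h' <;>
      simp only [List.length_cons, List.length_nil] at h h' <;> try omega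
    · simp only [stuffle, consL_word, map_add, counit_word_nil, one_smul, letter1, linExt_word,
        map_smul]
      have e1 := smul_lowerK_add a b b.2
      have e2 := smul_lowerK_add b a a.2
      simp only [Nat.add_comm b.2, add_comm b.1] at e1 e2 ⊢
      push_cast
      rw [add_smul, e1, e2]
      module
    · simp only [stuffle, consL_word, map_add, counit_word_nil, one_smul, letter1, linExt_word,
        map_smul, counit_word_cons, zero_smul, zero_add, isOne_add]
      simp only [shift_single, zero_mul, zero_smul, smul_add, add_zero, zero_add, Prod.add_def]
      rw [mul_natCast_smul_congr (n := d.2)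
          (y := Finsupp.single (b.1 + a.1, b.2 + d.2 - 1 + a.2) 1),
        mul_natCast_smul_congr (n := b.2)
          (y := Finsupp.single (d.1 + a.1, b.2 + d.2 - 1 + a.2) 1)]
      · abel
      · intro h
        rw [add_comm d.1]
        congr 2
        omega
      · intro h
        rw [add_comm b.1]
        congr 2
        omega
    · simp [stuffle, consL_word, letter1, linExt_word, counit_word_cons, isOne_add]

/-- For two letters both sides vanish because `letter4` is antisymmetric. For `a * b d`, the words
`(a + b) d` and `b (a + d)` contribute the excess of `lowerK_add` with the same coefficient `isOne b
* isOne d` and opposite signs. -/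
theorem letter4_isLetterDerivation : IsLetterDerivation letter4 := by
  refine isLetterDerivation_of_short 3 (linExt_word _ _) ?_ ?_
  · rintro (_ | ⟨a, _ | ⟨b, _ | ⟨c, w⟩⟩⟩) h <;>
      simp only [List.length_cons, List.length_nil] at h <;> try omega
    exact linExt_word _ _
  · rintro a b (_ | ⟨c, _ | ⟨c', u⟩⟩) (_ | ⟨d, _ | ⟨e, v⟩⟩) h h' <;>
      simp only [List.length_cons, List.length_nil] at h h' <;> try omega
    · simp only [stuffle, consL_word, map_add, counit_word_nil, one_smul, letter4, linExt_word,
        map_zero]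
      simp only [add_comm b.2]
      abel
    · simp only [stuffle, consL_word, map_add, counit_word_nil, one_smul, letter4, linExt_word,
        counit_word_cons, zero_smul, zero_add, isOne_add]
      have e1 := lowerK_add a b (b.2 + d.2)
      have e2 := lowerK_add a d (b.2 + d.2)
      have e3 : a.2 + b.2 + d.2 = a.2 + (b.2 + d.2) := by ring
      have e4 : b.2 + (a.2 + d.2) = a.2 + (b.2 + d.2) := by ring
      rw [e3, e4, e1, e2]
      simp only [map_sub, map_smul, smul_add, smul_smul]
      module
    · simp [stuffle, consL_word, letter4, linExt_word, counit_word_cons, isOne_add]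

set_option linter.unusedSimpArgs false in
-- By `isTwo_add`, merging two letters with upper entry `1` creates an upper entry `2`. For `a * b
-- d` the resulting extra terms are cancelled by the three-letter part: over the three shuffles `a b
-- d`, `b a d`, `b d a`, each surviving half occurs twice.
theorem letter5_isLetterDerivation : IsLetterDerivation letter5 := by
  have p1 : ∀ x y : ℕ+, x + y = y + x := add_comm
  have p2 : ∀ x y z : ℕ+, x + (y + z) = y + (x + z) := add_left_comm
  have p3 : ∀ x y z : ℕ+, x + y + z = x + (y + z) := add_assoc
  refine isLetterDerivation_of_short 4 (linExt_word _ _) ?_ ?_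
  · rintro (_ | ⟨a, _ | ⟨b, _ | ⟨c, _ | ⟨d, w⟩⟩⟩⟩) h <;>
      simp only [List.length_cons, List.length_nil] at h <;> try omega
    exact linExt_word _ _
  · rintro a b (_ | ⟨c, _ | ⟨c', _ | ⟨c'', u⟩⟩⟩) (_ | ⟨d, _ | ⟨e, _ | ⟨f, v⟩⟩⟩) h h' <;>
      simp only [List.length_cons, List.length_nil] at h h' <;> try omega
    all_goals
      simp only [stuffle, consL_word, map_add, counit_word_nil, one_smul, letter5, linExt_word,
        map_smul, counit_word_cons, zero_smul, zero_add, isOne_add, isTwo_add, map_sub, map_zero,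
        shift_single, mul_zero, zero_mul, add_zero, sub_zero, zero_sub, smul_zero,
        sub_self, Prod.add_def]
    all_goals
      simp only [Nat.add_comm, Nat.add_left_comm, Nat.add_assoc, p1, p2, p3]
      try module

/-! ### The explicit maps as coderivations -/

/-- Ends the evaluation of `prefixOp`: once the longest words in the support of the original map
have been consumed, the remaining map sees the empty prefix only. -/
theorem prefixOp_of_support {t : QA →ₗ[ℚ] LetterSpan} (ht : ∀ a w, t (word (a :: w)) = 0) (x : QA) :
    prefixOp t x = consM (t 1) x := by
  have h : prefixOp t = consM (t 1) := hom_ext fun w => by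
    cases w with
    | nil => rw [← one_def', prefixOp_one]
    | cons a w =>
      have h0 : t ∘ₗ consL a = 0 := hom_ext fun v => by
        rw [LinearMap.comp_apply, consL_word, ht, LinearMap.zero_apply]
      rw [← consL_word, prefixOp_consL, h0, prefixOp_zero, LinearMap.zero_apply, add_zero]
  rw [h]

theorem prefixOp_word_cons (t : QA →ₗ[ℚ] LetterSpan) (a : Letter) (w : Word) :
    prefixOp t (word (a :: w)) = consM (t 1) (word (a :: w)) + prefixOp (t ∘ₗ consL a) (word w) := by
  rw [← consL_word, prefixOp_consL]

theorem comp_consL_one {M : Type} [AddCommGroup M] [Module ℚ M] (t : QA →ₗ[ℚ] M) (a : Letter) :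
    (t ∘ₗ consL a) 1 = t (word [a]) := by
  rw [LinearMap.comp_apply, one_def', consL_word]

theorem comp_consL_word {M : Type} [AddCommGroup M] [Module ℚ M] (t : QA →ₗ[ℚ] M) (a : Letter)
    (w : Word) : (t ∘ₗ consL a) (word w) = t (word (a :: w)) := by
  rw [LinearMap.comp_apply, consL_word]

theorem kk_cons_zero (a : Letter) (w : Word) : kk (a :: w) 0 = a.1 := rfl

theorem kk_cons_succ (a : Letter) (w : Word) (j : ℕ) : kk (a :: w) (j + 1) = kk w j := by
  simp [kk]

theorem dd_cons_zero (a : Letter) (w : Word) : dd (a :: w) 0 = a.2 := rfl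

theorem dd_cons_succ (a : Letter) (w : Word) (j : ℕ) : dd (a :: w) (j + 1) = dd w j := by
  simp [dd]

theorem repl_cons_succ (a : Letter) (w : Word) (j m k d : ℕ) :
    repl (a :: w) (j + 1) m k d = consL a (repl w j m k d) := by
  rw [repl, repl, consL_word, add_right_comm, List.drop_succ_cons, List.take_succ_cons,
    List.cons_append]

theorem repl_zero (w : Word) (m k d : ℕ) : repl w 0 m k d = word ((k.toPNat', d) :: w.drop m) := by
  rw [repl, List.take_zero, List.nil_append, zero_add]

/-- For a sum over windows of `m + 1` consecutive letters, this separates the window at the front,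
which exists exactly when `m ≤ w.length`, from the windows of `w`. The front window will be the
`prefixOp` term of a coderivation. -/
theorem sum_range_length_cons {f : Word → ℕ → QA} {a : Letter} {w : Word}
    (hf : ∀ j, f (a :: w) (j + 1) = consL a (f w j)) (m : ℕ) :
    ∑ j ∈ Finset.range ((a :: w).length - m), f (a :: w) j
      = (if m ≤ w.length then f (a :: w) 0 else 0)
        + consL a (∑ j ∈ Finset.range (w.length - m), f w j) := by
  rw [List.length_cons]
  by_cases h : m ≤ w.length
  · rw [if_pos h, Nat.sub_add_comm h, Finset.sum_range_succ', map_sum, add_comm]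
    simp only [hf]
  · rw [if_neg h, Nat.sub_eq_zero_of_le (by omega), Nat.sub_eq_zero_of_le (by omega)]
    simp

theorem sum_range_length_cons_zero {f : Word → ℕ → QA} {a : Letter} {w : Word}
    (hf : ∀ j, f (a :: w) (j + 1) = consL a (f w j)) :
    ∑ j ∈ Finset.range (a :: w).length, f (a :: w) j
      = f (a :: w) 0 + consL a (∑ j ∈ Finset.range w.length, f w j) := by
  have h := sum_range_length_cons hf 0
  simpa only [Nat.sub_zero, Nat.zero_le, if_true] using h

theorem eq_coder {T : QA →ₗ[ℚ] QA} {t : QA →ₗ[ℚ] LetterSpan} (h0 : T (word []) = 0)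
    (h : ∀ a w, T (word (a :: w)) = prefixOp t (word (a :: w)) + consL a (T (word w))) :
    T = coder t := hom_ext fun w => by
  induction w with
  | nil => rw [h0, ← one_def', coder_one]
  | cons a w ih => rw [h, ← consL_word, coder_consL, ih]

theorem consM_lowerK (k : ℕ+) (d : ℕ) (x : QA) : consM (lowerK (k, d)) x =
    if 1 < (k : ℕ) then consL (((k : ℕ) - 1).toPNat', d) x else 0 := by
  rw [lowerK]
  split_ifs <;> simp [consM_single]

theorem toPNat'_coe_pnat (k : ℕ+) : (k : ℕ).toPNat' = k := by
  apply PNat.eq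
  rw [Nat.toPNat'_coe, if_pos k.pos]

theorem ite_eq_isOne_smul (a : Letter) (x : QA) :
    (if (a.1 : ℕ) = 1 then x else 0) = isOne a • x := by
  rw [isOne, ite_smul, one_smul, zero_smul]

theorem ite_eq_isTwo_smul (a : Letter) (x : QA) :
    (if (a.1 : ℕ) = 2 then x else 0) = isTwo a • x := by
  rw [isTwo, ite_smul, one_smul, zero_smul]

theorem prefixOp_letter1 (a : Letter) (w : Word) : prefixOp letter1 (word (a :: w)) =
    consM (letter1 (word [a])) (word w) +
      match w with
      | [] => 0
      | b :: v => consM (letter1 (word [a, b])) (word v) := by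
  rw [prefixOp_word_cons, letter1_isLetterDerivation.1, map_zero, LinearMap.zero_apply, zero_add]
  cases w with
  | nil => rw [← one_def', prefixOp_one, comp_consL_one, add_zero]
  | cons b v =>
    rw [prefixOp_word_cons, prefixOp_of_support, comp_consL_one, comp_consL_one, comp_consL_word]
    intro c u
    rw [comp_consL_word, comp_consL_word]
    exact linExt_word _ _

theorem prefixOp_letter4 (a : Letter) (w : Word) : prefixOp letter4 (word (a :: w)) =
      match w with
      | [] => 0
      | b :: v => consM (letter4 (word [a, b])) (word v) := by
  have h1 : letter4 (word [a]) = 0 := linExt_word _ _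
  rw [prefixOp_word_cons, letter4_isLetterDerivation.1, map_zero, LinearMap.zero_apply, zero_add]
  cases w with
  | nil => rw [← one_def', prefixOp_one, comp_consL_one, h1, map_zero, LinearMap.zero_apply]
  | cons b v =>
    rw [prefixOp_word_cons, prefixOp_of_support, comp_consL_one, comp_consL_one, comp_consL_word,
      h1, map_zero, LinearMap.zero_apply, zero_add]
    intro c u
    rw [comp_consL_word, comp_consL_word]
    exact linExt_word _ _

theorem prefixOp_letter5 (a : Letter) (w : Word) : prefixOp letter5 (word (a :: w)) =
      match w with
      | [] => 0
      | [b] => consM (letter5 (word [a, b])) 1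
      | b :: c :: v => consM (letter5 (word [a, b])) (word (c :: v))
          + consM (letter5 (word [a, b, c])) (word v) := by
  have h1 : letter5 (word [a]) = 0 := linExt_word _ _
  rw [prefixOp_word_cons, letter5_isLetterDerivation.1, map_zero, LinearMap.zero_apply, zero_add]
  rcases w with _ | ⟨b, _ | ⟨c, v⟩⟩
  · rw [← one_def', prefixOp_one, comp_consL_one, h1, map_zero, LinearMap.zero_apply]
  · rw [prefixOp_word_cons, comp_consL_one, h1, map_zero, LinearMap.zero_apply, zero_add,
      ← one_def', prefixOp_one, comp_consL_one, comp_consL_word]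
  · rw [prefixOp_word_cons, comp_consL_one, h1, map_zero, LinearMap.zero_apply, zero_add,
      prefixOp_word_cons, prefixOp_of_support, comp_consL_one, comp_consL_one, comp_consL_word,
      comp_consL_word, comp_consL_word]
    intro d u
    rw [comp_consL_word, comp_consL_word, comp_consL_word]
    exact linExt_word _ _

theorem delta1_eq_coder : delta1 = coder letter1 := by
  refine eq_coder ?_ fun a w => ?_
  · simp [delta1, linExt_word]
  · rw [prefixOp_letter1]
    simp only [delta1, linExt_word]
    rw [sum_range_length_cons_zero (w := w) (f := fun w j => if 1 < kk w j then
        (dd w j : ℚ) • repl w j 1 (kk w j - 1) (dd w j - 1) else 0),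
      sum_range_length_cons (w := w) (f := fun w j => if kk w (j + 1) = 1 then
        (dd w (j + 1) : ℚ) • repl w j 2 (kk w j) (dd w j + dd w (j + 1) - 1) else 0),
      sum_range_length_cons (w := w) (f := fun w j => if kk w j = 1 then
        (dd w j : ℚ) • repl w j 2 (kk w (j + 1)) (dd w j + dd w (j + 1) - 1) else 0)]
    · rcases w with _ | ⟨b, v⟩
      · simp [letter1, linExt_word, kk, dd, repl, consM_lowerK, consL_word]
      · simp only [letter1, linExt_word, map_smul, LinearMap.smul_apply, consM_lowerK, consL_word,
          kk_cons_zero, dd_cons_zero, kk_cons_succ, dd_cons_succ, repl_zero, map_add,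
          LinearMap.add_apply, consM_single, ite_eq_isOne_smul, zero_add, toPNat'_coe_pnat,
          List.length_cons, List.drop_succ_cons, List.drop_zero, if_pos (Nat.le_add_left 1 _)]
        simp only [map_sub, map_smul, smul_ite, smul_zero]
        module
    all_goals
      intro j
      simp only [kk_cons_succ, dd_cons_succ, repl_cons_succ, apply_ite (consL a), map_smul, map_zero]

theorem delta4_eq_coder : delta4 = coder letter4 := by
  refine eq_coder ?_ fun a w => ?_
  · simp [delta4, linExt_word]
  · rw [prefixOp_letter4]
    simp only [delta4, linExt_word]
    rw [sum_range_length_cons (w := w) (f := fun w j => if kk w (j + 1) = 1 ∧ 1 < kk w j then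
        repl w j 2 (kk w j - 1) (dd w j + dd w (j + 1)) else 0),
      sum_range_length_cons (w := w) (f := fun w j => if kk w j = 1 ∧ 1 < kk w (j + 1) then
        repl w j 2 (kk w (j + 1) - 1) (dd w j + dd w (j + 1)) else 0)]
    · rcases w with _ | ⟨b, v⟩
      · simp
      · simp only [letter4, linExt_word, map_smul, LinearMap.smul_apply, consM_lowerK, consL_word,
          kk_cons_zero, dd_cons_zero, kk_cons_succ, dd_cons_succ, repl_zero,
          LinearMap.sub_apply, ite_eq_isOne_smul, map_sub, zero_add, ite_and,
          List.length_cons, List.drop_succ_cons, List.drop_zero, if_pos (Nat.le_add_left 1 _)]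
        module
    all_goals
      intro j
      simp only [kk_cons_succ, dd_cons_succ, repl_cons_succ, apply_ite (consL a), map_zero]

theorem delta5_eq_coder : delta5 = coder letter5 := by
  refine eq_coder ?_ fun a w => ?_
  · simp [delta5, linExt_word]
  · rw [prefixOp_letter5]
    simp only [delta5, linExt_word]
    rw [sum_range_length_cons (w := w) (f := fun w j => if kk w j = 2 then
        repl w j 2 (kk w (j + 1)) (dd w j + dd w (j + 1)) else 0),
      sum_range_length_cons (w := w) (f := fun w j => if kk w (j + 1) = 2 then
        repl w j 2 (kk w j) (dd w j + dd w (j + 1)) else 0),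
      sum_range_length_cons (w := w) (f := fun w j => if kk w (j + 1) = 1 ∧ kk w (j + 2) = 1 then
        repl w j 3 (kk w j) (dd w j + dd w (j + 1) + dd w (j + 2)) else 0),
      sum_range_length_cons (w := w) (f := fun w j => if kk w j = 1 ∧ kk w (j + 1) = 1 then
        repl w j 3 (kk w (j + 2)) (dd w j + dd w (j + 1) + dd w (j + 2)) else 0)]
    · rcases w with _ | ⟨b, _ | ⟨c, v⟩⟩
      · simp
      · simp [letter5, linExt_word, kk, dd, repl, consM_single_smul, one_def',
          ite_eq_isTwo_smul, consL_word]
      · have e2 : ∀ (u : Word) (x : Letter), kk (x :: u) 2 = kk u 1 := fun u x => kk_cons_succ x u 1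
        have e3 : ∀ (u : Word) (x : Letter), dd (x :: u) 2 = dd u 1 := fun u x => dd_cons_succ x u 1
        simp only [letter5, linExt_word, map_smul, LinearMap.smul_apply, consL_word,
          kk_cons_zero, dd_cons_zero, kk_cons_succ, dd_cons_succ, repl_zero, e2, e3,
          LinearMap.sub_apply, map_sub, zero_add, toPNat'_coe_pnat, map_add,
          ite_eq_isOne_smul, ite_eq_isTwo_smul, List.length_cons, List.drop_succ_cons, List.drop_zero, ite_and,
          consM_single, le_add_iff_nonneg_left, zero_le, if_true]
        module
    all_goals
      intro j
      simp only [kk_cons_succ, dd_cons_succ, repl_cons_succ, apply_ite (consL a), map_zero,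
        add_right_comm j 1]

/-- A suffix of `a :: w` is the whole word or a suffix of `w`. This is the recursion that defines
`suffixOp`. -/
theorem strip_cons (l : Word) (a : Letter) (w : Word) :
    (if l <:+ a :: w then word ((a :: w).take ((a :: w).length - l.length)) else 0)
      = (if l = a :: w then 1 else 0)
        + consL a (if l <:+ w then word (w.take (w.length - l.length)) else 0) := by
  by_cases h : l <:+ w
  · have hle := h.length_le
    have hne : l ≠ a :: w := fun h' => by
      rw [h', List.length_cons] at hle
      omega
    rw [if_pos h, if_pos (List.suffix_cons_iff.2 (Or.inr h)), if_neg hne, consL_word, zero_add,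
      List.length_cons, Nat.sub_add_comm hle, List.take_succ_cons]
  · by_cases h' : l = a :: w
    · rw [if_neg h, if_pos h', if_pos (List.suffix_cons_iff.2 (Or.inl h')), h', Nat.sub_self,
        map_zero, add_zero, List.take_zero]
      rfl
    · rw [if_neg h, if_neg h', if_neg (fun h'' => (List.suffix_cons_iff.1 h'').elim h' h),
        map_zero, add_zero]

/-- The coefficient extraction behind `δ²`. -/
def eps2 : QA →ₗ[ℚ] ℚ := linExt fun w =>
  (if [((2 : ℕ+), 0)] = w then 1 else 0)
    - (1 / 2 : ℚ) * (if [((1 : ℕ+), 0), ((1 : ℕ+), 0)] = w then 1 else 0)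

/-- The coefficient extraction behind `δ³`. -/
def eps3 : QA →ₗ[ℚ] ℚ := linExt fun w => if [((1 : ℕ+), 1)] = w then 1 else 0

theorem eq_suffixOp {T : QA →ₗ[ℚ] QA} {ε : QA →ₗ[ℚ] ℚ} (h0 : T (word []) = 0)
    (h : ∀ a w, T (word (a :: w)) = ε (word (a :: w)) • 1 + consL a (T (word w))) :
    T = suffixOp ε := hom_ext fun w => by
  induction w with
  | nil => rw [h0, ← one_def', suffixOp_one]
  | cons a w ih => rw [h, ← consL_word, suffixOp_consL, ih]

theorem delta2_eq_suffixOp : delta2 = suffixOp eps2 := by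
  refine eq_suffixOp ?_ fun a w => ?_
  · simp [delta2, linExt_word]
  · have e1 := strip_cons [((2 : ℕ+), 0)] a w
    have e2 := strip_cons [((1 : ℕ+), 0), ((1 : ℕ+), 0)] a w
    simp only [List.length_cons, List.length_nil, zero_add, Nat.reduceAdd] at e1 e2
    simp only [delta2, eps2, linExt_word, List.length_cons, e1, e2, map_sub, map_smul, sub_smul,
      mul_smul, ite_smul, one_smul, zero_smul]
    module

theorem delta3_eq_suffixOp : delta3 = suffixOp eps3 := by
  refine eq_suffixOp ?_ fun a w => ?_
  · simp [delta3, linExt_word]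
  · have e1 := strip_cons [((1 : ℕ+), 1)] a w
    simp only [List.length_cons, List.length_nil, zero_add] at e1
    simp only [delta3, eps3, linExt_word, List.length_cons, e1, ite_smul, one_smul, zero_smul]

theorem map_mul_eq_zero_of_short {ε : QA →ₗ[ℚ] ℚ} (n : ℕ)
    (hε : ∀ w : Word, n ≤ w.length → ε (word w) = 0)
    (h : ∀ a b u v, u.length ≤ v.length → v.length + 1 < n →
      ε (stuffle (a :: u) (b :: v)) = 0) (a b : Letter) (x y : QA) :
    ε (consL a x * consL b y) = 0 := by
  have h' : ∀ a b u v, u.length ≤ v.length → ε (stuffle (a :: u) (b :: v)) = 0 := by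
    intro a b u v huv
    by_cases hv : v.length + 1 < n
    · exact h a b u v huv hv
    · rw [stuffle_comm]
      exact map_stuffle_eq_zero _ _ ε n hε (by simp only [List.length_cons]; omega)
  induction x using QA.induction with
  | ha x x' h1 h2 => simp only [map_add, add_mul, h1, h2, add_zero]
  | hs q x h1 => simp only [map_smul, smul_mul_assoc, h1, smul_zero]
  | hw u =>
    induction y using QA.induction with
    | ha y y' h1 h2 => simp only [map_add, mul_add, h1, h2, add_zero]
    | hs q y h1 => simp only [map_smul, mul_smul_comm, h1, smul_zero]
    | hw v =>
      rw [consL_word, consL_word, word_mul_word]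
      rcases le_total u.length v.length with huv | huv
      · exact h' a b u v huv
      · rw [stuffle_comm, h' b a v u huv]

theorem add_eq_two_zero_iff (a b : Letter) :
    (((2 : ℕ+), 0) : Letter) = (a.1 + b.1, a.2 + b.2) ↔ ((1 : ℕ+), 0) = a ∧ ((1 : ℕ+), 0) = b := by
  have ha := a.1.pos
  have hb := b.1.pos
  simp only [Prod.ext_iff, ← PNat.coe_inj, PNat.add_coe, PNat.val_ofNat]
  omega

theorem one_eq_add_iff (a b : ℕ+) : 1 = a + b ↔ False := by
  have ha := a.pos
  have hb := b.pos
  rw [← PNat.coe_inj, PNat.add_coe, PNat.one_coe, iff_false]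
  omega

/-- The one product seen by `eps2` is `[1;0] * [1;0] = 2 [1,1;0,0] + [2;0]`, and the coefficient
`-1/2` is chosen so that its two terms cancel. In longer products a merged letter has upper entry at
least `2`, so `[1,1;0,0]` does not occur. -/
theorem eps2_mul (a b : Letter) (x y : QA) : eps2 (consL a x * consL b y) = 0 := by
  refine map_mul_eq_zero_of_short 3 ?_ ?_ a b x y
  · rintro (_ | ⟨a, _ | ⟨b, _ | ⟨c, w⟩⟩⟩) h <;>
      simp only [List.length_cons, List.length_nil] at h <;> try omega
    simp [eps2, linExt_word]
  · rintro a b (_ | ⟨c, _ | ⟨c', u⟩⟩) (_ | ⟨d, _ | ⟨e, v⟩⟩) h h' <;>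
      simp only [List.length_cons, List.length_nil] at h h' <;> try omega
    · simp only [stuffle, consL_word, map_add, eps2, linExt_word, List.cons.injEq, and_true,
        add_eq_two_zero_iff, reduceCtorEq, and_false, if_false, and_comm (a := _ = b), true_and, false_and]
      ring
    · simp [stuffle, consL_word, eps2, linExt_word, one_eq_add_iff]
    · simp [stuffle, consL_word, eps2, linExt_word, one_eq_add_iff]

/-- A product of nonempty words contains single letters only by merging, and these have upper entry
at least `2`. -/
theorem eps3_mul (a b : Letter) (x y : QA) : eps3 (consL a x * consL b y) = 0 := by
  refine map_mul_eq_zero_of_short 2 ?_ ?_ a b x y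
  · rintro (_ | ⟨a, _ | ⟨b, w⟩⟩) h <;>
      simp only [List.length_cons, List.length_nil] at h <;> try omega
    simp [eps3, linExt_word]
  · rintro a b (_ | ⟨c, u⟩) (_ | ⟨d, v⟩) h h' <;>
      simp only [List.length_cons, List.length_nil] at h h' <;> try omega
    simp [stuffle, consL_word, eps3, linExt_word, one_eq_add_iff]

/-! ### Letterwise derivations and commutators -/

/-- The extension by zero of a map on letters. -/
def letterOp (θ : Letter → LetterSpan) : QA →ₗ[ℚ] LetterSpan := linExt fun w =>
  match w with
  | [a] => θ a
  | _ => 0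

theorem letterOp_one (θ : Letter → LetterSpan) : letterOp θ 1 = 0 := linExt_word _ _

theorem letterOp_singleton (θ : Letter → LetterSpan) (a : Letter) :
    letterOp θ (word [a]) = θ a := linExt_word _ _

theorem letterOp_cons_cons (θ : Letter → LetterSpan) (a b : Letter) (w : Word) :
    letterOp θ (word (a :: b :: w)) = 0 := linExt_word _ _

theorem letterOp_isLetterDerivation {θ : Letter → LetterSpan}
    (hθ : ∀ a b : Letter, θ (a.1 + b.1, a.2 + b.2) = shift b (θ a) + shift a (θ b)) :
    IsLetterDerivation (letterOp θ) := by
  refine isLetterDerivation_of_short 2 (letterOp_one θ) ?_ ?_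
  · rintro (_ | ⟨a, _ | ⟨b, w⟩⟩) h <;>
      simp only [List.length_cons, List.length_nil] at h <;> try omega
    exact linExt_word _ _
  · rintro a b (_ | ⟨c, u⟩) (_ | ⟨d, v⟩) h h' <;>
      simp only [List.length_cons, List.length_nil] at h h' <;> try omega
    simp only [stuffle, consL_word, map_add, letterOp, linExt_word, counit_word_nil, one_smul, hθ,
      zero_add]

theorem prefixOp_letterOp_consL (θ : Letter → LetterSpan) (a : Letter) (x : QA) :
    prefixOp (letterOp θ) (consL a x) = consM (θ a) x := by
  rw [prefixOp_consL, letterOp_one, map_zero, LinearMap.zero_apply, zero_add,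
    prefixOp_of_support (fun b w => ?_), comp_consL_one]
  · congr 1
    rw [letterOp, linExt_word]
  · rw [comp_consL_word]
    exact linExt_word _ _

theorem coder_letterOp_consL (θ : Letter → LetterSpan) (a : Letter) (x : QA) :
    coder (letterOp θ) (consL a x) = consM (θ a) x + consL a (coder (letterOp θ) x) := by
  rw [coder_consL, prefixOp_letterOp_consL]

theorem coder_letterOp_consM (θ : Letter → LetterSpan) (ℓ : LetterSpan) (x : QA) :
    coder (letterOp θ) (consM ℓ x)
      = consM (Finsupp.linearCombination ℚ θ ℓ) x + consM ℓ (coder (letterOp θ) x) := by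
  induction ℓ using Finsupp.induction_linear with
  | zero => simp
  | add f g hf hg =>
    simp only [map_add, LinearMap.add_apply, hf, hg]
    abel
  | single a q =>
    simp only [consM_single_smul, LinearMap.smul_apply, map_smul, coder_letterOp_consL,
      Finsupp.linearCombination_single, smul_add]

theorem prefixOp_add (s t : QA →ₗ[ℚ] LetterSpan) : prefixOp (s + t) = prefixOp s + prefixOp t := by
  have h : TensorProduct.lift (consM ∘ₗ (s + t))
      = TensorProduct.lift (consM ∘ₗ s) + TensorProduct.lift (consM ∘ₗ t) := by
    ext
    simp
  rw [prefixOp, h, LinearMap.add_comp]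
  rfl

theorem prefixOp_smul (q : ℚ) (t : QA →ₗ[ℚ] LetterSpan) : prefixOp (q • t) = q • prefixOp t := by
  have h : TensorProduct.lift (consM ∘ₗ (q • t)) = q • TensorProduct.lift (consM ∘ₗ t) := by
    ext
    simp
  rw [prefixOp, h, LinearMap.smul_comp]
  rfl

theorem coder_ext {T : QA →ₗ[ℚ] QA} {t : QA →ₗ[ℚ] LetterSpan} (h0 : T 1 = 0)
    (h : ∀ a x, T (consL a x) = prefixOp t (consL a x) + consL a (T x)) : T = coder t :=
  eq_coder h0 fun a w => by rw [← consL_word, h]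

theorem coder_add (s t : QA →ₗ[ℚ] LetterSpan) : coder (s + t) = coder s + coder t := by
  refine (coder_ext ?_ fun a x => ?_).symm
  · simp [coder_one]
  · simp only [LinearMap.add_apply, coder_consL, prefixOp_add, map_add]
    abel

theorem coder_smul (q : ℚ) (t : QA →ₗ[ℚ] LetterSpan) : coder (q • t) = q • coder t := by
  refine (coder_ext ?_ fun a x => ?_).symm
  · simp [coder_one]
  · simp only [LinearMap.smul_apply, coder_consL, prefixOp_smul, map_smul, smul_add]

theorem prefixOp_consM (t : QA →ₗ[ℚ] LetterSpan) (ℓ : LetterSpan) (x : QA) :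
    prefixOp t (consM ℓ x) = consM (t 1) (consM ℓ x) + prefixOp (t ∘ₗ consM ℓ) x := by
  induction ℓ using Finsupp.induction_linear with
  | zero => simp [prefixOp_zero]
  | add f g hf hg =>
    simp only [map_add, LinearMap.add_apply, hf, hg, LinearMap.comp_add, prefixOp_add]
    abel
  | single a q =>
    simp only [consM_single_smul, LinearMap.smul_apply, map_smul, LinearMap.comp_smul,
      prefixOp_smul, prefixOp_consL, smul_add]

/-- The projection to the letters of the commutator of `coder t` with a letterwise derivation. -/
def letterBracket (t : QA →ₗ[ℚ] LetterSpan) (θ : Letter → LetterSpan) : QA →ₗ[ℚ] LetterSpan :=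
  t ∘ₗ coder (letterOp θ) - Finsupp.linearCombination ℚ θ ∘ₗ t

/-- A letterwise derivation acts on a factorization `u v` through `u` or through `v`, and on `t(u)
v` through the letter `t(u)` or through `v`. The contributions of `v` agree; those of `u` and of
`t(u)` differ by `letterBracket t θ`. -/
theorem prefixOp_coder_letterOp (θ : Letter → LetterSpan) (w : Word) :
    ∀ t : QA →ₗ[ℚ] LetterSpan, prefixOp t (coder (letterOp θ) (word w))
      = coder (letterOp θ) (prefixOp t (word w)) + prefixOp (letterBracket t θ) (word w) := by
  induction w with
  | nil =>
    intro t
    rw [← one_def', coder_one, prefixOp_one, prefixOp_one, coder_letterOp_consM, coder_one,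
      letterBracket]
    simp [coder_one]
  | cons a w ih =>
    intro t
    have h : letterBracket t θ ∘ₗ consL a = t ∘ₗ consM (θ a) + letterBracket (t ∘ₗ consL a) θ := by
      refine LinearMap.ext fun x => ?_
      simp only [letterBracket, LinearMap.comp_apply, LinearMap.sub_apply, LinearMap.add_apply,
        coder_letterOp_consL, map_add]
      abel
    have h1 : letterBracket t θ 1 = -Finsupp.linearCombination ℚ θ (t 1) := by
      simp [letterBracket, coder_one]
    rw [← consL_word, coder_letterOp_consL, map_add, prefixOp_consM, prefixOp_consL, ih,
      prefixOp_consL, prefixOp_consL, h, prefixOp_add, h1, map_add, coder_letterOp_consM,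
      coder_letterOp_consL]
    simp only [map_add, map_neg, LinearMap.neg_apply, LinearMap.add_apply]
    abel

/-- The commutator of two coderivations is a coderivation, so it is known from its projection to the
letters. This reduces commutation relations to the support of `t`. -/
theorem coder_comp_letterOp (t : QA →ₗ[ℚ] LetterSpan) (θ : Letter → LetterSpan) :
    coder t ∘ₗ coder (letterOp θ) - coder (letterOp θ) ∘ₗ coder t = coder (letterBracket t θ) := by
  refine eq_coder ?_ fun a w => ?_
  · simp [← one_def', coder_one]
  · have h := prefixOp_coder_letterOp θ (a :: w) t
    have h2 : coder t (consM (θ a) (word w)) = prefixOp t (consM (θ a) (word w))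
        + consM (θ a) (coder t (word w)) := by
      generalize θ a = ℓ
      induction ℓ using Finsupp.induction_linear with
      | zero => simp
      | add f g hf hg =>
        simp only [map_add, LinearMap.add_apply, hf, hg]
        abel
      | single b q =>
        simp only [consM_single_smul, LinearMap.smul_apply, map_smul, coder_consL, smul_add]
    rw [← consL_word] at h ⊢
    simp only [coder_letterOp_consL, map_add] at h
    simp only [LinearMap.sub_apply, LinearMap.comp_apply, coder_letterOp_consL, map_add,
      coder_consL t, h2, map_sub]
    rw [← sub_eq_zero] at h ⊢
    rw [← h]
    abel

/-- Acting on the part that is kept commutes with stripping the rest, so only the action on the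
stripped suffix survives in the commutator. -/
theorem suffixOp_comp_letterOp (ε : QA →ₗ[ℚ] ℚ) (θ : Letter → LetterSpan) :
    suffixOp ε ∘ₗ coder (letterOp θ) - coder (letterOp θ) ∘ₗ suffixOp ε
      = suffixOp (ε ∘ₗ coder (letterOp θ)) := by
  refine eq_suffixOp ?_ fun a w => ?_
  · simp [← one_def', coder_one, suffixOp_one]
  · have h2 : suffixOp ε (consM (θ a) (word w)) = ε (consM (θ a) (word w)) • 1
        + consM (θ a) (suffixOp ε (word w)) := by
      generalize θ a = ℓ
      induction ℓ using Finsupp.induction_linear with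
      | zero => simp
      | add f g hf hg =>
        simp only [map_add, LinearMap.add_apply, hf, hg, add_smul]
        abel
      | single b q =>
        simp only [consM_single_smul, LinearMap.smul_apply, map_smul, suffixOp_consL, smul_add,
          smul_eq_mul, mul_smul]
    rw [← consL_word]
    simp only [LinearMap.sub_apply, LinearMap.comp_apply, coder_letterOp_consL, map_add,
      suffixOp_consL, h2, map_sub, map_smul, coder_one, smul_zero, add_smul]
    abel

/-- `D` on letters. -/
def letterD (a : Letter) : LetterSpan := Finsupp.single (a.1 + 1, a.2 + 1) (a.1 : ℚ)

/-- `W` on letters. -/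
def letterW (a : Letter) : LetterSpan := Finsupp.single a ((a.1 : ℚ) + a.2)

theorem letterD_add (a b : Letter) :
    letterD (a.1 + b.1, a.2 + b.2) = shift b (letterD a) + shift a (letterD b) := by
  have h1 : (b.1 + 1, b.2 + 1) + a = ((a.1 + b.1 + 1, a.2 + b.2 + 1) : Letter) :=
    Prod.ext (by simp only [Prod.fst_add]; ac_rfl) (by simp only [Prod.snd_add]; ac_rfl)
  have h2 : (a.1 + 1, a.2 + 1) + b = ((a.1 + b.1 + 1, a.2 + b.2 + 1) : Letter) :=
    Prod.ext (by simp only [Prod.fst_add]; ac_rfl) (by simp only [Prod.snd_add]; ac_rfl)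
  rw [letterD, letterD, letterD, shift_single, shift_single, h1, h2, ← Finsupp.single_add,
    PNat.add_coe, Nat.cast_add]

theorem letterW_add (a b : Letter) :
    letterW (a.1 + b.1, a.2 + b.2) = shift b (letterW a) + shift a (letterW b) := by
  rw [letterW, letterW, letterW, shift_single, shift_single, add_comm b a]
  change Finsupp.single (a + b) _ = _
  rw [← Finsupp.single_add]
  congr 1
  push_cast
  ring

theorem coder_letterD_word (w : Word) : coder (letterOp letterD) (word w) =
    ∑ j ∈ Finset.range w.length, (kk w j : ℚ) • repl w j 1 (kk w j + 1) (dd w j + 1) := by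
  induction w with
  | nil => rw [← one_def', coder_one]; rfl
  | cons a w ih =>
    rw [sum_range_length_cons_zero (w := w)
      (f := fun w j => (kk w j : ℚ) • repl w j 1 (kk w j + 1) (dd w j + 1)), ← ih, ← consL_word,
      coder_letterOp_consL]
    · congr 1
      rw [letterD, consM_single_smul, LinearMap.smul_apply, consL_word, repl_zero, kk_cons_zero,
        dd_cons_zero, List.drop_one, List.tail_cons]
      congr
    · intro j
      simp only [kk_cons_succ, dd_cons_succ, repl_cons_succ, map_smul]

theorem coder_letterW_word (w : Word) :
    coder (letterOp letterW) (word w) = (wt w : ℚ) • word w := by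
  induction w with
  | nil => rw [← one_def', coder_one]; simp [wt]
  | cons a w ih =>
    rw [← consL_word, coder_letterOp_consL, ih, letterW, consM_single_smul]
    simp only [wt, List.map_cons, List.sum_cons, map_smul, LinearMap.smul_apply, Nat.cast_add,
      add_smul, LinearMap.add_apply]

theorem lowerK_up (k : ℕ+) (d : ℕ) : lowerK (k + 1, d) = Finsupp.single (k, d) 1 := by
  have := k.pos
  rw [lowerK, if_pos (by simp only [PNat.add_coe, PNat.one_coe]; omega)]
  simp [PNat.add_coe]

/-- The case `k = 1`, where nothing can be lowered, is absorbed by the factor `k - 1`. -/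
theorem linearCombination_letterD_lowerK (k : ℕ+) (d : ℕ) :
    Finsupp.linearCombination ℚ letterD (lowerK (k, d)) =
      ((k : ℚ) - 1) • Finsupp.single (k, d + 1) 1 := by
  rw [lowerK]
  have hk := k.pos
  split_ifs with h
  · have hk' : ((k : ℕ) - 1).toPNat' + 1 = k := by
      apply PNat.eq
      rw [PNat.add_coe, Nat.toPNat'_coe, if_pos (Nat.sub_pos_of_lt h), PNat.one_coe]
      simp only at h ⊢
      omega
    simp only [Finsupp.linearCombination_single, letterD, hk', one_smul, Finsupp.smul_single,
      smul_eq_mul, mul_one, Nat.toPNat'_coe, if_pos (Nat.sub_pos_of_lt h)]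
    rw [Nat.cast_sub h.le, Nat.cast_one]
  · simp only at h
    have : (k : ℕ) = 1 := by omega
    simp [this]

theorem linearCombination_letterW_lowerK (k : ℕ+) (d : ℕ) :
    Finsupp.linearCombination ℚ letterW (lowerK (k, d)) =
      ((k : ℚ) + d - 1) • lowerK (k, d) := by
  rw [lowerK]
  split_ifs with h
  · simp only [Finsupp.linearCombination_single, letterW, one_smul, Finsupp.smul_single,
      smul_eq_mul, mul_one, Nat.toPNat'_coe, if_pos (Nat.sub_pos_of_lt h)]
    rw [Nat.cast_sub h.le, Nat.cast_one]
    congr 1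
    ring
  · simp

theorem isOne_up (k : ℕ+) (d : ℕ) : isOne (k + 1, d) = 0 := by
  rw [isOne, if_neg]
  simp [PNat.add_coe]

theorem isTwo_up (a : Letter) (d : ℕ) : isTwo (a.1 + 1, d) = isOne a := by
  simp [isTwo, isOne, PNat.add_coe]

theorem mul_isOne (a : Letter) : (a.1 : ℚ) * isOne a = isOne a := by
  rw [isOne]
  split_ifs with h <;> simp [h]

/-- Letterwise derivations preserve the length of words, so brackets with them do not enlarge the
support. -/
theorem map_coder_letterOp_eq_zero {M : Type} [AddCommGroup M] [Module ℚ M]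
    (θ : Letter → LetterSpan) (w : Word) : ∀ (t : QA →ₗ[ℚ] M) (n : ℕ),
      (∀ w : Word, n ≤ w.length → t (word w) = 0) → n ≤ w.length →
      t (coder (letterOp θ) (word w)) = 0 := by
  induction w with
  | nil => intro t n _ _; rw [← one_def', coder_one, map_zero]
  | cons a w ih =>
    intro t n ht hn
    simp only [List.length_cons] at hn
    have h1 : ∀ ℓ : LetterSpan, t (consM ℓ (word w)) = 0 := fun ℓ => by
      induction ℓ using Finsupp.induction_linear with
      | zero => simp
      | add f g hf hg => simp only [map_add, LinearMap.add_apply, hf, hg, add_zero]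
      | single b q =>
        rw [consM_single_smul, LinearMap.smul_apply, map_smul, consL_word,
          ht (b :: w) (by simpa using hn), smul_zero]
    rw [← consL_word, coder_letterOp_consL, map_add, h1, zero_add]
    refine ih (t ∘ₗ consL a) (n - 1) (fun v hv => ?_) (by omega)
    rw [comp_consL_word, ht]
    simp only [List.length_cons]
    omega

theorem coder_letterD_cons (a : Letter) (w : Word) : coder (letterOp letterD) (word (a :: w)) =
    (a.1 : ℚ) • word ((a.1 + 1, a.2 + 1) :: w) + consL a (coder (letterOp letterD) (word w)) := by
  rw [← consL_word, coder_letterOp_consL, letterD, consM_single_smul, LinearMap.smul_apply,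
    consL_word]

theorem coder_letterD_nil : coder (letterOp letterD) (word []) = 0 := coder_one _

theorem natCast_smul_congr {M : Type} [AddCommGroup M] [Module ℚ M] {n : ℕ} {x y : M}
    (h : n ≠ 0 → x = y) : (n : ℚ) • x = (n : ℚ) • y := by
  by_cases hn : n = 0
  · simp [hn]
  · rw [h hn]

theorem letterD_apply (a : Letter) :
    letterD a = (a.1 : ℚ) • Finsupp.single (a.1 + 1, a.2 + 1) 1 := by
  rw [letterD, Finsupp.smul_single, smul_eq_mul, mul_one]

theorem letterW_apply (a : Letter) :
    letterW a = ((a.1 : ℚ) + a.2) • Finsupp.single a 1 := by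
  rw [letterW, Finsupp.smul_single, smul_eq_mul, mul_one]

/-- On a letter, raising before lowering gives `k (d + 1)` and lowering before raising gives `d (k -
1)`; the difference is the weight `k + d`. On two letters the bracket vanishes: raising a letter
with `k = 1` destroys the indicator `isOne`, and raising the other letter commutes with the merging.
-/
theorem letterBracket_letter1_letterD : letterBracket letter1 letterD = letterOp letterW := by
  refine hom_ext fun w => ?_
  rw [letterBracket, LinearMap.sub_apply, LinearMap.comp_apply, LinearMap.comp_apply]
  rcases w with _ | ⟨a, _ | ⟨b, _ | ⟨c, w⟩⟩⟩
  · rw [← one_def', coder_one, letterOp_one, letter1_isLetterDerivation.1]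
    simp
  · simp only [coder_letterD_cons, coder_letterD_nil, map_zero, add_zero, letter1, linExt_word,
      letterOp_singleton, map_smul, Nat.add_sub_cancel, lowerK_up,
      linearCombination_letterD_lowerK]
    have h : (a.2 : ℚ) • Finsupp.single (a.1, a.2 - 1 + 1) (1 : ℚ)
        = (a.2 : ℚ) • Finsupp.single (a.1, a.2) (1 : ℚ) :=
      natCast_smul_congr fun h => by rw [Nat.sub_add_cancel (Nat.pos_of_ne_zero h)]
    rw [smul_comm (a.2 : ℚ), h, letterW_apply]
    push_cast
    module
  · simp only [coder_letterD_cons, coder_letterD_nil, map_zero, add_zero, letter1, linExt_word,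
      letterOp_cons_cons, map_smul, map_add, isOne_up, consL_word,
      Finsupp.linearCombination_single, letterD_apply]
    have e1 : a.2 + 1 + b.2 - 1 = a.2 + b.2 := by omega
    have e2 : a.2 + (b.2 + 1) - 1 = a.2 + b.2 := by omega
    have h1 : (isOne b * b.2) • Finsupp.single (a.1 + 1, a.2 + b.2 - 1 + 1) (1 : ℚ)
        = (isOne b * b.2) • Finsupp.single (a.1 + 1, a.2 + b.2) (1 : ℚ) :=
      mul_natCast_smul_congr fun h => by rw [Nat.sub_add_cancel (by omega)]
    have h2 : (isOne a * a.2) • Finsupp.single (b.1 + 1, a.2 + b.2 - 1 + 1) (1 : ℚ)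
        = (isOne a * a.2) • Finsupp.single (b.1 + 1, a.2 + b.2) (1 : ℚ) :=
      mul_natCast_smul_congr fun h => by rw [Nat.sub_add_cancel (by omega)]
    rw [one_smul, one_smul, smul_comm _ (a.1 : ℚ), smul_comm _ (b.1 : ℚ), h1, h2, e1, e2]
    module
  · have h := map_coder_letterOp_eq_zero letterD (a :: b :: c :: w) letter1 3 (by
      rintro (_ | ⟨a, _ | ⟨b, _ | ⟨c, w⟩⟩⟩) h <;>
        simp only [List.length_cons, List.length_nil] at h <;> try omega
      exact linExt_word _ _) (by simp)
    rw [h]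
    simp [letter1, letterOp_cons_cons, linExt_word]

/-- Only the sum commutes with `D`. On `a b`, the bracket of `letter4` is `isOne b` times the letter
`(a.1, a.2 + b.2 + 1)` minus `isOne a` times `(b.1, a.2 + b.2 + 1)`. That of `letter5` is the
negative, since raising turns the upper entry `1` into the `2` detected by `isTwo`. -/
theorem letterBracket_letter45_letterD : letterBracket (letter4 + letter5) letterD = 0 := by
  refine hom_ext fun w => ?_
  rw [letterBracket, LinearMap.sub_apply, LinearMap.comp_apply, LinearMap.comp_apply]
  rcases w with _ | ⟨a, _ | ⟨b, _ | ⟨c, _ | ⟨d, w⟩⟩⟩⟩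
  · simp [coder_letterD_nil, letter4, letter5, linExt_word]
  · simp [coder_letterD_cons, coder_letterD_nil, letter4, letter5, linExt_word]
  · simp only [coder_letterD_cons, coder_letterD_nil, map_zero, add_zero, letter4, letter5,
      linExt_word, map_smul, map_add, isOne_up, isTwo_up, consL_word, LinearMap.add_apply,
      lowerK_up, map_sub, linearCombination_letterD_lowerK,
      Finsupp.linearCombination_single, letterD_apply, LinearMap.zero_apply, ← add_assoc,
      add_right_comm _ 1]
    match_scalars <;> first
      | ring1
      | linear_combination mul_isOne a
      | linear_combination -mul_isOne b
  · simp only [coder_letterD_cons, coder_letterD_nil, map_zero, add_zero, letter4, letter5,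
      linExt_word, map_smul, map_add, isOne_up, consL_word, LinearMap.add_apply,
      map_sub, Finsupp.linearCombination_single, letterD_apply, LinearMap.zero_apply, ← add_assoc,
      add_right_comm _ 1]
    module
  · have h := map_coder_letterOp_eq_zero letterD (a :: b :: c :: d :: w) (letter4 + letter5) 4 (by
      rintro (_ | ⟨a, _ | ⟨b, _ | ⟨c, _ | ⟨d, w⟩⟩⟩⟩) h <;>
        simp only [List.length_cons, List.length_nil] at h <;> try omega
      simp [letter4, letter5, linExt_word]) (by simp)
    rw [h]
    simp [letter4, letter5, linExt_word]

/-- `t` lowers the weight by two. -/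
theorem letterBracket_letterW {t : QA →ₗ[ℚ] LetterSpan} (h : ∀ w : Word,
    Finsupp.linearCombination ℚ letterW (t (word w)) = ((wt w : ℚ) - 2) • t (word w)) :
    letterBracket t letterW = (2 : ℚ) • t := hom_ext fun w => by
  rw [letterBracket, LinearMap.sub_apply, LinearMap.comp_apply, LinearMap.comp_apply, h,
    coder_letterW_word, map_smul, LinearMap.smul_apply]
  module

theorem isOne_smul_congr {M : Type} [AddCommGroup M] [Module ℚ M] {a : Letter} {x y : M}
    (h : (a.1 : ℕ) = 1 → x = y) : isOne a • x = isOne a • y := by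
  rw [isOne]
  split_ifs with h'
  · rw [h h']
  · simp

theorem isTwo_smul_congr {M : Type} [AddCommGroup M] [Module ℚ M] {a : Letter} {x y : M}
    (h : (a.1 : ℕ) = 2 → x = y) : isTwo a • x = isTwo a • y := by
  rw [isTwo]
  split_ifs with h'
  · rw [h h']
  · simp

theorem letterBracket_letter1_letterW : letterBracket letter1 letterW = (2 : ℚ) • letter1 := by
  refine letterBracket_letterW fun w => ?_
  rcases w with _ | ⟨a, _ | ⟨b, _ | ⟨c, w⟩⟩⟩
  · simp [letter1, linExt_word]
  · simp only [letter1, linExt_word, map_smul, linearCombination_letterW_lowerK, wt, List.map_cons,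
      List.map_nil, List.sum_cons, List.sum_nil]
    rw [smul_comm _ (a.2 : ℚ)]
    refine natCast_smul_congr fun h => ?_
    rw [Nat.cast_sub (Nat.pos_of_ne_zero h)]
    congr 1
    push_cast
    ring
  · simp only [letter1, linExt_word, map_smul, map_add, Finsupp.linearCombination_single, wt,
      List.map_cons, List.map_nil, List.sum_cons, List.sum_nil, letterW_apply]
    have h1 : (isOne b * b.2) • ((a.1 : ℚ) + (a.2 + b.2 - 1 : ℕ)) • Finsupp.single (a.1, a.2 + b.2 - 1) (1 : ℚ)
        = (isOne b * b.2) • ((a.1 : ℚ) + b.1 + a.2 + b.2 - 2) • Finsupp.single (a.1, a.2 + b.2 - 1) (1 : ℚ) := by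
      rw [mul_comm, mul_smul, mul_smul]
      refine natCast_smul_congr fun h => isOne_smul_congr fun h' => ?_
      rw [h', Nat.cast_sub (by omega)]
      congr 1
      push_cast
      ring
    have h2 : (isOne a * a.2) • ((b.1 : ℚ) + (a.2 + b.2 - 1 : ℕ)) • Finsupp.single (b.1, a.2 + b.2 - 1) (1 : ℚ)
        = (isOne a * a.2) • ((a.1 : ℚ) + b.1 + a.2 + b.2 - 2) • Finsupp.single (b.1, a.2 + b.2 - 1) (1 : ℚ) := by
      rw [mul_comm, mul_smul, mul_smul]
      refine natCast_smul_congr fun h => isOne_smul_congr fun h' => ?_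
      rw [h', Nat.cast_sub (by omega)]
      congr 1
      push_cast
      ring
    rw [one_smul, one_smul, h1, h2]
    push_cast
    module
  · simp [letter1, linExt_word]

theorem letterBracket_letter4_letterW : letterBracket letter4 letterW = (2 : ℚ) • letter4 := by
  refine letterBracket_letterW fun w => ?_
  rcases w with _ | ⟨a, _ | ⟨b, _ | ⟨c, w⟩⟩⟩
  · simp [letter4, linExt_word]
  · simp [letter4, linExt_word]
  · simp only [letter4, linExt_word, map_smul, map_sub, linearCombination_letterW_lowerK, wt,
      List.map_cons, List.map_nil, List.sum_cons, List.sum_nil, smul_sub]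
    rw [smul_comm _ (isOne a), smul_comm _ (isOne b)]
    congr 1 <;>
    · refine isOne_smul_congr fun h => ?_
      congr 1
      push_cast [h]
      ring
  · simp [letter4, linExt_word]

theorem letterBracket_letter5_letterW : letterBracket letter5 letterW = (2 : ℚ) • letter5 := by
  refine letterBracket_letterW fun w => ?_
  rcases w with _ | ⟨a, _ | ⟨b, _ | ⟨c, _ | ⟨d, w⟩⟩⟩⟩
  · simp [letter5, linExt_word]
  · simp [letter5, linExt_word]
  · simp only [letter5, linExt_word, map_smul, map_sub, wt, Finsupp.linearCombination_single,
      List.map_cons, List.map_nil, List.sum_cons, List.sum_nil, smul_sub, letterW_apply]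
    rw [smul_comm _ (isTwo a), smul_comm _ (isTwo b)]
    congr 1 <;>
    · refine isTwo_smul_congr fun h => ?_
      rw [one_smul]
      congr 1
      push_cast [h]
      ring
  · simp only [letter5, linExt_word, map_smul, map_sub, wt, Finsupp.linearCombination_single,
      List.map_cons, List.map_nil, List.sum_cons, List.sum_nil, smul_sub, letterW_apply, mul_smul]
    have h1 : isOne b • isOne c • ((a.1 : ℚ) + (a.2 + b.2 + c.2 : ℕ)) •
        Finsupp.single (a.1, a.2 + b.2 + c.2) (1 : ℚ) = isOne b • isOne c •
          ((a.1 : ℚ) + b.1 + c.1 + a.2 + b.2 + c.2 - 2) •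
            Finsupp.single (a.1, a.2 + b.2 + c.2) (1 : ℚ) := by
      refine isOne_smul_congr fun h => isOne_smul_congr fun h' => ?_
      rw [h, h']
      congr 1
      push_cast
      ring
    have h2 : isOne a • isOne b • ((c.1 : ℚ) + (a.2 + b.2 + c.2 : ℕ)) •
        Finsupp.single (c.1, a.2 + b.2 + c.2) (1 : ℚ) = isOne a • isOne b •
          ((a.1 : ℚ) + b.1 + c.1 + a.2 + b.2 + c.2 - 2) •
            Finsupp.single (c.1, a.2 + b.2 + c.2) (1 : ℚ) := by
      refine isOne_smul_congr fun h => isOne_smul_congr fun h' => ?_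
      rw [h, h']
      congr 1
      push_cast
      ring
    rw [one_smul, one_smul, h1, h2]
    push_cast
    module
  · simp [letter5, linExt_word]

/-- Every word produced by `D` has a letter with positive lower entry, and the words detected by
`eps2` have none. -/
theorem eps2_letterD : eps2 ∘ₗ coder (letterOp letterD) = 0 := by
  refine hom_ext fun w => ?_
  rw [LinearMap.comp_apply]
  rcases w with _ | ⟨a, _ | ⟨b, _ | ⟨c, w⟩⟩⟩
  · simp [coder_letterD_nil]
  · simp [coder_letterD_cons, coder_letterD_nil, eps2, linExt_word]
  · simp [coder_letterD_cons, coder_letterD_nil, eps2, linExt_word, consL_word]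
  · exact map_coder_letterOp_eq_zero letterD (a :: b :: c :: w) eps2 3 (by
      rintro (_ | ⟨a, _ | ⟨b, _ | ⟨c, w⟩⟩⟩) h <;>
        simp only [List.length_cons, List.length_nil] at h <;> try omega
      simp [eps2, linExt_word]) (by simp)

/-- Every word produced by `D` has a letter with upper entry at least `2`. -/
theorem eps3_letterD : eps3 ∘ₗ coder (letterOp letterD) = 0 := by
  refine hom_ext fun w => ?_
  rw [LinearMap.comp_apply]
  rcases w with _ | ⟨a, _ | ⟨b, w⟩⟩
  · simp [coder_letterD_nil]
  · simp [coder_letterD_cons, coder_letterD_nil, eps3, linExt_word, one_eq_add_iff]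
  · exact map_coder_letterOp_eq_zero letterD (a :: b :: w) eps3 2 (by
      rintro (_ | ⟨a, _ | ⟨b, w⟩⟩) h <;>
        simp only [List.length_cons, List.length_nil] at h <;> try omega
      simp [eps3, linExt_word]) (by simp)

theorem eps2_letterW : eps2 ∘ₗ coder (letterOp letterW) = (2 : ℚ) • eps2 := by
  refine hom_ext fun w => ?_
  rw [LinearMap.comp_apply, coder_letterW_word, map_smul, LinearMap.smul_apply]
  by_cases h1 : [((2 : ℕ+), 0)] = w
  · simp [← h1, wt]
  · by_cases h2 : [((1 : ℕ+), 0), ((1 : ℕ+), 0)] = w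
    · simp [← h2, wt]
    · simp [eps2, linExt_word, h1, h2]

theorem eps3_letterW : eps3 ∘ₗ coder (letterOp letterW) = (2 : ℚ) • eps3 := by
  refine hom_ext fun w => ?_
  rw [LinearMap.comp_apply, coder_letterW_word, map_smul, LinearMap.smul_apply]
  by_cases h1 : [((1 : ℕ+), 1)] = w
  · simp [← h1, wt]
  · simp [eps3, linExt_word, h1]

/-! ### Linear maps on coefficients -/

section MapCoeff

variable {σ : Type}

/-- A linear map, applied to all coefficients of a power series. -/
def mapCoeff (T : QA →ₗ[ℚ] QA) (f : MvPowerSeries σ QA) : MvPowerSeries σ QA := fun n => T (f n)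

theorem coeff_mapCoeff (T : QA →ₗ[ℚ] QA) (f : MvPowerSeries σ QA) (n : σ →₀ ℕ) :
    MvPowerSeries.coeff n (mapCoeff T f) = T (MvPowerSeries.coeff n f) := rfl

theorem mapCoeff_add (T : QA →ₗ[ℚ] QA) (f g : MvPowerSeries σ QA) :
    mapCoeff T (f + g) = mapCoeff T f + mapCoeff T g :=
  MvPowerSeries.ext fun n => by simp only [coeff_mapCoeff, map_add]

theorem mapCoeff_sub (T : QA →ₗ[ℚ] QA) (f g : MvPowerSeries σ QA) :
    mapCoeff T (f - g) = mapCoeff T f - mapCoeff T g :=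
  MvPowerSeries.ext fun n => by simp only [coeff_mapCoeff, map_sub]

theorem mapCoeff_zero (T : QA →ₗ[ℚ] QA) : mapCoeff T (0 : MvPowerSeries σ QA) = 0 :=
  MvPowerSeries.ext fun n => by simp only [coeff_mapCoeff, map_zero]

theorem mapCoeff_neg (T : QA →ₗ[ℚ] QA) (f : MvPowerSeries σ QA) :
    mapCoeff T (-f) = -mapCoeff T f :=
  MvPowerSeries.ext fun n => T.map_neg (f n)

theorem mapCoeff_smul (T : QA →ₗ[ℚ] QA) (q : ℚ) (f : MvPowerSeries σ QA) :
    mapCoeff T (q • f) = q • mapCoeff T f :=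
  MvPowerSeries.ext fun n => T.map_smul q (f n)

theorem mapCoeff_sum {ι : Type} (T : QA →ₗ[ℚ] QA) (I : Finset ι) (f : ι → MvPowerSeries σ QA) :
    mapCoeff T (∑ i ∈ I, f i) = ∑ i ∈ I, mapCoeff T (f i) :=
  MvPowerSeries.ext fun n => by simp only [coeff_mapCoeff, map_sum]

/-- `T` is only `ℚ`-linear, so it cannot pass general coefficients from `QA`; the coefficient of a
variable is rational. -/
theorem mapCoeff_X_mul (T : QA →ₗ[ℚ] QA) (s : σ) (f : MvPowerSeries σ QA) :
    mapCoeff T (MvPowerSeries.X s * f) = MvPowerSeries.X s * mapCoeff T f :=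
  MvPowerSeries.ext fun n => by
    rw [coeff_mapCoeff, MvPowerSeries.X, MvPowerSeries.coeff_monomial_mul,
      MvPowerSeries.coeff_monomial_mul]
    split_ifs
    · rw [one_mul, one_mul, coeff_mapCoeff]
    · rw [map_zero]

end MapCoeff

/-! ### Transposition of linear substitutions -/

section Transpose

variable {σ τ : Type} [Fintype σ] [Fintype τ]

/-- The product of the factorials of the exponents. -/
def expFactorial (n : σ →₀ ℕ) : ℚ := ∏ s, ((n s).factorial : ℚ)

theorem expFactorial_ne_zero (n : σ →₀ ℕ) : expFactorial n ≠ 0 :=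
  Finset.prod_ne_zero_iff.2 fun _ _ => Nat.cast_ne_zero.2 (Nat.factorial_ne_zero _)

theorem expFactorial_zero : expFactorial (0 : σ →₀ ℕ) = 1 := by
  simp [expFactorial]

theorem expFactorial_add_single (n : σ →₀ ℕ) (s : σ) :
    expFactorial (n + Finsupp.single s 1) = (n s + 1) * expFactorial n := by
  classical
  rw [expFactorial, expFactorial, ← Finset.mul_prod_erase _ _ (Finset.mem_univ s),
    ← Finset.mul_prod_erase (a := s) _ (fun t => ((n t).factorial : ℚ)) (Finset.mem_univ s)]
  rw [Finset.prod_congr rfl (g := fun t => ((n t).factorial : ℚ))]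
  · simp only [Finsupp.add_apply, Finsupp.single_eq_same, Nat.factorial_succ]
    push_cast
    ring
  · intro t ht
    rw [Finsupp.add_apply, Finsupp.single_eq_of_ne (Finset.ne_of_mem_erase ht), add_zero]

/-- The functional on polynomials with value `n! c_n` on the monomial with exponent `n`, where
`c_n` are the coefficients of the power series `f`. -/
def borel (f : MvPowerSeries σ QA) : MvPolynomial σ ℚ →ₗ[ℚ] QA :=
  (MvPolynomial.basisMonomials σ ℚ).constr ℚ fun n => expFactorial n • MvPowerSeries.coeff n f

theorem borel_monomial (f : MvPowerSeries σ QA) (n : σ →₀ ℕ) (q : ℚ) :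
    borel f (MvPolynomial.monomial n q) = (q * expFactorial n) • MvPowerSeries.coeff n f := by
  have h : MvPolynomial.monomial n q = q • MvPolynomial.basisMonomials σ ℚ n := by
    rw [MvPolynomial.coe_basisMonomials, MvPolynomial.smul_monomial, smul_eq_mul, mul_one]
  rw [h, map_smul, borel, Module.Basis.constr_basis, mul_smul]

/-- The same functional for a rational polynomial in place of the power series. -/
def apolar (p : MvPolynomial σ ℚ) : MvPolynomial σ ℚ →ₗ[ℚ] ℚ :=
  (MvPolynomial.basisMonomials σ ℚ).constr ℚ fun n => expFactorial n * MvPolynomial.coeff n p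

theorem apolar_monomial (p : MvPolynomial σ ℚ) (n : σ →₀ ℕ) (q : ℚ) :
    apolar p (MvPolynomial.monomial n q) = q * expFactorial n * MvPolynomial.coeff n p := by
  have h : MvPolynomial.monomial n q = q • MvPolynomial.basisMonomials σ ℚ n := by
    rw [MvPolynomial.coe_basisMonomials, MvPolynomial.smul_monomial, smul_eq_mul, mul_one]
  rw [h, map_smul, apolar, Module.Basis.constr_basis, smul_eq_mul, mul_assoc]

/-- With the weights `n!`, multiplication by a variable is adjoint to the derivative in that
variable. -/
theorem apolar_X_mul (p q : MvPolynomial σ ℚ) (s : σ) :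
    apolar p (MvPolynomial.X s * q) = apolar (MvPolynomial.pderiv s p) q := by
  induction q using MvPolynomial.induction_on' with
  | monomial n c =>
    rw [mul_comm, ← pow_one (MvPolynomial.X s), ← MvPolynomial.monomial_add_single,
      apolar_monomial, apolar_monomial, MvPolynomial.coeff_pderiv, expFactorial_add_single]
    ring
  | add p q hp hq => rw [mul_add, map_add, map_add, hp, hq]

theorem finsupp_nat_induction {ι : Type} {P : (ι →₀ ℕ) → Prop} (h0 : P 0)
    (h1 : ∀ e t, P e → P (e + Finsupp.single t 1)) (e : ι →₀ ℕ) : P e := by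
  induction e using Finsupp.induction with
  | zero => exact h0
  | single_add t b f _ _ hf =>
    clear * - hf h1
    induction b with
    | zero => simpa using hf
    | succ b ih =>
      have := h1 _ t ih
      rwa [add_right_comm, ← Finsupp.single_add] at this

/-- The linear form with coefficients `c`. -/
def linForm (c : σ → ℚ) : MvPolynomial σ ℚ := ∑ s, MvPolynomial.C (c s) * MvPolynomial.X s

theorem pderiv_aeval_linForm (A : σ → τ → ℚ) (p : MvPolynomial σ ℚ) (t : τ) :
    MvPolynomial.pderiv t (MvPolynomial.aeval (fun s => linForm (A s)) p)
      = ∑ s, MvPolynomial.C (A s t) *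
          MvPolynomial.aeval (fun s => linForm (A s)) (MvPolynomial.pderiv s p) := by
  classical
  have hL : ∀ s, MvPolynomial.pderiv t (linForm (A s)) = MvPolynomial.C (A s t) := fun s => by
    simp [linForm, MvPolynomial.pderiv_X, Pi.single_apply]
  induction p using MvPolynomial.induction_on with
  | C q => simp
  | add p q hp hq => simp only [map_add, hp, hq, mul_add, Finset.sum_add_distrib]
  | mul_X p s hp =>
    have h : ∀ x, MvPolynomial.pderiv x (p * MvPolynomial.X s)
        = (if s = x then p else 0) + MvPolynomial.X s * MvPolynomial.pderiv x p := fun x => by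
      rw [Derivation.leibniz, MvPolynomial.pderiv_X, Pi.single_apply]
      simp only [smul_eq_mul, mul_ite, mul_one, mul_zero]
    simp only [h, map_mul, Derivation.leibniz, map_add, hp, smul_eq_mul, MvPolynomial.aeval_X, hL,
      mul_add, Finset.sum_add_distrib, apply_ite (MvPolynomial.aeval _), map_zero, mul_ite,
      mul_zero, Finset.sum_ite_eq, Finset.mem_univ, if_true, Finset.mul_sum]
    simp only [mul_left_comm (linForm _)]
    rw [mul_comm]

/-- The apolar pairing transposes linear substitutions. The induction on `e` reads a coefficient off
as an iterated derivative: the chain rule turns `∂/∂t` of the substituted polynomial into a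
combination of the `∂/∂s`, and each of these is adjoint to multiplication by `s`. -/
theorem expFactorial_mul_coeff_aeval (A : σ → τ → ℚ) (e : τ →₀ ℕ) : ∀ p : MvPolynomial σ ℚ,
    expFactorial e * MvPolynomial.coeff e (MvPolynomial.aeval (fun s => linForm (A s)) p)
      = apolar p (MvPolynomial.aeval (fun t => linForm fun s => A s t)
          (MvPolynomial.monomial e (1 : ℚ))) := by
  induction e using finsupp_nat_induction with
  | h0 =>
    intro p
    have h : (MvPolynomial.constantCoeff : MvPolynomial τ ℚ →+* ℚ).comp
        (MvPolynomial.aeval fun s => linForm (A s)).toRingHom = MvPolynomial.constantCoeff := by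
      ext s
      · simp
      · simp [linForm]
    have h' := congrArg (fun F => F p) h
    simp only [RingHom.comp_apply, AlgHom.toRingHom_eq_coe, RingHom.coe_coe,
      MvPolynomial.constantCoeff_eq] at h'
    rw [h', MvPolynomial.monomial_zero', map_one, map_one, ← map_one MvPolynomial.C,
      MvPolynomial.C_apply, apolar_monomial, expFactorial_zero, expFactorial_zero, one_mul, one_mul,
      one_mul]
  | h1 e t ih =>
    intro p
    rw [expFactorial_add_single, MvPolynomial.monomial_add_single, pow_one, map_mul,
      MvPolynomial.aeval_X]
    have h := MvPolynomial.coeff_pderiv (i := t) (MvPolynomial.aeval (fun s => linForm (A s)) p) e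
    rw [pderiv_aeval_linForm, MvPolynomial.coeff_sum] at h
    rw [mul_comm (_ + _ : ℚ), mul_assoc, mul_comm (_ + _ : ℚ), ← h, Finset.mul_sum]
    simp only [MvPolynomial.coeff_C_mul, mul_left_comm, ih, ← apolar_X_mul]
    rw [mul_comm, linForm, Finset.sum_mul, map_sum]
    refine Finset.sum_congr rfl fun s _ => ?_
    rw [mul_assoc, ← MvPolynomial.smul_eq_C_mul, map_smul, smul_eq_mul]

theorem finsupp_prod_linear_eq {σ : Type} (A : σ → τ → ℚ) (n : σ →₀ ℕ) :
    n.prod (fun s k => (∑ t, A s t • MvPowerSeries.X t : MvPowerSeries τ QA) ^ k)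
      = ((MvPolynomial.map (algebraMap ℚ QA) (MvPolynomial.aeval (fun s => linForm (A s))
          (MvPolynomial.monomial n (1 : ℚ))) : MvPolynomial τ QA) : MvPowerSeries τ QA) := by
  have h : ∀ s, (∑ t, A s t • MvPowerSeries.X t : MvPowerSeries τ QA)
      = ((MvPolynomial.map (algebraMap ℚ QA) (linForm (A s)) : MvPolynomial τ QA) :
        MvPowerSeries τ QA) := fun s => by
    rw [linForm, map_sum, ← MvPolynomial.coeToMvPowerSeries.ringHom_apply, map_sum]
    refine Finset.sum_congr rfl fun t _ => ?_
    rw [map_mul, MvPolynomial.map_C, MvPolynomial.map_X, map_mul,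
      MvPolynomial.coeToMvPowerSeries.ringHom_apply, MvPolynomial.coeToMvPowerSeries.ringHom_apply,
      MvPolynomial.coe_C, MvPolynomial.coe_X, ← MvPowerSeries.smul_eq_C_mul, algebraMap_smul]
  simp only [h, MvPolynomial.aeval_monomial, map_one, one_mul]
  rw [Finsupp.prod, Finsupp.prod, map_prod, ← MvPolynomial.coeToMvPowerSeries.ringHom_apply,
    map_prod]
  simp only [map_pow, MvPolynomial.coeToMvPowerSeries.ringHom_apply]

theorem hasSubst_linear (A : σ → τ → ℚ) :
    MvPowerSeries.HasSubst fun s => (∑ t, A s t • MvPowerSeries.X t : MvPowerSeries τ QA) := by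
  refine MvPowerSeries.hasSubst_of_constantCoeff_zero fun s => ?_
  rw [map_sum]
  refine Finset.sum_eq_zero fun t _ => ?_
  rw [← algebraMap_smul QA, MvPowerSeries.constantCoeff_smul, MvPowerSeries.constantCoeff_X,
    smul_zero]

theorem borel_eq_sum (f : MvPowerSeries σ QA) (q : MvPolynomial σ ℚ) :
    borel f q = ∑ n ∈ q.support, (MvPolynomial.coeff n q * expFactorial n) •
      MvPowerSeries.coeff n f := by
  conv_lhs => rw [q.as_sum, map_sum]
  simp only [borel_monomial]

/-- A coefficient of a substituted series is a priori a `finsum` over all exponents. Transposition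
identifies the summands with those of `borel f` on one fixed polynomial, whose support makes the sum
finite. -/
theorem expFactorial_smul_coeff_subst (A : σ → τ → ℚ) (f : MvPowerSeries σ QA) (e : τ →₀ ℕ) :
    expFactorial e • MvPowerSeries.coeff e
        (MvPowerSeries.subst (fun s => ∑ t, A s t • MvPowerSeries.X t : σ → MvPowerSeries τ QA) f)
      = borel f (MvPolynomial.aeval (fun t => linForm fun s => A s t)
          (MvPolynomial.monomial e (1 : ℚ))) := by
  have key : ∀ n : σ →₀ ℕ, MvPowerSeries.coeff n f • MvPowerSeries.coeff e
      (n.prod fun s k => (∑ t, A s t • MvPowerSeries.X t : MvPowerSeries τ QA) ^ k)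
      = ((expFactorial e)⁻¹ * (MvPolynomial.coeff n (MvPolynomial.aeval
          (fun t => linForm fun s => A s t) (MvPolynomial.monomial e (1 : ℚ))) * expFactorial n)) •
        MvPowerSeries.coeff n f := fun n => by
    have h := expFactorial_mul_coeff_aeval A e (MvPolynomial.monomial n 1)
    have h2 : ∀ q : MvPolynomial σ ℚ, apolar (MvPolynomial.monomial n (1 : ℚ)) q
        = MvPolynomial.coeff n q * expFactorial n := fun q => by
      classical
      induction q using MvPolynomial.induction_on' with
      | monomial m c =>
        rw [apolar_monomial, MvPolynomial.coeff_monomial, MvPolynomial.coeff_monomial]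
        by_cases hmn : m = n
        · subst hmn
          simp
        · simp [hmn, Ne.symm hmn]
      | add p q hp hq => rw [map_add, MvPolynomial.coeff_add, hp, hq, add_mul]
    rw [h2] at h
    rw [finsupp_prod_linear_eq, MvPolynomial.coeff_coe, MvPolynomial.coeff_map, ← h,
      inv_mul_cancel_left₀ (expFactorial_ne_zero e), smul_eq_mul, mul_comm, ← Algebra.smul_def]
  rw [MvPowerSeries.coeff_subst (hasSubst_linear A)]
  simp only [key]
  rw [finsum_eq_sum_of_support_subset (s := (MvPolynomial.aeval
          (fun t => linForm fun s => A s t) (MvPolynomial.monomial e (1 : ℚ))).support),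
    borel_eq_sum, Finset.smul_sum]
  · simp only [mul_smul, smul_inv_smul₀ (expFactorial_ne_zero e)]
  · intro n hn
    rw [Function.mem_support] at hn
    rw [Finset.mem_coe, MvPolynomial.mem_support_iff]
    intro h
    rw [h, zero_mul, mul_zero, zero_smul] at hn
    exact hn rfl

/-- A linear substitution is transposed to the linear substitution with the transposed matrix. -/
theorem borel_subst (A : σ → τ → ℚ) (f : MvPowerSeries σ QA) (p : MvPolynomial τ ℚ) :
    borel (MvPowerSeries.subst
        (fun s => ∑ t, A s t • MvPowerSeries.X t : σ → MvPowerSeries τ QA) f) p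
      = borel f (MvPolynomial.aeval (fun t => linForm fun s => A s t) p) := by
  induction p using MvPolynomial.induction_on' with
  | monomial e q =>
    have h : MvPolynomial.monomial e q = q • MvPolynomial.monomial e (1 : ℚ) := by
      rw [MvPolynomial.smul_monomial, smul_eq_mul, mul_one]
    rw [h, map_smul, map_smul, map_smul, ← expFactorial_smul_coeff_subst, borel_monomial, one_mul]
  | add p q hp hq => simp only [map_add, hp, hq]

theorem borel_pderiv (f : MvPowerSeries σ QA) (s : σ) (p : MvPolynomial σ ℚ) :
    borel (MvPowerSeries.pderiv QA s f) p = borel f (MvPolynomial.X s * p) := by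
  induction p using MvPolynomial.induction_on' with
  | monomial n c =>
    rw [mul_comm, ← pow_one (MvPolynomial.X s), ← MvPolynomial.monomial_add_single,
      borel_monomial, borel_monomial, MvPowerSeries.coeff_pderiv, expFactorial_add_single]
    have h : ((n s : QA) + 1) = algebraMap ℚ QA (n s + 1) := by simp
    rw [h, mul_comm (MvPowerSeries.coeff _ _), ← Algebra.smul_def, smul_smul]
    congr 1
    ring
  | add p q hp hq => rw [mul_add, map_add, map_add, hp, hq]

theorem borel_injective {f g : MvPowerSeries σ QA} (h : borel f = borel g) : f = g := by
  refine MvPowerSeries.ext fun n => ?_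
  have h' := congrArg (fun F => F (MvPolynomial.monomial n (1 : ℚ))) h
  simp only [borel_monomial, one_mul] at h'
  exact smul_right_injective QA (expFactorial_ne_zero n) h'

theorem borel_mapCoeff (T : QA →ₗ[ℚ] QA) (f : MvPowerSeries σ QA) (p : MvPolynomial σ ℚ) :
    borel (mapCoeff T f) p = T (borel f p) := by
  induction p using MvPolynomial.induction_on' with
  | monomial n c => rw [borel_monomial, borel_monomial, map_smul, coeff_mapCoeff]
  | add p q hp hq => rw [map_add, map_add, map_add, hp, hq]

/-- After transposition the substitution acts on the polynomial argument and `T` on the value, so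
the two commute. -/
theorem mapCoeff_subst (T : QA →ₗ[ℚ] QA) (A : σ → τ → ℚ) (f : MvPowerSeries σ QA) :
    mapCoeff T (MvPowerSeries.subst
        (fun s => ∑ t, A s t • MvPowerSeries.X t : σ → MvPowerSeries τ QA) f)
      = MvPowerSeries.subst
        (fun s => ∑ t, A s t • MvPowerSeries.X t : σ → MvPowerSeries τ QA) (mapCoeff T f) :=
  borel_injective <| LinearMap.ext fun p => by
    rw [borel_mapCoeff, borel_subst, borel_subst, borel_mapCoeff]

end Transpose

/-! ### Linear forms and substitutions in bimoulds -/

/-- `a` is a linear form with rational coefficients. -/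
def IsLinear {r : ℕ} (a : BB r) : Prop :=
  ∃ c : Fin r ⊕ Fin r → ℚ, a = ∑ t, c t • MvPowerSeries.X t

theorem IsLinear.zero {r : ℕ} : IsLinear (0 : BB r) := ⟨0, by simp⟩

theorem IsLinear.add {r : ℕ} {a b : BB r} (ha : IsLinear a) (hb : IsLinear b) :
    IsLinear (a + b) := by
  obtain ⟨c, rfl⟩ := ha
  obtain ⟨d, rfl⟩ := hb
  exact ⟨c + d, by simp only [Pi.add_apply, add_smul, Finset.sum_add_distrib]⟩

theorem IsLinear.sub {r : ℕ} {a b : BB r} (ha : IsLinear a) (hb : IsLinear b) :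
    IsLinear (a - b) := by
  obtain ⟨c, rfl⟩ := ha
  obtain ⟨d, rfl⟩ := hb
  exact ⟨c - d, by simp only [Pi.sub_apply, sub_smul, Finset.sum_sub_distrib]⟩

theorem IsLinear.sum {r : ℕ} {ι : Type} (I : Finset ι) {a : ι → BB r} (ha : ∀ i, IsLinear (a i)) :
    IsLinear (∑ i ∈ I, a i) := by
  classical
  induction I using Finset.induction_on with
  | empty => exact IsLinear.zero
  | insert i I hi h => rw [Finset.sum_insert hi]; exact (ha i).add h

theorem IsLinear.X {r : ℕ} (t : Fin r ⊕ Fin r) : IsLinear (MvPowerSeries.X t : BB r) :=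
  ⟨Pi.single t 1, by simp [Pi.single_apply]⟩

theorem IsLinear.ite {r : ℕ} {p : Prop} [Decidable p] {a b : BB r} (ha : IsLinear a)
    (hb : IsLinear b) : IsLinear (if p then a else b) := by
  split_ifs <;> assumption

theorem isLinear_varX (r j : ℕ) : IsLinear (varX r j) := by
  rw [varX]
  split_ifs
  · exact IsLinear.X _
  · exact IsLinear.zero

theorem isLinear_varY (r j : ℕ) : IsLinear (varY r j) := by
  rw [varY]
  split_ifs
  · exact IsLinear.X _
  · exact IsLinear.zero

theorem varX_of_lt {r j : ℕ} (h : r < j) : varX r j = 0 := dif_neg (by omega)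

theorem mapCoeff_varX_mul (T : QA →ₗ[ℚ] QA) {r : ℕ} (j : ℕ) (f : BB r) :
    mapCoeff T (varX r j * f) = varX r j * mapCoeff T f := by
  rw [varX]
  split_ifs
  · exact mapCoeff_X_mul _ _ _
  · rw [zero_mul, zero_mul, mapCoeff_zero]

theorem mapCoeff_varY_mul (T : QA →ₗ[ℚ] QA) {r : ℕ} (j : ℕ) (f : BB r) :
    mapCoeff T (varY r j * f) = varY r j * mapCoeff T f := by
  rw [varY]
  split_ifs
  · exact mapCoeff_X_mul _ _ _
  · rw [zero_mul, zero_mul, mapCoeff_zero]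

section Subs

variable {r s t : ℕ} {x y : ℕ → BB r}

theorem exists_matrix (hx : ∀ i, IsLinear (x i)) (hy : ∀ i, IsLinear (y i)) :
    ∃ A : Fin s ⊕ Fin s → Fin r ⊕ Fin r → ℚ,
      Sum.elim (fun i : Fin s => x (i + 1)) (fun i : Fin s => y (i + 1))
        = fun u => ∑ v, A u v • MvPowerSeries.X v := by
  choose c hc using hx
  choose d hd using hy
  refine ⟨Sum.elim (fun i => c (i + 1)) (fun i => d (i + 1)), funext fun u => ?_⟩
  rcases u with u | u
  · exact hc _
  · exact hd _

theorem hasSubst_subs (s : ℕ) (hx : ∀ i, IsLinear (x i)) (hy : ∀ i, IsLinear (y i)) :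
    MvPowerSeries.HasSubst
      (Sum.elim (fun i : Fin s => x (i + 1)) (fun i : Fin s => y (i + 1))) := by
  obtain ⟨A, hA⟩ := exists_matrix (s := s) hx hy
  rw [hA]
  exact hasSubst_linear A

theorem mapCoeff_subs (T : QA →ₗ[ℚ] QA) (hx : ∀ i, IsLinear (x i)) (hy : ∀ i, IsLinear (y i))
    (f : BB s) : mapCoeff T (subs r s x y f) = subs r s x y (mapCoeff T f) := by
  obtain ⟨A, hA⟩ := exists_matrix (s := s) hx hy
  rw [subs, subs, hA]
  exact mapCoeff_subst T A f

theorem subs_add (hx : ∀ i, IsLinear (x i)) (hy : ∀ i, IsLinear (y i)) (f g : BB s) :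
    subs r s x y (f + g) = subs r s x y f + subs r s x y g :=
  MvPowerSeries.subst_add (hasSubst_subs s hx hy) f g

theorem subs_sub (hx : ∀ i, IsLinear (x i)) (hy : ∀ i, IsLinear (y i)) (f g : BB s) :
    subs r s x y (f - g) = subs r s x y f - subs r s x y g :=
  MvPowerSeries.subst_sub (hasSubst_subs s hx hy) f g

theorem subs_mul (hx : ∀ i, IsLinear (x i)) (hy : ∀ i, IsLinear (y i)) (f g : BB s) :
    subs r s x y (f * g) = subs r s x y f * subs r s x y g :=
  MvPowerSeries.subst_mul (hasSubst_subs s hx hy) f g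

theorem subs_smul (hx : ∀ i, IsLinear (x i)) (hy : ∀ i, IsLinear (y i)) (q : ℚ) (f : BB s) :
    subs r s x y (q • f) = q • subs r s x y f :=
  MvPowerSeries.subst_smul (hasSubst_subs s hx hy) q f

theorem subs_zero (hx : ∀ i, IsLinear (x i)) (hy : ∀ i, IsLinear (y i)) :
    subs r s x y 0 = 0 := by
  have h := subs_smul hx hy (s := s) 0 0
  rwa [zero_smul, zero_smul] at h

theorem subs_sum (hx : ∀ i, IsLinear (x i)) (hy : ∀ i, IsLinear (y i)) {ι : Type} (I : Finset ι)
    (f : ι → BB s) : subs r s x y (∑ i ∈ I, f i) = ∑ i ∈ I, subs r s x y (f i) := by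
  classical
  induction I using Finset.induction_on with
  | empty => exact subs_zero hx hy
  | insert i I hi h => rw [Finset.sum_insert hi, Finset.sum_insert hi, subs_add hx hy, h]

theorem subs_varX (hx : ∀ i, IsLinear (x i)) (hy : ∀ i, IsLinear (y i)) {j : ℕ} (h1 : 1 ≤ j)
    (h2 : j ≤ s) : subs r s x y (varX s j) = x j := by
  rw [varX, dif_pos ⟨h1, h2⟩, subs, MvPowerSeries.subst_X (hasSubst_subs s hx hy), Sum.elim_inl,
    Nat.sub_add_cancel h1]

theorem subs_varY (hx : ∀ i, IsLinear (x i)) (hy : ∀ i, IsLinear (y i)) {j : ℕ} (h1 : 1 ≤ j)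
    (h2 : j ≤ s) : subs r s x y (varY s j) = y j := by
  rw [varY, dif_pos ⟨h1, h2⟩, subs, MvPowerSeries.subst_X (hasSubst_subs s hx hy), Sum.elim_inr,
    Nat.sub_add_cancel h1]

theorem subs_congr {x' y' : ℕ → BB r} (hx : ∀ i, 1 ≤ i → i ≤ s → x i = x' i)
    (hy : ∀ i, 1 ≤ i → i ≤ s → y i = y' i) (f : BB s) : subs r s x y f = subs r s x' y' f := by
  rw [subs, subs]
  congr 1
  funext u
  rcases u with u | u
  · exact hx _ (by omega) (by omega)
  · exact hy _ (by omega) (by omega)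

theorem subs_subs (hx : ∀ i, IsLinear (x i)) (hy : ∀ i, IsLinear (y i)) {x' y' : ℕ → BB s}
    (hx' : ∀ i, IsLinear (x' i)) (hy' : ∀ i, IsLinear (y' i)) (f : BB t) :
    subs r s x y (subs s t x' y' f)
      = subs r t (fun i => subs r s x y (x' i)) (fun i => subs r s x y (y' i)) f := by
  rw [subs, subs, MvPowerSeries.subst_comp_subst_apply (hasSubst_subs t hx' hy')
    (hasSubst_subs s hx hy), subs]
  congr 1
  funext u
  rcases u with u | u <;> rfl

end Subs

/-! ### The swap and `δ` on bimoulds -/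

/-- The values of the variables `X_j` under the swap. -/
def swapX (r j : ℕ) : BB r := ∑ i ∈ Finset.Icc 1 (r + 1 - j), varY r i

/-- The values of the variables `Y_j` under the swap. -/
def swapY (r j : ℕ) : BB r := varX r (r + 1 - j) - varX r (r + 2 - j)

theorem isLinear_swapX (r j : ℕ) : IsLinear (swapX r j) := IsLinear.sum _ fun _ => isLinear_varY _ _

theorem isLinear_swapY (r j : ℕ) : IsLinear (swapY r j) := (isLinear_varX _ _).sub (isLinear_varX _ _)

theorem swapB_apply (f : Bimould) (r : ℕ) : swapB f r = subs r r (swapX r) (swapY r) (f r) := rfl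

/-- The values of the variables `X_i` under `φ_j⁺` and `φ_j⁻`. -/
def phiX (j r i : ℕ) : BB r := if i < j then varX r i else varX r (i + 1)

/-- The values of the variables `Y_i` under `φ_j⁺`. -/
def phiPlusY (j r i : ℕ) : BB r :=
  if i < j then varY r i else if i = j then varY r j + varY r (j + 1) else varY r (i + 1)

/-- The values of the variables `Y_i` under `φ_j⁻`. -/
def phiMinusY (j r i : ℕ) : BB r :=
  if i < j - 1 then varY r i else if i = j - 1 then varY r (j - 1) + varY r j else varY r (i + 1)

theorem isLinear_phiX (j r i : ℕ) : IsLinear (phiX j r i) :=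
  (isLinear_varX _ _).ite (isLinear_varX _ _)

theorem isLinear_phiPlusY (j r i : ℕ) : IsLinear (phiPlusY j r i) :=
  (isLinear_varY _ _).ite (((isLinear_varY _ _).add (isLinear_varY _ _)).ite (isLinear_varY _ _))

theorem isLinear_phiMinusY (j r i : ℕ) : IsLinear (phiMinusY j r i) :=
  (isLinear_varY _ _).ite (((isLinear_varY _ _).add (isLinear_varY _ _)).ite (isLinear_varY _ _))

theorem phiPlus_apply {j r : ℕ} (h1 : 1 ≤ j) (h2 : j ≤ r) (f : Bimould) :
    phiPlus j f r = subs r (r - 1) (phiX j r) (phiPlusY j r) (f (r - 1)) := if_pos ⟨h1, h2⟩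

theorem phiPlus_of_lt {j r : ℕ} (h : r < j) (f : Bimould) : phiPlus j f r = 0 :=
  if_neg (by omega)

theorem phiMinus_apply {j r : ℕ} (h1 : 2 ≤ j) (h2 : j ≤ r) (f : Bimould) :
    phiMinus j f r = subs r (r - 1) (phiX j r) (phiMinusY j r) (f (r - 1)) := if_pos ⟨h1, h2⟩

theorem phiMinus_of_lt {j r : ℕ} (h : r < j) (f : Bimould) : phiMinus j f r = 0 :=
  if_neg (by omega)

theorem phiMinus_one (f : Bimould) (r : ℕ) : phiMinus 1 f r = 0 := if_neg (by omega)

/-- A linear map, applied to all coefficients of a bimould. -/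
def mapB (T : QA →ₗ[ℚ] QA) (f : Bimould) : Bimould := fun r => mapCoeff T (f r)

theorem mapB_swapB (T : QA →ₗ[ℚ] QA) (f : Bimould) : mapB T (swapB f) = swapB (mapB T f) :=
  funext fun r => mapCoeff_subs T (isLinear_swapX r) (isLinear_swapY r) (f r)

theorem mapB_phiPlus (T : QA →ₗ[ℚ] QA) (j : ℕ) (f : Bimould) :
    mapB T (phiPlus j f) = phiPlus j (mapB T f) := by
  funext r
  by_cases h : 1 ≤ j ∧ j ≤ r
  · rw [phiPlus_apply h.1 h.2, mapB, phiPlus_apply h.1 h.2,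
      mapCoeff_subs T (isLinear_phiX j r) (isLinear_phiPlusY j r), mapB]
  · rw [mapB, phiPlus, phiPlus, if_neg h, if_neg h, mapCoeff_zero]

theorem mapB_phiMinus (T : QA →ₗ[ℚ] QA) (j : ℕ) (f : Bimould) :
    mapB T (phiMinus j f) = phiMinus j (mapB T f) := by
  funext r
  by_cases h : 2 ≤ j ∧ j ≤ r
  · rw [phiMinus_apply h.1 h.2, mapB, phiMinus_apply h.1 h.2,
      mapCoeff_subs T (isLinear_phiX j r) (isLinear_phiMinusY j r), mapB]
  · rw [mapB, phiMinus, phiMinus, if_neg h, if_neg h, mapCoeff_zero]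

theorem mapB_derDeltaB (T : QA →ₗ[ℚ] QA) (f : Bimould) :
    mapB T (derDeltaB f) = derDeltaB (mapB T f) := by
  funext r
  have hp : ∀ j f, mapCoeff T (phiPlus j f r) = phiPlus j (mapB T f) r := fun j f =>
    congrFun (mapB_phiPlus T j f) r
  have hm : ∀ j f, mapCoeff T (phiMinus j f r) = phiMinus j (mapB T f) r := fun j f =>
    congrFun (mapB_phiMinus T j f) r
  rw [mapB, derDeltaB, derDeltaB]
  simp only [mapCoeff_add, mapCoeff_sub, mapCoeff_sum, sub_mul, add_mul, Finset.sum_mul, mul_assoc,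
    mapCoeff_varX_mul, mapCoeff_varY_mul, mapCoeff_smul, hp, hm, mapB_phiPlus, mapB_phiMinus,
    mapCoeff_neg, mapB]

theorem sum_telescope {R : Type} [CommRing R] (x y : ℕ → R) (r : ℕ) :
    ∑ j ∈ Finset.Icc 1 r, (∑ i ∈ Finset.Icc 1 j, y i) * (x j - x (j + 1))
      = ∑ j ∈ Finset.Icc 1 r, x j * y j - (∑ i ∈ Finset.Icc 1 r, y i) * x (r + 1) := by
  induction r with
  | zero => simp
  | succ r ih =>
    rw [Finset.sum_Icc_succ_top (by omega), Finset.sum_Icc_succ_top (by omega), ih,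
      Finset.sum_Icc_succ_top (by omega)]
    ring

/-- Reflecting `j ↦ r + 1 - j` gives partial sums of the `Y` times differences of the `X`. Abel
summation restores the original sum, with no boundary term because `X_{r+1} = 0`. -/
theorem sum_varX_mul_varY_swap (r : ℕ) :
    subs r r (swapX r) (swapY r) (∑ j ∈ Finset.Icc 1 r, varX r j * varY r j)
      = ∑ j ∈ Finset.Icc 1 r, varX r j * varY r j := by
  have hx := isLinear_swapX r
  have hy := isLinear_swapY r
  have h := sum_telescope (varX r) (varY r) r
  rw [varX_of_lt (Nat.lt_succ_self r), mul_zero, sub_zero] at h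
  rw [subs_sum hx hy, ← h]
  refine Finset.sum_nbij' (fun j => r + 1 - j) (fun j => r + 1 - j) ?_ ?_ ?_ ?_ ?_
  · intro j hj; simp only [Finset.mem_Icc] at hj ⊢; omega
  · intro j hj; simp only [Finset.mem_Icc] at hj ⊢; omega
  · intro j hj; simp only [Finset.mem_Icc] at hj; omega
  · intro j hj; simp only [Finset.mem_Icc] at hj; omega
  · intro j hj
    rw [Finset.mem_Icc] at hj
    rw [subs_mul hx hy, subs_varX hx hy hj.1 hj.2, subs_varY hx hy hj.1 hj.2, swapX, swapY,
      show r + 1 - j + 1 = r + 2 - j by omega]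

/-- The substitution that deletes `X_p` and merges `Y_q` with `Y_{q + 1}`. -/
def merge (p q n : ℕ) (g : BB n) : BB (n + 1) :=
  subs (n + 1) n (phiX p (n + 1)) (phiPlusY q (n + 1)) g

theorem phiPlus_succ {j n : ℕ} (h1 : 1 ≤ j) (h2 : j ≤ n + 1) (f : Bimould) :
    phiPlus j f (n + 1) = merge j j n (f n) := if_pos ⟨h1, h2⟩

/-- Thus `φ_j⁺` and `φ_j⁻` are the substitutions `merge p q` with `p = j` and `q = j` or `q = j -
1`, and can be treated together. -/
theorem phiMinusY_eq {j : ℕ} (h1 : 1 ≤ j) (r : ℕ) : phiMinusY j r = phiPlusY (j - 1) r := by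
  funext i
  rw [phiMinusY, phiPlusY, Nat.sub_add_cancel h1]

theorem phiMinus_succ {j n : ℕ} (h1 : 2 ≤ j) (h2 : j ≤ n + 1) (f : Bimould) :
    phiMinus j f (n + 1) = merge j (j - 1) n (f n) := by
  rw [merge, ← phiMinusY_eq (by omega)]
  exact phiMinus_apply h1 h2 f

theorem merge_zero (p q n : ℕ) : merge p q n 0 = 0 :=
  subs_zero (isLinear_phiX _ _) (isLinear_phiPlusY _ _)

theorem sum_phiPlusY {q : ℕ} (hq : 1 ≤ q) (r n : ℕ) :
    ∑ i ∈ Finset.Icc 1 n, phiPlusY q r i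
      = ∑ i ∈ Finset.Icc 1 (if n < q then n else n + 1), varY r i := by
  induction n with
  | zero => simp [show 0 < q by omega]
  | succ n ih =>
    rw [Finset.sum_Icc_succ_top (by omega), ih, phiPlusY]
    rcases lt_trichotomy (n + 1) q with h | h | h
    · rw [if_pos (by omega), if_pos h, if_pos h, Finset.sum_Icc_succ_top (by omega)]
    · rw [if_pos (by omega), if_neg (by omega), if_pos h, if_neg (by omega), ← h,
        Finset.sum_Icc_succ_top (by omega), Finset.sum_Icc_succ_top (by omega), ← add_assoc]
    · rw [if_neg (by omega), if_neg (by omega), if_neg (by omega), if_neg (by omega),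
        Finset.sum_Icc_succ_top (b := n + 1) (by omega)]

theorem subs_merge_varX {p q n i : ℕ} (hp : p ≤ n + 1) (h1 : 1 ≤ i) (h2 : i ≤ n + 1) :
    subs (n + 1) n (phiX p (n + 1)) (phiPlusY q (n + 1)) (varX n i) = phiX p (n + 1) i := by
  rcases Nat.lt_or_ge n i with h | h
  · rw [varX_of_lt h, subs_zero (isLinear_phiX _ _) (isLinear_phiPlusY _ _), phiX,
      if_neg (by omega), varX_of_lt (by omega)]
  · exact subs_varX (isLinear_phiX _ _) (isLinear_phiPlusY _ _) h1 h

/-- The swap replaces the `X`s by partial sums of the `Y`s: deleting one partial sum amounts to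
merging two neighbouring `Y`s. It replaces the `Y`s by differences of neighbouring `X`s: merging two
such differences amounts to deleting the `X` between them. So the indices `p` and `q` are reflected
and exchanged. -/
theorem subs_swap_merge {p q n : ℕ} (hp2 : p ≤ n + 1) (hq1 : 1 ≤ q) (hq2 : q ≤ n + 1)
    (g : BB n) :
    subs (n + 1) (n + 1) (swapX (n + 1)) (swapY (n + 1)) (merge p q n g)
      = merge (n + 2 - q) (n + 2 - p) n (subs n n (swapX n) (swapY n) g) := by
  have hx := isLinear_swapX (n + 1)
  have hy := isLinear_swapY (n + 1)
  rw [merge, merge, subs_subs hx hy (isLinear_phiX _ _) (isLinear_phiPlusY _ _),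
    subs_subs (isLinear_phiX _ _) (isLinear_phiPlusY _ _) (isLinear_swapX n) (isLinear_swapY n)]
  refine subs_congr (fun i h1 h2 => ?_) (fun i h1 h2 => ?_) g
  · rw [swapX, subs_sum (isLinear_phiX _ _) (isLinear_phiPlusY _ _)]
    have e : ∑ m ∈ Finset.Icc 1 (n + 1 - i), subs (n + 1) n (phiX (n + 2 - q) (n + 1))
        (phiPlusY (n + 2 - p) (n + 1)) (varY n m)
        = ∑ m ∈ Finset.Icc 1 (n + 1 - i), phiPlusY (n + 2 - p) (n + 1) m :=
      Finset.sum_congr rfl fun m hm => by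
        rw [Finset.mem_Icc] at hm
        exact subs_varY (isLinear_phiX _ _) (isLinear_phiPlusY _ _) hm.1 (by omega)
    rw [e, sum_phiPlusY (by omega), phiX]
    by_cases h : i < p
    · rw [if_pos h, if_neg (by omega), subs_varX hx hy h1 (by omega), swapX,
        show n + 1 - i + 1 = n + 1 + 1 - i by omega]
    · rw [if_neg h, if_pos (by omega), subs_varX hx hy (by omega) (by omega), swapX,
        show n + 1 + 1 - (i + 1) = n + 1 - i by omega]
  · rw [swapY, subs_sub (isLinear_phiX _ _) (isLinear_phiPlusY _ _),
      subs_merge_varX (by omega) (by omega) (by omega),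
      subs_merge_varX (by omega) (by omega) (by omega), phiX, phiX, phiPlusY]
    rcases lt_trichotomy i q with h | h | h
    · rw [if_pos h, if_neg (by omega), if_neg (by omega), subs_varY hx hy h1 (by omega), swapY,
        show n + 1 + 2 - i = n + 2 - i + 1 by omega, show n + 1 + 1 - i = n + 1 - i + 1 by omega]
    · rw [if_neg (by omega), if_pos h, if_pos (by omega), if_neg (by omega), subs_add hx hy,
        subs_varY hx hy hq1 hq2, subs_varY hx hy (by omega) (by omega), swapY, swapY, h,
        show n + 1 + 1 - (q + 1) = n + 1 - q by omega,
        show n + 1 + 2 - (q + 1) = n + 1 + 1 - q by omega,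
        show n + 1 + 2 - q = n + 2 - q + 1 by omega]
      ring
    · rw [if_neg (by omega), if_neg (by omega), if_pos (by omega), if_pos (by omega),
        subs_varY hx hy (by omega) (by omega), swapY,
        show n + 1 + 1 - (i + 1) = n + 1 - i by omega,
        show n + 1 + 2 - (i + 1) = n + 2 - i by omega]

/-- Two neighbouring deletions and mergings may be made in either order. This is needed for squares:
reflection depends on the depth, so the swap of `φ_j φ_j` has two indices that differ by one. -/
theorem merge_succ_merge {p q n : ℕ} (hp : p ≤ n + 1) (hq1 : 1 ≤ q) (g : BB n) :
    merge (p + 1) (q + 1) (n + 1) (merge p q n g) = merge p q (n + 1) (merge p q n g) := by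
  rw [merge, merge, merge, subs_subs (isLinear_phiX _ _) (isLinear_phiPlusY _ _) (isLinear_phiX _ _)
    (isLinear_phiPlusY _ _), subs_subs (isLinear_phiX _ _) (isLinear_phiPlusY _ _)
    (isLinear_phiX _ _) (isLinear_phiPlusY _ _)]
  refine subs_congr (fun i h1 h2 => ?_) (fun i h1 h2 => ?_) g
  · rw [phiX]
    by_cases h : i < p
    · rw [if_pos h, subs_merge_varX (by omega) h1 (by omega),
        subs_merge_varX (by omega) h1 (by omega), phiX, phiX, if_pos h, if_pos (by omega)]
    · rw [if_neg h, subs_merge_varX (by omega) (by omega) (by omega),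
        subs_merge_varX (by omega) (by omega) (by omega), phiX, phiX, if_neg (by omega),
        if_neg (by omega)]
  · have hY : ∀ (p q m : ℕ), 1 ≤ m → m ≤ n + 1 →
        subs (n + 1 + 1) (n + 1) (phiX p (n + 1 + 1)) (phiPlusY q (n + 1 + 1)) (varY (n + 1) m)
          = phiPlusY q (n + 1 + 1) m := fun p q m h h' =>
      subs_varY (isLinear_phiX _ _) (isLinear_phiPlusY _ _) h h'
    rw [phiPlusY]
    rcases lt_trichotomy i q with h | h | h
    · rw [if_pos h, hY _ _ _ h1 (by omega), hY _ _ _ h1 (by omega), phiPlusY, phiPlusY, if_pos h,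
        if_pos (by omega)]
    · rw [if_neg (by omega), if_pos h, subs_add (isLinear_phiX _ _) (isLinear_phiPlusY _ _),
        subs_add (isLinear_phiX _ _) (isLinear_phiPlusY _ _), hY _ _ _ hq1 (by omega),
        hY _ _ _ (by omega) (by omega), hY _ _ _ hq1 (by omega), hY _ _ _ (by omega) (by omega)]
      have e1 : phiPlusY (q + 1) (n + 1 + 1) q = varY (n + 1 + 1) q := if_pos (Nat.lt_succ_self q)
      have e2 : phiPlusY q (n + 1 + 1) (q + 1) = varY (n + 1 + 1) (q + 1 + 1) := by
        rw [phiPlusY, if_neg (by omega), if_neg (by omega)]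
      have e3 : ∀ p, phiPlusY p (n + 1 + 1) p
          = varY (n + 1 + 1) p + varY (n + 1 + 1) (p + 1) := fun p => by
        rw [phiPlusY, if_neg (lt_irrefl p), if_pos rfl]
      rw [e1, e2, e3, e3, add_assoc (varY (n + 1 + 1) q)]
    · rw [if_neg (by omega), if_neg (by omega), hY _ _ _ (by omega) (by omega),
        hY _ _ _ (by omega) (by omega), phiPlusY, phiPlusY, if_neg (by omega), if_neg (by omega),
        if_neg (by omega), if_neg (by omega)]

theorem sum_Icc_reflect {M : Type} [AddCommMonoid M] {F G : ℕ → M} {a b r : ℕ} (ha : 1 ≤ a)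
    (hb : b ≤ r) (hF : ∀ j, 1 ≤ j → j ≤ r → ¬(a ≤ j ∧ j ≤ b) → F j = 0)
    (hG : ∀ j, 1 ≤ j → j ≤ r → ¬(a ≤ j ∧ j ≤ b) → G j = 0)
    (h : ∀ j, a ≤ j → j ≤ b → F j = G (a + b - j)) :
    ∑ j ∈ Finset.Icc 1 r, F j = ∑ j ∈ Finset.Icc 1 r, G j := by
  have hs : Finset.Icc a b ⊆ Finset.Icc 1 r := Finset.Icc_subset_Icc ha hb
  rw [← Finset.sum_subset hs fun j hj hj' => ?_, ← Finset.sum_subset hs fun j hj hj' => ?_]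
  · refine Finset.sum_nbij' (fun j => a + b - j) (fun j => a + b - j) ?_ ?_ ?_ ?_ ?_
    · intro j hj; simp only [Finset.mem_Icc] at hj ⊢; omega
    · intro j hj; simp only [Finset.mem_Icc] at hj ⊢; omega
    · intro j hj; simp only [Finset.mem_Icc] at hj; omega
    · intro j hj; simp only [Finset.mem_Icc] at hj; omega
    · intro j hj
      rw [Finset.mem_Icc] at hj
      exact h j hj.1 hj.2
  · rw [Finset.mem_Icc] at hj hj'
    exact hG j hj.1 hj.2 hj'
  · rw [Finset.mem_Icc] at hj hj'
    exact hF j hj.1 hj.2 hj'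

theorem subs_swap_varX {r j : ℕ} (h1 : 1 ≤ j) :
    subs r r (swapX r) (swapY r) (varX r j) = swapX r j := by
  rcases Nat.lt_or_ge r j with h | h
  · rw [varX_of_lt h, subs_zero (isLinear_swapX r) (isLinear_swapY r), swapX,
      show r + 1 - j = 0 by omega]
    simp
  · exact subs_varX (isLinear_swapX r) (isLinear_swapY r) h1 h

theorem subs_swap_varX_sub {r j : ℕ} (h1 : 1 ≤ j) (h2 : j ≤ r) :
    subs r r (swapX r) (swapY r) (varX r j - varX r (j + 1)) = varY r (r + 1 - j) := by
  rw [subs_sub (isLinear_swapX r) (isLinear_swapY r), subs_swap_varX h1, subs_swap_varX (by omega),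
    swapX, swapX, show r + 1 - j = r - j + 1 by omega, Finset.sum_Icc_succ_top (by omega),
    show r + 1 - (j + 1) = r - j by omega, add_sub_cancel_left]

theorem swapB_phiPlus {j n : ℕ} (h1 : 1 ≤ j) (h2 : j ≤ n + 1) (f : Bimould) :
    swapB (phiPlus j f) (n + 1) = phiPlus (n + 2 - j) (swapB f) (n + 1) := by
  rw [swapB_apply, phiPlus_succ h1 h2, subs_swap_merge h2 h1 h2,
    phiPlus_succ (by omega) (by omega), swapB_apply]

theorem swapB_phiMinus {j n : ℕ} (h1 : 2 ≤ j) (h2 : j ≤ n + 1) (f : Bimould) :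
    swapB (phiMinus j f) (n + 1) = phiMinus (n + 3 - j) (swapB f) (n + 1) := by
  rw [swapB_apply, phiMinus_succ h1 h2, subs_swap_merge h2 (by omega) (by omega),
    phiMinus_succ (by omega) (by omega), swapB_apply, show n + 2 - (j - 1) = n + 3 - j by omega,
    show n + 3 - j - 1 = n + 2 - j by omega]

theorem swapB_phiPlus_phiPlus {j m : ℕ} (h1 : 1 ≤ j) (h2 : j ≤ m + 1) (f : Bimould) :
    swapB (phiPlus j (phiPlus j f)) (m + 2)
      = phiPlus (m + 2 - j) (phiPlus (m + 2 - j) (swapB f)) (m + 2) := by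
  rw [swapB_phiPlus h1 (by omega), phiPlus_succ (by omega) (by omega), phiPlus_succ (by omega)
    (by omega), phiPlus_succ (by omega) (by omega), swapB_phiPlus h1 h2,
    phiPlus_succ (by omega) (by omega), ← merge_succ_merge (by omega) (by omega),
    show m + 1 + 2 - j = m + 2 - j + 1 by omega]

theorem swapB_phiMinus_phiMinus {j m : ℕ} (h1 : 2 ≤ j) (h2 : j ≤ m + 1) (f : Bimould) :
    swapB (phiMinus j (phiMinus j f)) (m + 2)
      = phiMinus (m + 3 - j) (phiMinus (m + 3 - j) (swapB f)) (m + 2) := by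
  rw [swapB_phiMinus h1 (by omega), phiMinus_succ (by omega) (by omega), phiMinus_succ (by omega)
    (by omega), phiMinus_succ (by omega) (by omega), swapB_phiMinus h1 h2,
    phiMinus_succ (by omega) (by omega), ← merge_succ_merge (by omega) (by omega),
    show m + 1 + 3 - j = m + 3 - j + 1 by omega, show m + 3 - j + 1 - 1 = m + 3 - j - 1 + 1 by omega]

/-- The inner operator acts in depth `n`, where the index `n + 1` is out of range. Hence the square
has no term at the top index. -/
theorem phiPlus_phiPlus_self (n : ℕ) (f : Bimould) :
    phiPlus (n + 1) (phiPlus (n + 1) f) (n + 1) = 0 := by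
  rw [phiPlus_succ (by omega) le_rfl, phiPlus_of_lt (Nat.lt_succ_self n), merge_zero]

theorem phiMinus_phiMinus_self (n : ℕ) (f : Bimould) :
    phiMinus (n + 1) (phiMinus (n + 1) f) (n + 1) = 0 := by
  rcases Nat.eq_zero_or_pos n with h | h
  · subst h
    exact phiMinus_one _ _
  · rw [phiMinus_succ (by omega) le_rfl, phiMinus_of_lt (Nat.lt_succ_self n), merge_zero]

theorem derDeltaB_apply (f : Bimould) (r : ℕ) : derDeltaB f r
    = (∑ j ∈ Finset.Icc 1 r, varX r j * varY r j) * f r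
      - (1 / 2 : ℚ) • ∑ j ∈ Finset.Icc 1 r,
          (varX r j - varX r (j + 1) + varY r j) * phiPlus j f r
      - (1 / 2 : ℚ) • ∑ j ∈ Finset.Icc 1 r,
          (varX r (j - 1) - varX r j + varY r j) * phiMinus j f r
      + (1 / 4 : ℚ) • ∑ j ∈ Finset.Icc 1 r, phiPlus j (phiPlus j f) r
      - (1 / 4 : ℚ) • ∑ j ∈ Finset.Icc 1 r, phiMinus j (phiMinus j f) r := by
  simp only [derDeltaB, Finset.sum_sub_distrib, Finset.sum_add_distrib, Finset.sum_neg_distrib,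
    Finset.smul_sum, mul_smul_comm]
  abel

/-- `δ` commutes with the swap on bimoulds. -/
theorem swapB_derDeltaB (f : Bimould) : swapB (derDeltaB f) = derDeltaB (swapB f) := by
  funext r
  have hx := isLinear_swapX r
  have hy := isLinear_swapY r
  rw [swapB_apply, derDeltaB_apply, derDeltaB_apply, subs_sub hx hy, subs_add hx hy,
    subs_sub hx hy, subs_sub hx hy, subs_mul hx hy, sum_varX_mul_varY_swap]
  simp only [subs_smul hx hy, subs_sum hx hy]
  rcases r with _ | n
  · rfl
  congr 1
  · congr 1
    · congr 1
      · congr 1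
        congr 1
        -- In depth `r = n + 1` the swap takes `φ_j⁺` to `φ⁺` at `r + 1 - j`. It exchanges the two
        -- parts `X_j - X_{j+1}` and `Y_j` of the factor, up to the same reflection.
        refine sum_Icc_reflect le_rfl le_rfl (fun j h1 h2 h => absurd ⟨h1, h2⟩ h)
          (fun j h1 h2 h => absurd ⟨h1, h2⟩ h) fun j h1 h2 => ?_
        rw [subs_mul hx hy, subs_add hx hy, subs_swap_varX_sub h1 h2, subs_varY hx hy h1 h2,
          ← swapB_apply, swapB_phiPlus h1 h2, swapY, show 1 + (n + 1) - j = n + 2 - j by omega,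
          show n + 1 + 2 - j = n + 2 - j + 1 by omega, add_comm (varY _ _)]
      · congr 1
        -- Since `φ_1⁻ = 0`, the reflection for `φ⁻` is that of the interval from `2` to `r`, namely
        -- `j ↦ r + 2 - j`.
        refine sum_Icc_reflect (a := 2) (b := n + 1) (by omega) le_rfl (fun j h1 h2 h => ?_)
          (fun j h1 h2 h => ?_) fun j h1 h2 => ?_
        · rw [show j = 1 by omega, phiMinus_one, mul_zero, subs_zero hx hy]
        · rw [show j = 1 by omega, phiMinus_one, mul_zero]
        · have e := subs_swap_varX_sub (r := n + 1) (j := j - 1) (by omega) (by omega)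
          rw [Nat.sub_add_cancel (by omega)] at e
          rw [subs_mul hx hy, subs_add hx hy, e, subs_varY hx hy (by omega) h2,
            ← swapB_apply, swapB_phiMinus h1 h2, swapY, show 2 + (n + 1) - j = n + 3 - j by omega,
            show n + 3 - j - 1 = n + 2 - j by omega, add_comm (varY _ _),
            show n + 1 + 1 - (j - 1) = n + 3 - j by omega]
    · congr 1
      -- The square of `φ_j⁺` vanishes at `j = r`, which leaves the reflection `j ↦ r - j`; for `φ⁻`
      -- below, both end terms vanish.
      refine sum_Icc_reflect (a := 1) (b := n) le_rfl (by omega) (fun j h1 h2 h => ?_)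
        (fun j h1 h2 h => ?_) fun j h1 h2 => ?_
      · rw [show j = n + 1 by omega, phiPlus_phiPlus_self, subs_zero hx hy]
      · rw [show j = n + 1 by omega, phiPlus_phiPlus_self]
      · obtain ⟨m, rfl⟩ : ∃ m, n = m + 1 := ⟨n - 1, by omega⟩
        rw [← swapB_apply, swapB_phiPlus_phiPlus h1 h2, show 1 + (m + 1) - j = m + 2 - j by omega]
  · congr 1
    refine sum_Icc_reflect (a := 2) (b := n) (by omega) (by omega) (fun j h1 h2 h => ?_)
      (fun j h1 h2 h => ?_) fun j h1 h2 => ?_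
    · rcases (by omega : j = 1 ∨ j = n + 1) with rfl | rfl
      · rw [phiMinus_one, subs_zero hx hy]
      · rw [phiMinus_phiMinus_self, subs_zero hx hy]
    · rcases (by omega : j = 1 ∨ j = n + 1) with rfl | rfl
      · rw [phiMinus_one]
      · rw [phiMinus_phiMinus_self]
    · obtain ⟨m, rfl⟩ : ∃ m, n = m + 1 := ⟨n - 1, by omega⟩
      rw [← swapB_apply, swapB_phiMinus_phiMinus h1 h2, show 2 + (m + 1) - j = m + 3 - j by omega]

/-! ### Maps on bimoulds and maps on words -/

/-- The word with letters `(n_{X_j} + 1, n_{Y_j})`. -/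
def wordOf {r : ℕ} (n : Fin r ⊕ Fin r →₀ ℕ) : Word :=
  List.ofFn fun i : Fin r => ((n (Sum.inl i)).succPNat, n (Sum.inr i))

/-- The product of the factorials of the exponents of the `Y_j`. -/
def factY {r : ℕ} (n : Fin r ⊕ Fin r →₀ ℕ) : ℚ := ∏ i : Fin r, ((n (Sum.inr i)).factorial : ℚ)

theorem factY_ne_zero {r : ℕ} (n : Fin r ⊕ Fin r →₀ ℕ) : factY n ≠ 0 :=
  Finset.prod_ne_zero_iff.2 fun _ _ => Nat.cast_ne_zero.2 (Nat.factorial_ne_zero _)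

theorem coeff_genA {r : ℕ} (n : Fin r ⊕ Fin r →₀ ℕ) :
    MvPowerSeries.coeff n (genA r) = (factY n)⁻¹ • word (wordOf n) := rfl

theorem expo_inl (w : Word) (i : Fin w.length) : expo w (Sum.inl i) = (w.get i).1.natPred := rfl

theorem expo_inr (w : Word) (i : Fin w.length) : expo w (Sum.inr i) = (w.get i).2 := rfl

theorem wordOf_expo (w : Word) : wordOf (expo w) = w := by
  have h : (fun i : Fin w.length => ((expo w (Sum.inl i)).succPNat, expo w (Sum.inr i)))
      = w.get := funext fun i => by
    rw [expo_inl, expo_inr, PNat.succPNat_natPred]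
  rw [wordOf, h, List.ofFn_get]

theorem factY_expo (w : Word) : factY (expo w) = (w.map fun a => (a.2.factorial : ℚ)).prod := by
  conv_rhs => rw [← List.ofFn_get w, List.map_ofFn, List.prod_ofFn]
  rfl

theorem wordMap_word (ρ : Bimould → Bimould) (w : Word) :
    wordMap ρ (word w) = factY (expo w) • MvPowerSeries.coeff (expo w) (ρ genA w.length) := by
  rw [wordMap, linExt_word, factY_expo]

theorem wordOf_injective {r : ℕ} {m n : Fin r ⊕ Fin r →₀ ℕ} (h : wordOf m = wordOf n) : m = n := by
  have h' := List.ofFn_injective h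
  refine Finsupp.ext fun s => ?_
  rcases s with i | i
  · have := congrArg Prod.fst (congrFun h' i)
    exact Nat.succPNat_injective this
  · exact congrArg Prod.snd (congrFun h' i)

theorem wordMap_wordOf (ρ : Bimould → Bimould) {r : ℕ} (n : Fin r ⊕ Fin r →₀ ℕ) :
    wordMap ρ (word (wordOf n)) = factY n • MvPowerSeries.coeff n (ρ genA r) := by
  have key : ∀ w : Word, w = wordOf n → wordMap ρ (word w)
      = factY n • MvPowerSeries.coeff n (ρ genA r) := by
    intro w h
    have hr : w.length = r := by rw [h, wordOf, List.length_ofFn]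
    subst hr
    rw [wordMap_word, wordOf_injective ((wordOf_expo w).trans h)]
  exact key _ rfl

/-- The defining property of the induced map: on the generic bimould, acting on words is the same as
acting on variables. -/
theorem mapB_wordMap (ρ : Bimould → Bimould) : mapB (wordMap ρ) genA = ρ genA :=
  funext fun r => MvPowerSeries.ext fun n => by
    rw [mapB, coeff_mapCoeff, coeff_genA, map_smul, wordMap_wordOf,
      inv_smul_smul₀ (factY_ne_zero n)]

theorem mapB_comp (T T' : QA →ₗ[ℚ] QA) (f : Bimould) : mapB (T ∘ₗ T') f = mapB T (mapB T' f) := rfl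

theorem eq_of_mapB_genA {T T' : QA →ₗ[ℚ] QA} (h : mapB T genA = mapB T' genA) : T = T' :=
  hom_ext fun w => by
    have h1 := congrArg (MvPowerSeries.coeff (expo w)) (congrFun h w.length)
    rw [mapB, mapB, coeff_mapCoeff, coeff_mapCoeff, coeff_genA, map_smul, map_smul, wordOf_expo]
      at h1
    exact smul_right_injective QA (inv_ne_zero (factY_ne_zero _)) h1

/-- Linear maps are determined by their action on `genA`, whose coefficients are all words up to
nonzero scalars. There the two composites become `swapB (ρ genA)` and `ρ (swapB genA)`. -/
theorem isSwapEquivariant_wordMap (ρ : Bimould → Bimould)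
    (h1 : ∀ T f, mapB T (ρ f) = ρ (mapB T f)) (h2 : ∀ f, swapB (ρ f) = ρ (swapB f)) :
    IsSwapEquivariant (wordMap ρ) := by
  have h : wordMap ρ ∘ₗ swap = swap ∘ₗ wordMap ρ := by
    refine eq_of_mapB_genA ?_
    rw [mapB_comp, mapB_comp, mapB_wordMap, h1, swap, mapB_wordMap, mapB_swapB, mapB_wordMap, h2]
  exact fun x => congrArg (fun F => F x) h

theorem derDelta_isSwapEquivariant : IsSwapEquivariant derDelta :=
  isSwapEquivariant_wordMap _ mapB_derDeltaB swapB_derDeltaB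

/-! ### The swap and `D` -/

section Extend

variable {M : Type} [AddCommGroup M] {r : ℕ}

/-- A finite sequence, numbered from `1` and extended by `0`. -/
def extend (v : Fin r → M) (k : ℕ) : M := if h : 1 ≤ k ∧ k ≤ r then v ⟨k - 1, by omega⟩ else 0

theorem extend_succ (v : Fin r → M) (i : Fin r) : extend v (i + 1) = v i :=
  dif_pos ⟨Nat.succ_pos _, i.2⟩

theorem extend_of_lt (v : Fin r → M) {k : ℕ} (h : r < k) : extend v k = 0 := dif_neg (by omega)

theorem sum_fin_eq_sum_Icc (F : ℕ → M) : ∑ i : Fin r, F (i + 1) = ∑ k ∈ Finset.Icc 1 r, F k := by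
  rw [Fin.sum_univ_eq_sum_range (fun i => F (i + 1)), Finset.range_eq_Ico,
    Finset.sum_Ico_add' F, Nat.zero_add, Finset.Ico_add_one_right_eq_Icc]

variable [Module ℚ M]

theorem sum_ite_eq_extend (v : Fin r → M) (k : ℕ) :
    ∑ j : Fin r, (if (j : ℕ) + 1 = k then 1 else 0 : ℚ) • v j = extend v k := by
  rw [extend]
  split_ifs with h
  · rw [Finset.sum_eq_single ⟨k - 1, by omega⟩]
    · rw [if_pos (Nat.sub_add_cancel h.1), one_smul]
    · intro j _ hj
      rw [if_neg fun h' => hj (Fin.ext (by simp only; omega)), zero_smul]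
    · exact fun h' => absurd (Finset.mem_univ _) h'
  · refine Finset.sum_eq_zero fun j _ => ?_
    rw [if_neg (by omega), zero_smul]

theorem sum_Icc_extend (v : Fin r → M) (k : ℕ) :
    ∑ i ∈ Finset.Icc 1 k, extend v i = ∑ j : Fin r, (if (j : ℕ) + 1 ≤ k then 1 else 0 : ℚ) • v j := by
  simp only [← sum_ite_eq_extend v]
  rw [Finset.sum_comm]
  refine Finset.sum_congr rfl fun j _ => ?_
  rw [← Finset.sum_smul, Finset.sum_ite_eq]
  simp

end Extend

theorem varX_eq_extend (r : ℕ) : varX r = extend fun i => MvPowerSeries.X (Sum.inl i) := rfl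

theorem varY_eq_extend (r : ℕ) : varY r = extend fun i => MvPowerSeries.X (Sum.inr i) := rfl

/-- The matrix of the swap. -/
def swapMatrix (r : ℕ) : Fin r ⊕ Fin r → Fin r ⊕ Fin r → ℚ
  | Sum.inl _, Sum.inl _ => 0
  | Sum.inl j, Sum.inr i => if (j : ℕ) + i + 1 ≤ r then 1 else 0
  | Sum.inr j, Sum.inl i => (if (j : ℕ) + i + 1 = r then 1 else 0) - if (j : ℕ) + i = r then 1 else 0
  | Sum.inr _, Sum.inr _ => 0

theorem swapMatrix_spec (r : ℕ) :
    Sum.elim (fun i : Fin r => swapX r (i + 1)) (fun i : Fin r => swapY r (i + 1))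
      = fun s => ∑ t, swapMatrix r s t • (MvPowerSeries.X t : BB r) := by
  funext s
  rw [Fintype.sum_sum_type]
  rcases s with j | j
  · simp only [Sum.elim_inl, swapMatrix, zero_smul, Finset.sum_const_zero, zero_add]
    rw [swapX, varY_eq_extend, sum_Icc_extend]
    refine Finset.sum_congr rfl fun i _ => ?_
    congr 2
    exact propext (by omega)
  · simp only [Sum.elim_inr, swapMatrix, zero_smul, Finset.sum_const_zero, add_zero, sub_smul,
      Finset.sum_sub_distrib]
    rw [swapY, varX_eq_extend, ← sum_ite_eq_extend, ← sum_ite_eq_extend]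
    congr 1 <;>
    · refine Finset.sum_congr rfl fun i _ => ?_
      congr 2
      exact propext (by omega)

/-- The polynomial `∑ X_j Y_j`. -/
def pairing (r : ℕ) : MvPolynomial (Fin r ⊕ Fin r) ℚ :=
  ∑ i, MvPolynomial.X (Sum.inl i) * MvPolynomial.X (Sum.inr i)

/-- The transposed swap exchanges the roles of `X` and `Y`: the `X`s become differences of the `Y`s
and the `Y`s become partial sums of the `X`s. Abel summation applies once more. -/
theorem aeval_swap_pairing (r : ℕ) :
    MvPolynomial.aeval (fun t => linForm fun s => swapMatrix r s t) (pairing r) = pairing r := by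
  have hX : ∀ i : Fin r, linForm (fun s => swapMatrix r s (Sum.inl i))
      = extend (fun j : Fin r => MvPolynomial.X (R := ℚ) (σ := Fin r ⊕ Fin r) (Sum.inr j)) (r - i)
        - extend (fun j : Fin r => MvPolynomial.X (Sum.inr j)) (r - i + 1) := fun i => by
    simp only [linForm, ← MvPolynomial.smul_eq_C_mul]
    rw [Fintype.sum_sum_type]
    simp only [swapMatrix, zero_smul, Finset.sum_const_zero, zero_add, sub_smul,
      Finset.sum_sub_distrib]
    rw [← sum_ite_eq_extend, ← sum_ite_eq_extend]
    congr 1 <;>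
    · refine Finset.sum_congr rfl fun j _ => ?_
      congr 2
      exact propext (by omega)
  have hY : ∀ i : Fin r, linForm (fun s => swapMatrix r s (Sum.inr i))
      = ∑ k ∈ Finset.Icc 1 (r - i),
        extend (fun j : Fin r => MvPolynomial.X (R := ℚ) (σ := Fin r ⊕ Fin r) (Sum.inl j)) k :=
    fun i => by
    simp only [linForm, ← MvPolynomial.smul_eq_C_mul]
    rw [Fintype.sum_sum_type, sum_Icc_extend]
    simp only [swapMatrix, zero_smul, Finset.sum_const_zero, add_zero]
    refine Finset.sum_congr rfl fun j _ => ?_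
    congr 2
    exact propext (by omega)
  have h := sum_telescope
    (extend fun j : Fin r => MvPolynomial.X (R := ℚ) (σ := Fin r ⊕ Fin r) (Sum.inr j))
    (extend fun j : Fin r => MvPolynomial.X (R := ℚ) (σ := Fin r ⊕ Fin r) (Sum.inl j)) r
  rw [extend_of_lt _ (Nat.lt_succ_self r), mul_zero, sub_zero, ← sum_fin_eq_sum_Icc,
    ← sum_fin_eq_sum_Icc] at h
  simp only [extend_succ] at h
  rw [pairing, map_sum]
  simp only [map_mul, MvPolynomial.aeval_X, hX, hY]
  simp only [mul_comm (MvPolynomial.X (Sum.inl _)), ← h]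
  rw [← Equiv.sum_comp Fin.revPerm]
  refine Finset.sum_congr rfl fun i _ => ?_
  rw [mul_comm, Fin.revPerm_apply, Fin.val_rev, show r - (r - (i + 1 : ℕ)) = i + 1 by omega,
    extend_succ]

theorem borel_swapB (f : Bimould) (r : ℕ) (p : MvPolynomial (Fin r ⊕ Fin r) ℚ) :
    borel (swapB f r) p
      = borel (f r) (MvPolynomial.aeval (fun t => linForm fun s => swapMatrix r s t) p) := by
  rw [swapB_apply, subs, swapMatrix_spec, borel_subst]

theorem borel_sum {σ ι : Type} [Fintype σ] (I : Finset ι) (f : ι → MvPowerSeries σ QA)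
    (p : MvPolynomial σ ℚ) : borel (∑ i ∈ I, f i) p = ∑ i ∈ I, borel (f i) p := by
  induction p using MvPolynomial.induction_on' with
  | monomial n c => simp only [borel_monomial, map_sum, Finset.smul_sum]
  | add p q hp hq => simp only [map_add, hp, hq, Finset.sum_add_distrib]

theorem borel_derDB (f : Bimould) (r : ℕ) (p : MvPolynomial (Fin r ⊕ Fin r) ℚ) :
    borel (derDB f r) p = borel (f r) (pairing r * p) := by
  rw [derDB, borel_sum, pairing, Finset.sum_mul, map_sum]
  refine Finset.sum_congr rfl fun i _ => ?_
  rw [borel_pderiv, borel_pderiv, ← mul_assoc, mul_comm (MvPolynomial.X (Sum.inr i))]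

/-- Under `borel`, `D` is multiplication by `pairing r` and the swap is an algebra map fixing
`pairing r`, so no second-order chain rule is needed. -/
theorem swapB_derDB (f : Bimould) : swapB (derDB f) = derDB (swapB f) :=
  funext fun r => borel_injective <| LinearMap.ext fun p => by
    rw [borel_swapB, borel_derDB, borel_derDB, borel_swapB, map_mul (MvPolynomial.aeval _),
      aeval_swap_pairing]

theorem mapB_derDB (T : QA →ₗ[ℚ] QA) (f : Bimould) : mapB T (derDB f) = derDB (mapB T f) :=
  funext fun r => borel_injective <| LinearMap.ext fun p => by
    rw [mapB, borel_mapCoeff, borel_derDB, borel_derDB, mapB, borel_mapCoeff]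

theorem derD_isSwapEquivariant : IsSwapEquivariant derD :=
  isSwapEquivariant_wordMap _ mapB_derDB swapB_derDB

/-! ### Substitutions given by partial maps of variables -/

section PartialSubst

variable {σ τ : Type} [Fintype σ] [Fintype τ] [DecidableEq σ]

/-- The matrix of the substitution of `∑_{m t = s} X_t` for the variable `s`, where `m` is a partial
map. -/
def partialMatrix (m : τ → Option σ) (s : σ) (t : τ) : ℚ := if m t = some s then 1 else 0

/-- The push-forward of an exponent along a partial map. -/
def pushExp (m : τ → Option σ) (e : τ →₀ ℕ) : σ →₀ ℕ :=
  Finsupp.equivFunOnFinite.symm fun s => ∑ t, if m t = some s then e t else 0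

theorem pushExp_apply (m : τ → Option σ) (e : τ →₀ ℕ) (s : σ) :
    pushExp m e s = ∑ t, if m t = some s then e t else 0 := rfl

/-- Although `merge` substitutes sums, its transpose sends each variable to a single variable or to
`0`. Monomials go to monomials or to `0`, and no binomial coefficients appear. -/
theorem aeval_partialMatrix (m : τ → Option σ) (e : τ →₀ ℕ) :
    MvPolynomial.aeval (fun t => linForm fun s => partialMatrix m s t)
        (MvPolynomial.monomial e (1 : ℚ))
      = if ∀ t, m t = none → e t = 0 then MvPolynomial.monomial (pushExp m e) 1 else 0 := by
  classical
  have h0 : ∀ t, m t = none → linForm (fun s => partialMatrix m s t) = 0 := fun t ht => by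
    simp [linForm, partialMatrix, ht]
  have h1 : ∀ t s, m t = some s → linForm (fun s => partialMatrix m s t) = MvPolynomial.X s :=
    fun t s ht => by
      simp [linForm, partialMatrix, ht, apply_ite MvPolynomial.C]
  rw [MvPolynomial.aeval_monomial, map_one, one_mul,
    Finsupp.prod_fintype _ _ fun t => pow_zero _]
  split_ifs with h
  · rw [MvPolynomial.monomial_eq, MvPolynomial.C_1, one_mul,
      Finsupp.prod_fintype _ _ fun t => pow_zero _]
    simp only [pushExp_apply]
    simp only [← Finset.prod_pow_eq_pow_sum]
    rw [Finset.prod_comm]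
    refine Finset.prod_congr rfl fun t _ => ?_
    rcases hm : m t with _ | s
    · simp [h t hm]
    · rw [h1 t s hm, Finset.prod_eq_single s]
      · rw [if_pos rfl]
      · intro s' _ hs
        rw [if_neg (fun h => hs (Option.some.inj h).symm), pow_zero]
      · exact fun h => absurd (Finset.mem_univ _) h
  · push Not at h
    obtain ⟨t, ht, ht'⟩ := h
    refine Finset.prod_eq_zero (Finset.mem_univ t) ?_
    rw [h0 t ht, zero_pow ht']

theorem expFactorial_smul_coeff_subst_partial (m : τ → Option σ) (f : MvPowerSeries σ QA)
    (e : τ →₀ ℕ) :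
    expFactorial e • MvPowerSeries.coeff e (MvPowerSeries.subst
        (fun s => ∑ t, partialMatrix m s t • MvPowerSeries.X t : σ → MvPowerSeries τ QA) f)
      = if ∀ t, m t = none → e t = 0 then
          expFactorial (pushExp m e) • MvPowerSeries.coeff (pushExp m e) f else 0 := by
  rw [expFactorial_smul_coeff_subst, aeval_partialMatrix]
  split_ifs
  · rw [borel_monomial, one_mul]
  · rw [map_zero]

end PartialSubst

theorem sum_fin_ite_eq {M : Type} [AddCommMonoid M] {r : ℕ} (f : Fin r → M) (k : ℕ) :
    (∑ t : Fin r, if (t : ℕ) = k then f t else 0) = if h : k < r then f ⟨k, h⟩ else 0 := by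
  split_ifs with h
  · rw [Finset.sum_eq_single ⟨k, h⟩]
    · rw [if_pos rfl]
    · intro t _ ht
      rw [if_neg fun h' => ht (Fin.ext h')]
    · exact fun h => absurd (Finset.mem_univ _) h
  · exact Finset.sum_eq_zero fun t _ => if_neg (by omega)

/-- The new position of `X_{t + 1}` after removal of `X_{p + 1}`, where `n` stands for none. -/
def posX (n p t : ℕ) : ℕ := if t < p then t else if t = p then n else t - 1

/-- The new position of `Y_{t + 1}` after `Y_{q + 1}` and `Y_{q + 2}` are merged. -/
def posY (q t : ℕ) : ℕ := if t ≤ q then t else t - 1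

/-- The number `k` as an element of `Fin n`, if possible. -/
def toFin (n k : ℕ) : Option (Fin n) := if h : k < n then some ⟨k, h⟩ else none

theorem toFin_eq_some {n k : ℕ} {i : Fin n} : toFin n k = some i ↔ k = i := by
  rw [toFin]
  split_ifs with h
  · simp [Fin.ext_iff]
  · simp only [false_iff]
    omega

theorem toFin_eq_none {n k : ℕ} : toFin n k = none ↔ n ≤ k := by
  rw [toFin]
  split_ifs with h
  · simpa using h
  · simpa using h

/-- The partial map on variables which is dual to `merge`. -/
def mergeMap (n p q : ℕ) : Fin (n + 1) ⊕ Fin (n + 1) → Option (Fin n ⊕ Fin n)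
  | Sum.inl t => (toFin n (posX n p t)).map Sum.inl
  | Sum.inr t => (toFin n (posY q t)).map Sum.inr

theorem mergeMap_inl_inl {n p q : ℕ} {t : Fin (n + 1)} {i : Fin n} :
    mergeMap n p q (Sum.inl t) = some (Sum.inl i) ↔ (t : ℕ) = if (i : ℕ) < p then (i : ℕ) else i + 1 := by
  simp only [mergeMap, Option.map_eq_some_iff, Sum.inl.injEq, exists_eq_right, toFin_eq_some, posX]
  split_ifs <;> omega

theorem mergeMap_inr_inr {n p q : ℕ} {t : Fin (n + 1)} {i : Fin n} :
    mergeMap n p q (Sum.inr t) = some (Sum.inr i)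
      ↔ (t : ℕ) = i ∧ (i : ℕ) ≤ q ∨ (t : ℕ) = i + 1 ∧ q ≤ i := by
  simp only [mergeMap, Option.map_eq_some_iff, Sum.inr.injEq, exists_eq_right, toFin_eq_some, posY]
  split_ifs <;> omega

theorem mergeMap_inl_inr {n p q : ℕ} {t : Fin (n + 1)} {i : Fin n} :
    mergeMap n p q (Sum.inl t) ≠ some (Sum.inr i) := by
  simp [mergeMap]

theorem mergeMap_inr_inl {n p q : ℕ} {t : Fin (n + 1)} {i : Fin n} :
    mergeMap n p q (Sum.inr t) ≠ some (Sum.inl i) := by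
  simp [mergeMap]

theorem sum_mergeMap_inl {M : Type} [AddCommMonoid M] {n p q : ℕ}
    (F : Fin (n + 1) ⊕ Fin (n + 1) → M) (i : Fin n) :
    (∑ t, if mergeMap n p q t = some (Sum.inl i) then F t else 0)
      = F (Sum.inl ⟨if (i : ℕ) < p then (i : ℕ) else i + 1, by split_ifs <;> omega⟩) := by
  rw [Fintype.sum_sum_type]
  simp only [mergeMap_inl_inl, mergeMap_inr_inl, if_false, Finset.sum_const_zero, add_zero]
  rw [sum_fin_ite_eq (fun t => F (Sum.inl t)), dif_pos]

theorem sum_mergeMap_inr {M : Type} [AddCommMonoid M] {n p q : ℕ}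
    (F : Fin (n + 1) ⊕ Fin (n + 1) → M) (i : Fin n) :
    (∑ t, if mergeMap n p q t = some (Sum.inr i) then F t else 0)
      = (if (i : ℕ) ≤ q then F (Sum.inr i.castSucc) else 0)
        + if q ≤ i then F (Sum.inr i.succ) else 0 := by
  rw [Fintype.sum_sum_type]
  simp only [mergeMap_inr_inr, mergeMap_inl_inr, if_false, Finset.sum_const_zero, zero_add]
  have h : ∀ t : Fin (n + 1),
      (if (t : ℕ) = i ∧ (i : ℕ) ≤ q ∨ (t : ℕ) = i + 1 ∧ q ≤ i then F (Sum.inr t) else 0)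
      = (if (t : ℕ) = i then if (i : ℕ) ≤ q then F (Sum.inr t) else 0 else 0)
        + if (t : ℕ) = i + 1 then if q ≤ i then F (Sum.inr t) else 0 else 0 := fun t => by
    split_ifs <;> first | omega | simp
  simp only [h, Finset.sum_add_distrib]
  rw [sum_fin_ite_eq (fun t => if (i : ℕ) ≤ q then F (Sum.inr t) else 0),
    sum_fin_ite_eq (fun t => if q ≤ i then F (Sum.inr t) else 0), dif_pos (by omega),
    dif_pos (by omega)]
  rfl

theorem varX_succ {r k : ℕ} (h : k < r) : varX r (k + 1) = MvPowerSeries.X (Sum.inl ⟨k, h⟩) :=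
  dif_pos ⟨Nat.succ_pos k, h⟩

theorem varY_succ {r k : ℕ} (h : k < r) : varY r (k + 1) = MvPowerSeries.X (Sum.inr ⟨k, h⟩) :=
  dif_pos ⟨Nat.succ_pos k, h⟩

theorem merge_eq_subst (n p q : ℕ) (g : BB n) : merge (p + 1) (q + 1) n g
    = MvPowerSeries.subst (fun s => ∑ t, partialMatrix (mergeMap n p q) s t • MvPowerSeries.X t) g := by
  rw [merge, subs]
  congr 1
  funext s
  simp only [partialMatrix, ite_smul, one_smul, zero_smul]
  rcases s with i | i
  · rw [sum_mergeMap_inl, Sum.elim_inl, phiX]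
    by_cases h : (i : ℕ) < p
    · rw [if_pos (by omega), varX_succ (by omega)]
      simp only [if_pos h]
    · rw [if_neg (by omega), varX_succ (by omega)]
      simp only [if_neg h]
  · rw [sum_mergeMap_inr, Sum.elim_inr, phiPlusY]
    rcases lt_trichotomy (i : ℕ) q with h | h | h
    · rw [if_pos (by omega), if_pos (by omega), if_neg (by omega), varY_succ (by omega), add_zero]
      rfl
    · rw [if_neg (by omega), if_pos (by omega), if_pos (by omega), if_pos (by omega), ← h,
        varY_succ (by omega), varY_succ (by omega)]
      rfl
    · rw [if_neg (by omega), if_neg (by omega), if_neg (by omega), if_pos (by omega),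
        varY_succ (by omega), zero_add]
      rfl

/-- The product of the factorials of the exponents of the `X_j`. -/
def factX {r : ℕ} (n : Fin r ⊕ Fin r →₀ ℕ) : ℚ := ∏ i : Fin r, ((n (Sum.inl i)).factorial : ℚ)

theorem factX_ne_zero {r : ℕ} (n : Fin r ⊕ Fin r →₀ ℕ) : factX n ≠ 0 :=
  Finset.prod_ne_zero_iff.2 fun _ _ => Nat.cast_ne_zero.2 (Nat.factorial_ne_zero _)

theorem expFactorial_eq {r : ℕ} (n : Fin r ⊕ Fin r →₀ ℕ) :
    expFactorial n = factX n * factY n := Fintype.prod_sum_type _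

theorem factX_pushExp_mergeMap {n p q : ℕ} (hp : p < n + 1) (e : Fin (n + 1) ⊕ Fin (n + 1) →₀ ℕ)
    (he : e (Sum.inl ⟨p, hp⟩) = 0) : factX (pushExp (mergeMap n p q) e) = factX e := by
  rw [factX, factX, Fin.prod_univ_succAbove _ ⟨p, hp⟩, he, Nat.factorial_zero, Nat.cast_one,
    one_mul]
  refine Finset.prod_congr rfl fun i _ => ?_
  rw [pushExp_apply, sum_mergeMap_inl]
  congr 4
  rw [Fin.succAbove]
  by_cases h : (i : ℕ) < p
  · rw [if_pos (show i.castSucc < ⟨p, hp⟩ from h)]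
    simp only [if_pos h]
    rfl
  · rw [if_neg (show ¬i.castSucc < ⟨p, hp⟩ from h)]
    simp only [if_neg h]
    rfl

/-- Words are normalized by the factorials of the `Y`-exponents only, while transposition uses all
factorials. The `X`-factorials cancel: the exponents of the `X` are never added, and the deleted one
is `0`. -/
theorem factY_smul_coeff_merge {n p q : ℕ} (hp : p < n + 1)
    (e : Fin (n + 1) ⊕ Fin (n + 1) →₀ ℕ) :
    factY e • MvPowerSeries.coeff e (merge (p + 1) (q + 1) n (genA n))
      = if ∀ t, mergeMap n p q t = none → e t = 0 then
          word (wordOf (pushExp (mergeMap n p q) e)) else 0 := by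
  have h := expFactorial_smul_coeff_subst_partial (mergeMap n p q) (genA n) e
  rw [← merge_eq_subst] at h
  refine smul_right_injective QA (factX_ne_zero e) ?_
  simp only
  rw [smul_smul, ← expFactorial_eq, h]
  split_ifs with h'
  · have h0 : e (Sum.inl ⟨p, hp⟩) = 0 := h' _ (by simp [mergeMap, posX, toFin])
    rw [coeff_genA, expFactorial_eq, factX_pushExp_mergeMap hp e h0, mul_smul,
      smul_inv_smul₀ (factY_ne_zero _)]
  · rw [smul_zero]

/-- The deleted `X` always loses its image. A `Y` does so only in the last position, because of the
convention `Y_{r+1} = 0`. -/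
theorem mergeMap_condition {n p q : ℕ} (hp : p < n + 1) (hq : q < n + 1)
    (e : Fin (n + 1) ⊕ Fin (n + 1) →₀ ℕ) :
    (∀ t, mergeMap n p q t = none → e t = 0)
      ↔ e (Sum.inl ⟨p, hp⟩) = 0 ∧ (q = n → e (Sum.inr ⟨q, hq⟩) = 0) := by
  rw [Sum.forall]
  simp only [mergeMap, Option.map_eq_none_iff, toFin_eq_none, posX, posY]
  refine and_congr ⟨fun h => h _ (by simp), fun h t ht => ?_⟩ ⟨fun h hqn => h _ (by simp [hqn]),
    fun h t ht => ?_⟩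
  · rw [← h]
    congr 2
    refine Fin.ext ?_
    split_ifs at ht <;> simp only <;> omega
  · rw [← h (by split_ifs at ht <;> omega)]
    congr 2
    refine Fin.ext ?_
    split_ifs at ht <;> simp only <;> omega
/-! ### The operators on words -/

theorem getElem_of_wordOf_eq {r : ℕ} {n : Fin r ⊕ Fin r →₀ ℕ} {w : Word} (h : wordOf n = w)
    (i : Fin r) (hi : (i : ℕ) < w.length) :
    w[(i : ℕ)] = ((n (Sum.inl i)).succPNat, n (Sum.inr i)) := by
  subst h
  simp [wordOf]

theorem wordOf_eq {r : ℕ} {n : Fin r ⊕ Fin r →₀ ℕ} {w : Word} (hr : w.length = r)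
    (h : ∀ (i : Fin r) (hi : (i : ℕ) < w.length),
      w[(i : ℕ)] = ((n (Sum.inl i)).succPNat, n (Sum.inr i))) : wordOf n = w := by
  refine List.ext_getElem (by rw [wordOf, List.length_ofFn, hr]) fun i h1 h2 => ?_
  rw [h ⟨i, hr ▸ h2⟩ h2]
  simp [wordOf]

theorem exists_wordOf {r : ℕ} {w : Word} (hr : w.length = r) :
    ∃ n : Fin r ⊕ Fin r →₀ ℕ, wordOf n = w := by
  subst hr
  exact ⟨expo w, wordOf_expo w⟩

theorem wordOf_modify {r : ℕ} {n n' : Fin r ⊕ Fin r →₀ ℕ} {u v : Word} {a : Letter} (b : Letter)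
    (hn : wordOf n = u ++ a :: v) (hu : u.length < r)
    (h : ∀ i : Fin r, (i : ℕ) ≠ u.length →
      n' (Sum.inl i) = n (Sum.inl i) ∧ n' (Sum.inr i) = n (Sum.inr i))
    (hb : b = ((n' (Sum.inl ⟨u.length, hu⟩)).succPNat, n' (Sum.inr ⟨u.length, hu⟩))) :
    wordOf n' = u ++ b :: v := by
  have hr : (u ++ a :: v).length = r := by rw [← hn, wordOf, List.length_ofFn]
  have hr' : (u ++ b :: v).length = r := by rw [← hr]; simp
  refine wordOf_eq hr' fun i hi => ?_
  by_cases hi' : (i : ℕ) = u.length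
  · have e : i = ⟨u.length, hu⟩ := Fin.ext hi'
    subst e
    simp [hb]
  · rw [(h i hi').1, (h i hi').2, ← getElem_of_wordOf_eq hn i (by omega)]
    simp only [List.getElem_append, List.getElem_cons]
    split_ifs <;> first | rfl | omega

theorem letter_eq_of_wordOf_eq {r : ℕ} {n : Fin r ⊕ Fin r →₀ ℕ} {u v : Word} {a : Letter}
    (hn : wordOf n = u ++ a :: v) (hu : u.length < r) :
    a = ((n (Sum.inl ⟨u.length, hu⟩)).succPNat, n (Sum.inr ⟨u.length, hu⟩)) := by
  rw [← getElem_of_wordOf_eq hn ⟨u.length, hu⟩ (by simp)]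
  simp

theorem factY_add_single_inl {r : ℕ} (n : Fin r ⊕ Fin r →₀ ℕ) (i : Fin r) :
    factY (n + Finsupp.single (Sum.inl i) 1) = factY n := by
  simp [factY]

theorem factY_add_single_inr {r : ℕ} (n : Fin r ⊕ Fin r →₀ ℕ) (i : Fin r) :
    factY (n + Finsupp.single (Sum.inr i) 1) = (n (Sum.inr i) + 1) * factY n := by
  have h := expFactorial_add_single n (Sum.inr i)
  rw [expFactorial_eq, expFactorial_eq, show factX (n + Finsupp.single (Sum.inr i) 1) = factX n by
    simp [factX], mul_left_comm] at h
  exact mul_left_cancel₀ (factX_ne_zero n) h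

/-- Multiplication by `X_j` on bimoulds. -/
def mulXB (j : ℕ) : Bimould → Bimould := fun f r => varX r j * f r

/-- Multiplication by `Y_j` on bimoulds. -/
def mulYB (j : ℕ) : Bimould → Bimould := fun f r => varY r j * f r

theorem wordMap_mulXB (u v : Word) (a : Letter) :
    wordMap (mulXB (u.length + 1)) (word (u ++ a :: v))
      = if 1 < (a.1 : ℕ) then word (u ++ (((a.1 : ℕ) - 1).toPNat', a.2) :: v) else 0 := by
  have hu : u.length < u.length + (v.length + 1) := by omega
  obtain ⟨n, hn⟩ := exists_wordOf (r := u.length + (v.length + 1)) (w := u ++ a :: v) (by simp)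
  have ha := letter_eq_of_wordOf_eq hn hu
  rw [← hn, wordMap_wordOf, mulXB, varX_succ hu, MvPowerSeries.X, MvPowerSeries.coeff_monomial_mul]
  have ha1 : (a.1 : ℕ) = n (Sum.inl ⟨u.length, hu⟩) + 1 := by
    rw [ha]; rfl
  by_cases h : 1 < (a.1 : ℕ)
  · rw [if_pos h, if_pos (Finsupp.single_le_iff.2 (by omega)), one_mul]
    obtain ⟨m, rfl⟩ : ∃ m, n = m + Finsupp.single (Sum.inl ⟨u.length, hu⟩) 1 :=
      ⟨n - Finsupp.single _ 1, (tsub_add_cancel_of_le (Finsupp.single_le_iff.2 (by omega))).symm⟩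
    rw [add_tsub_cancel_right, coeff_genA, factY_add_single_inl, smul_inv_smul₀ (factY_ne_zero m)]
    refine congrArg word (wordOf_modify _ hn hu (fun i hi => ?_) ?_)
    · constructor <;> simp [Fin.ext_iff, Ne.symm hi]
    · refine Prod.ext (PNat.eq ?_) ?_
      · simp only [Nat.toPNat'_coe, ha1]
        simp
      · rw [ha]
        simp
  · rw [if_neg h, if_neg fun h' => h (by have := Finsupp.single_le_iff.1 h'; omega), smul_zero]

theorem wordMap_mulYB (u v : Word) (a : Letter) :
    wordMap (mulYB (u.length + 1)) (word (u ++ a :: v))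
      = (a.2 : ℚ) • word (u ++ (a.1, a.2 - 1) :: v) := by
  have hu : u.length < u.length + (v.length + 1) := by omega
  obtain ⟨n, hn⟩ := exists_wordOf (r := u.length + (v.length + 1)) (w := u ++ a :: v) (by simp)
  have ha := letter_eq_of_wordOf_eq hn hu
  rw [← hn, wordMap_wordOf, mulYB, varY_succ hu, MvPowerSeries.X, MvPowerSeries.coeff_monomial_mul]
  have ha2 : a.2 = n (Sum.inr ⟨u.length, hu⟩) := by rw [ha]
  by_cases h : 1 ≤ a.2
  · rw [if_pos (Finsupp.single_le_iff.2 (by omega)), one_mul]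
    obtain ⟨m, rfl⟩ : ∃ m, n = m + Finsupp.single (Sum.inr ⟨u.length, hu⟩) 1 :=
      ⟨n - Finsupp.single _ 1, (tsub_add_cancel_of_le (Finsupp.single_le_iff.2 (by omega))).symm⟩
    have ha3 : a.2 = m (Sum.inr ⟨u.length, hu⟩) + 1 := by rw [ha2]; simp
    rw [add_tsub_cancel_right, coeff_genA, factY_add_single_inr, mul_smul,
      smul_inv_smul₀ (factY_ne_zero m), ha3, Nat.cast_succ]
    congr 1
    refine congrArg word (wordOf_modify _ hn hu (fun i hi => ?_) ?_)
    · constructor <;> simp [Fin.ext_iff, Ne.symm hi]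
    · refine Prod.ext ?_ ?_
      · rw [ha]
        simp
      · simp
  · rw [if_neg fun h' => h (by have := Finsupp.single_le_iff.1 h'; omega), smul_zero,
      show a.2 = 0 by omega, Nat.cast_zero, zero_smul]

/-- The factor from `∂/∂Y` is absorbed by the normalization with factorials; the factor `k` from
`∂/∂X` remains. -/
theorem derDB_coeff {r : ℕ} (n : Fin r ⊕ Fin r →₀ ℕ) :
    factY n • MvPowerSeries.coeff n (derDB genA r) = ∑ i : Fin r, (n (Sum.inl i) + 1 : ℚ) •
      word (wordOf (n + Finsupp.single (Sum.inl i) 1 + Finsupp.single (Sum.inr i) 1)) := by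
  rw [derDB, map_sum, Finset.smul_sum]
  refine Finset.sum_congr rfl fun i _ => ?_
  rw [MvPowerSeries.coeff_pderiv, MvPowerSeries.coeff_pderiv, coeff_genA, factY_add_single_inr,
    factY_add_single_inl]
  have h1 : ((n (Sum.inl i) : QA) + 1) = algebraMap ℚ QA (n (Sum.inl i) + 1) := by simp
  have h2 : (((n + Finsupp.single (Sum.inl i) 1 : Fin r ⊕ Fin r →₀ ℕ) (Sum.inr i) : QA) + 1)
      = algebraMap ℚ QA (n (Sum.inr i) + 1) := by simp
  have h3 : (n (Sum.inr i) + 1 : ℚ) ≠ 0 := Nat.cast_add_one_ne_zero _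
  have h4 := factY_ne_zero n
  rw [h1, h2, mul_comm, ← Algebra.smul_def, mul_comm, ← Algebra.smul_def, smul_smul, smul_smul,
    smul_smul]
  congr 1
  simp only [Finsupp.add_apply, Finsupp.single_apply, reduceCtorEq, if_false, add_zero]
  field_simp

theorem derWB_coeff {r : ℕ} (n : Fin r ⊕ Fin r →₀ ℕ) :
    factY n • MvPowerSeries.coeff n (derWB genA r)
      = (∑ i : Fin r, (n (Sum.inl i) + 1 + n (Sum.inr i) : ℚ)) • word (wordOf n) := by
  have hX : ∀ (t : Fin r ⊕ Fin r) (g : BB r), MvPowerSeries.coeff (n + Finsupp.single t 1)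
      (MvPowerSeries.X t * g) = MvPowerSeries.coeff n g := fun t g => by
    rw [MvPowerSeries.X, add_comm, MvPowerSeries.coeff_add_monomial_mul, one_mul]
  rw [derWB, map_sum, Finset.smul_sum, Finset.sum_smul]
  refine Finset.sum_congr rfl fun i _ => ?_
  have h1 : ((n (Sum.inl i) : QA) + 1) = algebraMap ℚ QA (n (Sum.inl i) + 1) := by simp
  have h2 : MvPowerSeries.coeff n (MvPowerSeries.X (Sum.inr i) *
      MvPowerSeries.pderiv QA (Sum.inr i) (genA r))
      = (n (Sum.inr i) : ℚ) • MvPowerSeries.coeff n (genA r) := by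
    rw [MvPowerSeries.X, MvPowerSeries.coeff_monomial_mul]
    split_ifs with h
    · obtain ⟨m, rfl⟩ : ∃ m, n = m + Finsupp.single (Sum.inr i) 1 :=
        ⟨n - Finsupp.single _ 1, (tsub_add_cancel_of_le h).symm⟩
      have h1 : ((m (Sum.inr i) : QA) + 1) = algebraMap ℚ QA (m (Sum.inr i) + 1) := by simp
      rw [add_tsub_cancel_right, MvPowerSeries.coeff_pderiv, h1, one_mul, mul_comm,
        ← Algebra.smul_def]
      simp
    · rw [Finsupp.single_le_iff] at h
      rw [show n (Sum.inr i) = 0 by omega, Nat.cast_zero, zero_smul]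
  rw [map_add, MvPowerSeries.coeff_pderiv, hX, h2, h1, mul_comm, ← Algebra.smul_def, ← add_smul,
    coeff_genA, smul_comm, smul_inv_smul₀ (factY_ne_zero n)]

theorem wt_eq_sum (w : Word) : (wt w : ℚ)
    = ∑ i : Fin w.length, ((expo w (Sum.inl i) : ℚ) + 1 + expo w (Sum.inr i)) := by
  have h : w.map (fun a => (a.1 : ℕ) + a.2) = List.ofFn fun i => ((w.get i).1 : ℕ) + (w.get i).2 := by
    conv_lhs => rw [← List.ofFn_get w, List.map_ofFn]
    rfl
  rw [wt, h, List.sum_ofFn, Nat.cast_sum]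
  refine Finset.sum_congr rfl fun i _ => ?_
  rw [expo_inl, expo_inr, ← Nat.cast_succ, Nat.succ_eq_add_one, PNat.natPred_add_one, Nat.cast_add]

theorem derW_word (w : Word) : derW (word w) = (wt w : ℚ) • word w := by
  rw [derW, wordMap_word, derWB_coeff, wordOf_expo, wt_eq_sum]

theorem kk_eq (w : Word) (j : ℕ) (h : j < w.length) : kk w j = (w[j].1 : ℕ) := by
  simp [kk, h]

theorem dd_eq (w : Word) (j : ℕ) (h : j < w.length) : dd w j = w[j].2 := by
  simp [dd, h]

theorem derD_word (w : Word) : derD (word w) = ∑ j ∈ Finset.range w.length,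
    (kk w j : ℚ) • repl w j 1 (kk w j + 1) (dd w j + 1) := by
  rw [derD, wordMap_word, derDB_coeff, ← Fin.sum_univ_eq_sum_range
    (fun j => (kk w j : ℚ) • repl w j 1 (kk w j + 1) (dd w j + 1))]
  refine Finset.sum_congr rfl fun i _ => ?_
  have hw : w.take i ++ w[(i : ℕ)] :: w.drop (i + 1) = w := by simp
  have hl : (w.take i).length = i := by simp
  rw [kk_eq w i i.2, dd_eq w i i.2, ← Nat.cast_succ, expo_inl, Nat.succ_eq_add_one,
    PNat.natPred_add_one, repl]
  congr 1
  refine congrArg word (wordOf_modify (a := w[(i : ℕ)]) (n := expo w) _ ?_ ?_ (fun j hj => ?_) ?_)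
  · rw [wordOf_expo, hw]
  · rw [hl]
    exact i.2
  · rw [hl] at hj
    constructor <;> simp [Fin.ext_iff, Ne.symm hj]
  · simp only [hl, Fin.eta]
    refine Prod.ext (PNat.eq ?_) ?_
    · simp [expo_inl]
    · simp [expo_inr]

theorem pushExp_mergeMap_inl {n p q : ℕ} (e : Fin (n + 1) ⊕ Fin (n + 1) →₀ ℕ) (i : Fin n) :
    pushExp (mergeMap n p q) e (Sum.inl i)
      = e (Sum.inl ⟨if (i : ℕ) < p then (i : ℕ) else i + 1, by split_ifs <;> omega⟩) :=
  sum_mergeMap_inl _ i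

theorem pushExp_mergeMap_inr {n p q : ℕ} (e : Fin (n + 1) ⊕ Fin (n + 1) →₀ ℕ) (i : Fin n) :
    pushExp (mergeMap n p q) e (Sum.inr i)
      = (if (i : ℕ) ≤ q then e (Sum.inr i.castSucc) else 0)
        + if q ≤ i then e (Sum.inr i.succ) else 0 :=
  sum_mergeMap_inr _ i

theorem wordOf_pushExp_mergeMap {n p q : ℕ} {e : Fin (n + 1) ⊕ Fin (n + 1) →₀ ℕ} {w w' : Word}
    (he : wordOf e = w) (hl : w'.length = n)
    (h : ∀ i (hi : i < w'.length) (hi1 : i < w.length) (hi2 : i + 1 < w.length),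
      w'[i].1 = (if i < p then w[i].1 else w[i + 1].1) ∧
      w'[i].2 = (if i ≤ q then w[i].2 else 0) + if q ≤ i then w[i + 1].2 else 0) :
    wordOf (pushExp (mergeMap n p q) e) = w' := by
  have hw : w.length = n + 1 := by rw [← he, wordOf, List.length_ofFn]
  refine wordOf_eq hl fun i hi => ?_
  obtain ⟨h1, h2⟩ := h i hi (by omega) (by omega)
  have g1 : w[(i : ℕ)] = ((e (Sum.inl i.castSucc)).succPNat, e (Sum.inr i.castSucc)) :=
    getElem_of_wordOf_eq he i.castSucc (by simp only [Fin.val_castSucc]; omega)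
  have g2 : w[(i : ℕ) + 1] = ((e (Sum.inl i.succ)).succPNat, e (Sum.inr i.succ)) :=
    getElem_of_wordOf_eq he i.succ (by simp only [Fin.val_succ]; omega)
  refine Prod.ext ?_ ?_
  · rw [h1, pushExp_mergeMap_inl]
    by_cases hp : (i : ℕ) < p
    · rw [if_pos hp, g1]
      simp only [if_pos hp]
      rfl
    · rw [if_neg hp, g2]
      simp only [if_neg hp]
      rfl
  · rw [h2, pushExp_mergeMap_inr, g1, g2]

theorem eq_zero_iff_of_wordOf_eq {r : ℕ} {n : Fin r ⊕ Fin r →₀ ℕ} {w : Word} (h : wordOf n = w)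
    (i : Fin r) (hi : (i : ℕ) < w.length) : n (Sum.inl i) = 0 ↔ (w[(i : ℕ)].1 : ℕ) = 1 := by
  rw [getElem_of_wordOf_eq h i hi, Nat.succPNat_coe, Nat.succ_eq_add_one, Nat.add_eq_right]

theorem wordMap_phiPlus (u v : Word) (a b : Letter) :
    wordMap (phiPlus (u.length + 1)) (word (u ++ a :: b :: v))
      = if (a.1 : ℕ) = 1 then word (u ++ (b.1, a.2 + b.2) :: v) else 0 := by
  obtain ⟨e, he⟩ := exists_wordOf (r := u.length + (v.length + 1) + 1) (w := u ++ a :: b :: v)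
    (by simp; omega)
  have hp : u.length < u.length + (v.length + 1) + 1 := by omega
  have h0 := eq_zero_iff_of_wordOf_eq he ⟨u.length, hp⟩ (by simp)
  simp only [List.getElem_append_right le_rfl, Nat.sub_self, List.getElem_cons_zero] at h0
  rw [← he, wordMap_wordOf, phiPlus_succ (by omega) (by omega), factY_smul_coeff_merge hp]
  simp only [mergeMap_condition hp hp, h0, show ¬u.length = u.length + (v.length + 1) by omega,
    false_implies, and_true]
  refine if_congr Iff.rfl (congrArg word (wordOf_pushExp_mergeMap he (by simp) ?_)) rfl
  intro i hi hi1 hi2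
  rcases lt_trichotomy i u.length with h | h | h
  · simp [h, h.le, h.not_ge]
  · subst h
    simp
  · obtain ⟨k, rfl⟩ : ∃ k, i = u.length + 1 + k := ⟨i - (u.length + 1), by omega⟩
    simp [List.getElem_append, List.getElem_cons]
    grind

theorem wordMap_phiMinus (u v : Word) (a b : Letter) :
    wordMap (phiMinus (u.length + 2)) (word (u ++ a :: b :: v))
      = if (b.1 : ℕ) = 1 then word (u ++ (a.1, a.2 + b.2) :: v) else 0 := by
  obtain ⟨e, he⟩ := exists_wordOf (r := u.length + (v.length + 1) + 1) (w := u ++ a :: b :: v)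
    (by simp; omega)
  have hp : u.length + 1 < u.length + (v.length + 1) + 1 := by omega
  have hq : u.length < u.length + (v.length + 1) + 1 := by omega
  have h0 := eq_zero_iff_of_wordOf_eq he ⟨u.length + 1, hp⟩ (by simp)
  have hb : (u ++ a :: b :: v)[u.length + 1]'(by simp) = b := by simp
  simp only [hb] at h0
  rw [← he, wordMap_wordOf, phiMinus_succ (by omega) (by omega),
    show u.length + 2 - 1 = u.length + 1 from rfl, factY_smul_coeff_merge hp]
  simp only [mergeMap_condition hp hq, h0, show ¬u.length = u.length + (v.length + 1) by omega,
    false_implies, and_true]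
  refine if_congr Iff.rfl (congrArg word (wordOf_pushExp_mergeMap he (by simp) ?_)) rfl
  intro i hi hi1 hi2
  rcases lt_trichotomy i u.length with h | h | h
  · simp [h, h.le, h.not_ge]
  · subst h
    simp
  · obtain ⟨k, rfl⟩ : ∃ k, i = u.length + 1 + k := ⟨i - (u.length + 1), by omega⟩
    simp [List.getElem_append, List.getElem_cons]
    grind

/-- At the end of a word there is no next `Y` to merge with, so the lower entry must vanish. This
boundary effect is the source of `δ²` and `δ³`. -/
theorem wordMap_phiPlus_last (u : Word) (a : Letter) :
    wordMap (phiPlus (u.length + 1)) (word (u ++ [a]))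
      = if (a.1 : ℕ) = 1 ∧ a.2 = 0 then word u else 0 := by
  obtain ⟨e, he⟩ := exists_wordOf (r := u.length + 1) (w := u ++ [a]) (by simp)
  have hp : u.length < u.length + 1 := by omega
  have h0 := eq_zero_iff_of_wordOf_eq he ⟨u.length, hp⟩ (by simp)
  have h1 : a.2 = e (Sum.inr ⟨u.length, hp⟩) := by
    have := getElem_of_wordOf_eq he ⟨u.length, hp⟩ (by simp)
    simpa using congrArg Prod.snd this
  simp only [List.getElem_append_right le_rfl, Nat.sub_self, List.getElem_cons_zero] at h0
  rw [← he, wordMap_wordOf, phiPlus_succ (by omega) (by omega), factY_smul_coeff_merge hp]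
  simp only [mergeMap_condition hp hp, h0, h1, true_implies]
  refine if_congr Iff.rfl (congrArg word (wordOf_pushExp_mergeMap he rfl ?_)) rfl
  intro i hi hi1 hi2
  simp [hi, hi.le, hi.not_ge]

/-- The order is reversed, since word maps act on coefficients and hence commute past the outer
operation on variables. -/
theorem wordMap_comp {ρ ρ' : Bimould → Bimould} (h : ∀ T f, mapB T (ρ' f) = ρ' (mapB T f)) :
    wordMap (ρ' ∘ ρ) = wordMap ρ ∘ₗ wordMap ρ' := by
  refine eq_of_mapB_genA ?_
  rw [mapB_wordMap, mapB_comp, mapB_wordMap, h, mapB_wordMap, Function.comp_apply]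

theorem mapB_mulXB (T : QA →ₗ[ℚ] QA) (j : ℕ) (f : Bimould) :
    mapB T (mulXB j f) = mulXB j (mapB T f) := funext fun r => mapCoeff_varX_mul T j (f r)

theorem mapB_mulYB (T : QA →ₗ[ℚ] QA) (j : ℕ) (f : Bimould) :
    mapB T (mulYB j f) = mulYB j (mapB T f) := funext fun r => mapCoeff_varY_mul T j (f r)

/-! ### The explicit formula for `δ` -/

/-- `δ` in terms of elementary word operators. By contravariance, a prefactor such as `X_j` in front
of `φ_j⁺` is the operator applied to the word before `φ_j⁺`. -/
theorem derDelta_word_eq (w : Word) : derDelta (word w)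
    = ∑ i ∈ Finset.range w.length,
        wordMap (mulYB (i + 1)) (wordMap (mulXB (i + 1)) (word w))
      - (1 / 2 : ℚ) • ∑ i ∈ Finset.range w.length,
        (wordMap (phiPlus (i + 1)) (wordMap (mulXB (i + 1)) (word w))
          - wordMap (phiPlus (i + 1)) (wordMap (mulXB (i + 2)) (word w))
          + wordMap (phiPlus (i + 1)) (wordMap (mulYB (i + 1)) (word w)))
      - (1 / 2 : ℚ) • ∑ i ∈ Finset.range w.length,
        (wordMap (phiMinus (i + 1)) (wordMap (mulXB i) (word w))
          - wordMap (phiMinus (i + 1)) (wordMap (mulXB (i + 1)) (word w))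
          + wordMap (phiMinus (i + 1)) (wordMap (mulYB (i + 1)) (word w)))
      + (1 / 4 : ℚ) • ∑ i ∈ Finset.range w.length,
        wordMap (phiPlus (i + 1)) (wordMap (phiPlus (i + 1)) (word w))
      - (1 / 4 : ℚ) • ∑ i ∈ Finset.range w.length,
        wordMap (phiMinus (i + 1)) (wordMap (phiMinus (i + 1)) (word w)) := by
  have hX : ∀ (j : ℕ) (ρ : Bimould → Bimould), factY (expo w) •
      MvPowerSeries.coeff (expo w) (varX w.length j * ρ genA w.length)
      = wordMap ρ (wordMap (mulXB j) (word w)) := fun j ρ => by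
    rw [← LinearMap.comp_apply, ← wordMap_comp fun T => mapB_mulXB T j, wordMap_word]
    rfl
  have hY : ∀ (j : ℕ) (ρ : Bimould → Bimould), factY (expo w) •
      MvPowerSeries.coeff (expo w) (varY w.length j * ρ genA w.length)
      = wordMap ρ (wordMap (mulYB j) (word w)) := fun j ρ => by
    rw [← LinearMap.comp_apply, ← wordMap_comp fun T => mapB_mulYB T j, wordMap_word]
    rfl
  have hP : ∀ j : ℕ, factY (expo w) •
      MvPowerSeries.coeff (expo w) (phiPlus j (phiPlus j genA) w.length)
      = wordMap (phiPlus j) (wordMap (phiPlus j) (word w)) := fun j => by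
    rw [← LinearMap.comp_apply, ← wordMap_comp fun T => mapB_phiPlus T j, wordMap_word]
    rfl
  have hM : ∀ j : ℕ, factY (expo w) •
      MvPowerSeries.coeff (expo w) (phiMinus j (phiMinus j genA) w.length)
      = wordMap (phiMinus j) (wordMap (phiMinus j) (word w)) := fun j => by
    rw [← LinearMap.comp_apply, ← wordMap_comp fun T => mapB_phiMinus T j, wordMap_word]
    rfl
  have hXY : ∀ j : ℕ, factY (expo w) •
      MvPowerSeries.coeff (expo w) (varX w.length j * (varY w.length j * genA w.length))
      = wordMap (mulYB j) (wordMap (mulXB j) (word w)) := fun j => hX j (mulYB j)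
  have hs : ∀ (q : ℚ) (f : BB w.length), MvPowerSeries.coeff (expo w) (q • f)
      = q • MvPowerSeries.coeff (expo w) f := fun _ _ => rfl
  have hI : ∀ F : ℕ → QA, ∑ j ∈ Finset.Icc 1 w.length, F j
      = ∑ i ∈ Finset.range w.length, F (i + 1) := fun F => by
    rw [← sum_fin_eq_sum_Icc, Fin.sum_univ_eq_sum_range (fun i => F (i + 1))]
  rw [derDelta, wordMap_word, derDeltaB_apply]
  simp only [Finset.sum_mul, add_mul, sub_mul, mul_assoc, map_add, map_sub, map_sum, hs, smul_add,
    smul_sub, Finset.smul_sum, smul_comm (factY (expo w)) (1 / 2 : ℚ),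
    smul_comm (factY (expo w)) (1 / 4 : ℚ), hX, hY, hP, hM, hXY]
  simp only [hI, Nat.add_sub_cancel]

/-! ### Elementary operators at a given position of a word -/

theorem exists_eq_append {w : Word} {i : ℕ} (h : i < w.length) :
    ∃ u a v, w = u ++ a :: v ∧ u.length = i :=
  ⟨w.take i, w[i], w.drop (i + 1), by simp, by simp; omega⟩

theorem exists_eq_append_two {w : Word} {i : ℕ} (h : i + 1 < w.length) :
    ∃ u a b v, w = u ++ a :: b :: v ∧ u.length = i :=
  ⟨w.take i, w[i], w[i + 1], w.drop (i + 2), by simp, by simp; omega⟩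

theorem exists_eq_append_three {w : Word} {i : ℕ} (h : i + 2 < w.length) :
    ∃ u a b c v, w = u ++ a :: b :: c :: v ∧ u.length = i :=
  ⟨w.take i, w[i], w[i + 1], w[i + 2], w.drop (i + 3), by simp, by simp; omega⟩

theorem kk_append (u v : Word) (k : ℕ) : kk (u ++ v) (u.length + k) = kk v k := by
  rw [kk, kk, List.getElem?_append_right (Nat.le_add_right _ _), Nat.add_sub_cancel_left]

theorem dd_append (u v : Word) (k : ℕ) : dd (u ++ v) (u.length + k) = dd v k := by
  rw [dd, dd, List.getElem?_append_right (Nat.le_add_right _ _), Nat.add_sub_cancel_left]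

theorem kk_append_length (u v : Word) : kk (u ++ v) u.length = kk v 0 := kk_append u v 0

theorem dd_append_length (u v : Word) : dd (u ++ v) u.length = dd v 0 := dd_append u v 0

theorem repl_append (u v : Word) (m k d : ℕ) :
    repl (u ++ v) u.length m k d = word (u ++ (k.toPNat', d) :: v.drop m) := by
  simp [repl]

theorem mulY_mulX_word {w : Word} {i : ℕ} (h : i < w.length) :
    wordMap (mulYB (i + 1)) (wordMap (mulXB (i + 1)) (word w))
      = if 1 < kk w i then (dd w i : ℚ) • repl w i 1 (kk w i - 1) (dd w i - 1) else 0 := by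
  obtain ⟨u, a, v, rfl, rfl⟩ := exists_eq_append h
  simp only [wordMap_mulXB, apply_ite (wordMap _), map_zero, wordMap_mulYB, kk_append_length,
    dd_append_length, repl_append, kk_cons_zero, dd_cons_zero, List.drop_succ_cons, List.drop_zero]

theorem wordMap_mulXB_second (u v : Word) (a b : Letter) :
    wordMap (mulXB (u.length + 2)) (word (u ++ a :: b :: v))
      = if 1 < (b.1 : ℕ) then word (u ++ a :: (((b.1 : ℕ) - 1).toPNat', b.2) :: v) else 0 := by
  have h := wordMap_mulXB (u ++ [a]) v b
  simpa using h

theorem wordMap_mulYB_second (u v : Word) (a b : Letter) :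
    wordMap (mulYB (u.length + 2)) (word (u ++ a :: b :: v))
      = (b.2 : ℚ) • word (u ++ a :: (b.1, b.2 - 1) :: v) := by
  have h := wordMap_mulYB (u ++ [a]) v b
  simpa using h

theorem ite_ite_one {M : Type} [Zero M] (k : ℕ+) (x : M) :
    (if 1 < (k : ℕ) then if ((((k : ℕ) - 1).toPNat' : ℕ+) : ℕ) = 1 then x else 0 else 0)
      = if (k : ℕ) = 2 then x else 0 := by
  rw [Nat.toPNat'_coe]
  split_ifs <;> first | rfl | omega

section TwoLetters

variable {w : Word} {i : ℕ}

theorem phiPlus_mulX_word (h : i + 1 < w.length) :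
    wordMap (phiPlus (i + 1)) (wordMap (mulXB (i + 1)) (word w))
      = if kk w i = 2 then repl w i 2 (kk w (i + 1)) (dd w i + dd w (i + 1)) else 0 := by
  obtain ⟨u, a, b, v, rfl, rfl⟩ := exists_eq_append_two h
  simp only [wordMap_mulXB, apply_ite (wordMap _), map_zero, wordMap_phiPlus, kk_append_length,
    dd_append_length, kk_append, dd_append, repl_append, kk_cons_zero, dd_cons_zero, kk_cons_succ,
    dd_cons_succ, List.drop_succ_cons, List.drop_zero, toPNat'_coe_pnat, ite_ite_one]

theorem phiPlus_mulX_succ_word (h : i + 1 < w.length) :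
    wordMap (phiPlus (i + 1)) (wordMap (mulXB (i + 2)) (word w))
      = if kk w i = 1 ∧ 1 < kk w (i + 1) then
          repl w i 2 (kk w (i + 1) - 1) (dd w i + dd w (i + 1)) else 0 := by
  obtain ⟨u, a, b, v, rfl, rfl⟩ := exists_eq_append_two h
  simp only [wordMap_mulXB_second, apply_ite (wordMap _), map_zero, wordMap_phiPlus,
    kk_append_length, dd_append_length, kk_append, dd_append, repl_append, kk_cons_zero,
    dd_cons_zero, kk_cons_succ, dd_cons_succ, List.drop_succ_cons, List.drop_zero, ite_and]
  split_ifs <;> rfl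

theorem phiPlus_mulY_word (h : i + 1 < w.length) :
    wordMap (phiPlus (i + 1)) (wordMap (mulYB (i + 1)) (word w))
      = if kk w i = 1 then
          (dd w i : ℚ) • repl w i 2 (kk w (i + 1)) (dd w i + dd w (i + 1) - 1) else 0 := by
  obtain ⟨u, a, b, v, rfl, rfl⟩ := exists_eq_append_two h
  simp only [wordMap_mulYB, map_smul, wordMap_phiPlus, kk_append_length, dd_append_length,
    kk_append, dd_append, repl_append, kk_cons_zero, dd_cons_zero, kk_cons_succ, dd_cons_succ,
    List.drop_succ_cons, List.drop_zero, toPNat'_coe_pnat, smul_ite, smul_zero]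
  rcases a with ⟨k, _ | d⟩
  · simp
  · rw [show d + 1 + b.2 - 1 = d + 1 - 1 + b.2 by omega]

theorem phiMinus_mulX_word (h : i + 1 < w.length) :
    wordMap (phiMinus (i + 2)) (wordMap (mulXB (i + 1)) (word w))
      = if kk w (i + 1) = 1 ∧ 1 < kk w i then
          repl w i 2 (kk w i - 1) (dd w i + dd w (i + 1)) else 0 := by
  obtain ⟨u, a, b, v, rfl, rfl⟩ := exists_eq_append_two h
  simp only [wordMap_mulXB, apply_ite (wordMap _), map_zero, wordMap_phiMinus, kk_append_length,
    dd_append_length, kk_append, dd_append, repl_append, kk_cons_zero, dd_cons_zero, kk_cons_succ,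
    dd_cons_succ, List.drop_succ_cons, List.drop_zero, ite_and]
  split_ifs <;> rfl

theorem phiMinus_mulX_succ_word (h : i + 1 < w.length) :
    wordMap (phiMinus (i + 2)) (wordMap (mulXB (i + 2)) (word w))
      = if kk w (i + 1) = 2 then repl w i 2 (kk w i) (dd w i + dd w (i + 1)) else 0 := by
  obtain ⟨u, a, b, v, rfl, rfl⟩ := exists_eq_append_two h
  simp only [wordMap_mulXB_second, apply_ite (wordMap _), map_zero, wordMap_phiMinus,
    kk_append_length, dd_append_length, kk_append, dd_append, repl_append, kk_cons_zero,
    dd_cons_zero, kk_cons_succ, dd_cons_succ, List.drop_succ_cons, List.drop_zero,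
    toPNat'_coe_pnat, ite_ite_one]

theorem phiMinus_mulY_word (h : i + 1 < w.length) :
    wordMap (phiMinus (i + 2)) (wordMap (mulYB (i + 2)) (word w))
      = if kk w (i + 1) = 1 then
          (dd w (i + 1) : ℚ) • repl w i 2 (kk w i) (dd w i + dd w (i + 1) - 1) else 0 := by
  obtain ⟨u, a, b, v, rfl, rfl⟩ := exists_eq_append_two h
  simp only [wordMap_mulYB_second, map_smul, wordMap_phiMinus, kk_append_length, dd_append_length,
    kk_append, dd_append, repl_append, kk_cons_zero, dd_cons_zero, kk_cons_succ, dd_cons_succ,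
    List.drop_succ_cons, List.drop_zero, toPNat'_coe_pnat, smul_ite, smul_zero]
  rcases b with ⟨k, _ | d⟩
  · simp
  · rw [show a.2 + (d + 1) - 1 = a.2 + (d + 1 - 1) by omega]

theorem phiPlus_phiPlus_word (h : i + 2 < w.length) :
    wordMap (phiPlus (i + 1)) (wordMap (phiPlus (i + 1)) (word w))
      = if kk w i = 1 ∧ kk w (i + 1) = 1 then
          repl w i 3 (kk w (i + 2)) (dd w i + dd w (i + 1) + dd w (i + 2)) else 0 := by
  obtain ⟨u, a, b, c, v, rfl, rfl⟩ := exists_eq_append_three h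
  simp only [apply_ite (wordMap _), map_zero, wordMap_phiPlus, kk_append_length,
    dd_append_length, kk_append, dd_append, repl_append, kk_cons_zero, dd_cons_zero, kk_cons_succ,
    dd_cons_succ, List.drop_succ_cons, List.drop_zero, toPNat'_coe_pnat, ite_and]

theorem phiMinus_phiMinus_word (h : i + 2 < w.length) :
    wordMap (phiMinus (i + 2)) (wordMap (phiMinus (i + 2)) (word w))
      = if kk w (i + 1) = 1 ∧ kk w (i + 2) = 1 then
          repl w i 3 (kk w i) (dd w i + dd w (i + 1) + dd w (i + 2)) else 0 := by
  obtain ⟨u, a, b, c, v, rfl, rfl⟩ := exists_eq_append_three h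
  simp only [apply_ite (wordMap _), map_zero, wordMap_phiMinus, kk_append_length,
    dd_append_length, kk_append, dd_append, repl_append, kk_cons_zero, dd_cons_zero, kk_cons_succ,
    dd_cons_succ, List.drop_succ_cons, List.drop_zero, toPNat'_coe_pnat, ite_and]

end TwoLetters

theorem mulX_word_of_lt {w : Word} {j : ℕ} (h : w.length < j) :
    wordMap (mulXB j) (word w) = 0 := by
  rw [wordMap_word, mulXB, varX_of_lt h, zero_mul, map_zero, smul_zero]

theorem phiPlus_mulX_last (u : Word) (a : Letter) :
    wordMap (phiPlus (u.length + 1)) (wordMap (mulXB (u.length + 1)) (word (u ++ [a])))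
      = if a = (2, 0) then word u else 0 := by
  rw [wordMap_mulXB, apply_ite (wordMap _), map_zero, wordMap_phiPlus_last, Nat.toPNat'_coe]
  have h : a = (2, 0) ↔ (a.1 : ℕ) = 2 ∧ a.2 = 0 := by
    rw [Prod.ext_iff, ← PNat.coe_inj]
    rfl
  simp only [h]
  split_ifs <;> first | rfl | omega

theorem phiPlus_mulY_last (u : Word) (a : Letter) :
    wordMap (phiPlus (u.length + 1)) (wordMap (mulYB (u.length + 1)) (word (u ++ [a])))
      = if a = (1, 1) then word u else 0 := by
  rw [wordMap_mulYB, map_smul, wordMap_phiPlus_last]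
  have h : a = (1, 1) ↔ (a.1 : ℕ) = 1 ∧ a.2 = 1 := by
    rw [Prod.ext_iff, ← PNat.coe_inj]
    rfl
  simp only [h]
  rcases a with ⟨k, _ | _ | d⟩ <;> simp

theorem phiPlus_phiPlus_last (u : Word) (a b : Letter) :
    wordMap (phiPlus (u.length + 1)) (wordMap (phiPlus (u.length + 1)) (word (u ++ [a, b])))
      = if a = (1, 0) ∧ b = (1, 0) then word u else 0 := by
  have h : ∀ a : Letter, a = (1, 0) ↔ (a.1 : ℕ) = 1 ∧ a.2 = 0 := fun a => by
    rw [Prod.ext_iff, ← PNat.coe_inj]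
    rfl
  rw [wordMap_phiPlus, apply_ite (wordMap _), map_zero, wordMap_phiPlus_last]
  simp only [h]
  split_ifs <;> first | rfl | omega

theorem phiPlus_phiPlus_length {w : Word} {m : ℕ} (h : w.length = m + 1) :
    wordMap (phiPlus (m + 1)) (wordMap (phiPlus (m + 1)) (word w)) = 0 := by
  obtain ⟨n, rfl⟩ := exists_wordOf h
  rw [← LinearMap.comp_apply, ← wordMap_comp fun T => mapB_phiPlus T _, wordMap_wordOf,
    Function.comp_apply, phiPlus_phiPlus_self, map_zero, smul_zero]

theorem phiMinus_phiMinus_length {w : Word} {m : ℕ} (h : w.length = m + 1) :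
    wordMap (phiMinus (m + 1)) (wordMap (phiMinus (m + 1)) (word w)) = 0 := by
  obtain ⟨n, rfl⟩ := exists_wordOf h
  rw [← LinearMap.comp_apply, ← wordMap_comp fun T => mapB_phiMinus T _, wordMap_wordOf,
    Function.comp_apply, phiMinus_phiMinus_self, map_zero, smul_zero]

theorem wordMap_phiMinus_one : wordMap (phiMinus 1) = 0 := hom_ext fun w => by
  rw [wordMap_word, phiMinus_one, map_zero, smul_zero]
  rfl

theorem singleton_suffix_append_singleton {u : Word} {a b : Letter} :
    [b] <:+ u ++ [a] ↔ a = b := by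
  rw [← List.reverse_prefix]
  simp [eq_comm]

theorem pair_suffix_append_pair {u : Word} {a b c d : Letter} :
    [c, d] <:+ u ++ [a, b] ↔ a = c ∧ b = d := by
  rw [← List.reverse_prefix]
  simp [eq_comm, and_comm]

theorem sum_phiPlus_phiPlus (u : Word) (a : Letter) :
    ∑ i ∈ Finset.range u.length,
        wordMap (phiPlus (i + 1)) (wordMap (phiPlus (i + 1)) (word (u ++ [a])))
      = (∑ i ∈ Finset.range (u.length - 1),
          if kk (u ++ [a]) i = 1 ∧ kk (u ++ [a]) (i + 1) = 1 then
            repl (u ++ [a]) i 3 (kk (u ++ [a]) (i + 2))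
              (dd (u ++ [a]) i + dd (u ++ [a]) (i + 1) + dd (u ++ [a]) (i + 2)) else 0)
        + if [((1 : ℕ+), 0), ((1 : ℕ+), 0)] <:+ u ++ [a] then
            word ((u ++ [a]).take ((u ++ [a]).length - 2)) else 0 := by
  rcases List.eq_nil_or_concat' u with rfl | ⟨u, b, rfl⟩
  · rw [if_neg fun h => by simpa using h.length_le]
    simp
  · simp only [List.append_assoc, List.cons_append, List.nil_append]
    -- The split-off term is the one that removes the last two letters. It yields the part of `δ²`
    -- with coefficient `-1/2`; all other terms leave a third letter.
    rw [List.length_append, List.length_singleton, Nat.add_sub_cancel, Finset.sum_range_succ,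
      phiPlus_phiPlus_last]
    congr 1
    · refine Finset.sum_congr rfl fun i hi => phiPlus_phiPlus_word ?_
      rw [Finset.mem_range] at hi
      simp
      omega
    · refine if_congr pair_suffix_append_pair.symm ?_ rfl
      simp

theorem sum_phiMinus_phiMinus (u : Word) (a : Letter) :
    ∑ i ∈ Finset.range u.length,
        wordMap (phiMinus (i + 2)) (wordMap (phiMinus (i + 2)) (word (u ++ [a])))
      = ∑ i ∈ Finset.range (u.length - 1),
          if kk (u ++ [a]) (i + 1) = 1 ∧ kk (u ++ [a]) (i + 2) = 1 then
            repl (u ++ [a]) i 3 (kk (u ++ [a]) i)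
              (dd (u ++ [a]) i + dd (u ++ [a]) (i + 1) + dd (u ++ [a]) (i + 2)) else 0 := by
  rcases Nat.eq_zero_or_pos u.length with h | h
  · simp [h]
  · obtain ⟨m, hm⟩ : ∃ m, u.length = m + 1 := ⟨u.length - 1, by omega⟩
    rw [hm, Finset.sum_range_succ, phiMinus_phiMinus_length (by simp [hm]), add_zero,
      Nat.add_sub_cancel]
    refine Finset.sum_congr rfl fun i hi => phiMinus_phiMinus_word ?_
    rw [Finset.mem_range] at hi
    simp
    omega

theorem derDelta_eq : derDelta
    = delta1 - (1 / 2 : ℚ) • (delta2 + delta3 + delta4 + delta5) := hom_ext fun w => by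
  rw [derDelta_word_eq]
  rcases List.eq_nil_or_concat' w with rfl | ⟨u, a, rfl⟩
  · simp [delta1, delta2, delta3, delta4, delta5, linExt_word]
  have hl : (u ++ [a]).length = u.length + 1 := by simp
  have h2 : ∀ i ∈ Finset.range u.length, i + 1 < (u ++ [a]).length := fun i hi => by
    rw [Finset.mem_range] at hi
    omega
  have hXY : ∑ i ∈ Finset.range (u ++ [a]).length,
      wordMap (mulYB (i + 1)) (wordMap (mulXB (i + 1)) (word (u ++ [a])))
      = ∑ j ∈ Finset.range (u ++ [a]).length, _ :=
    Finset.sum_congr rfl fun i hi => mulY_mulX_word (Finset.mem_range.1 hi)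
  simp only [LinearMap.sub_apply, LinearMap.smul_apply, LinearMap.add_apply, delta1, delta2, delta3,
    delta4, delta5, linExt_word]
  rw [hXY]
  simp only [hl]
  -- For `φ⁺` the last position is separated, because it removes a letter without merging. For `φ⁻`
  -- the zero term at the first position is separated, which also aligns its index with that of the
  -- merged pair.
  rw [Finset.sum_range_succ (n := u.length) (f := fun i => wordMap (phiPlus (i + 1)) _ - _ + _),
    Finset.sum_range_succ' (n := u.length) (f := fun i => wordMap (phiMinus (i + 1)) _ - _ + _),
    Finset.sum_range_succ (n := u.length) (f := fun i => wordMap (phiPlus (i + 1)) (wordMap (phiPlus (i + 1)) _)),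
    Finset.sum_range_succ' (n := u.length) (f := fun i => wordMap (phiMinus (i + 1)) (wordMap (phiMinus (i + 1)) _))]
  simp only [Finset.sum_add_distrib, Finset.sum_sub_distrib, zero_add, wordMap_phiMinus_one,
    LinearMap.zero_apply, sub_zero, add_zero, phiPlus_phiPlus_length hl, phiPlus_mulX_last,
    phiPlus_mulY_last, mulX_word_of_lt (show (u ++ [a]).length < u.length + 2 by omega), map_zero,
    Nat.add_sub_cancel]
  rw [sum_phiPlus_phiPlus, sum_phiMinus_phiMinus,
    Finset.sum_congr rfl fun i hi => phiPlus_mulX_word (h2 i hi),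
    Finset.sum_congr rfl fun i hi => phiPlus_mulX_succ_word (h2 i hi),
    Finset.sum_congr rfl fun i hi => phiPlus_mulY_word (h2 i hi),
    Finset.sum_congr rfl fun i hi => phiMinus_mulX_word (h2 i hi),
    Finset.sum_congr rfl fun i hi => phiMinus_mulX_succ_word (h2 i hi),
    Finset.sum_congr rfl fun i hi => phiMinus_mulY_word (h2 i hi)]
  simp only [singleton_suffix_append_singleton, hl, List.take_left,
    show u.length + 1 - 2 = u.length - 1 by omega]
  module

/-! ### The `sl₂`-relations -/

theorem derD_eq_coder : derD = coder (letterOp letterD) := hom_ext fun w => by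
  rw [derD_word, coder_letterD_word]

theorem derW_eq_coder : derW = coder (letterOp letterW) := hom_ext fun w => by
  rw [derW_word, coder_letterW_word]

theorem derDelta_eq_coder : derDelta = coder letter1 - (1 / 2 : ℚ) •
    (suffixOp eps2 + suffixOp eps3 + coder (letter4 + letter5)) := by
  rw [derDelta_eq, delta1_eq_coder, delta2_eq_suffixOp, delta3_eq_suffixOp, delta4_eq_coder,
    delta5_eq_coder, coder_add]
  module

theorem suffixOp_zero : suffixOp 0 = 0 := (eq_suffixOp rfl fun a w => by simp).symm

theorem suffixOp_smul (q : ℚ) (ε : QA →ₗ[ℚ] ℚ) : suffixOp (q • ε) = q • suffixOp ε := by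
  refine (eq_suffixOp ?_ fun a w => ?_).symm
  · rw [LinearMap.smul_apply, ← one_def', suffixOp_one, smul_zero]
  · rw [LinearMap.smul_apply, ← consL_word, suffixOp_consL, LinearMap.smul_apply,
      LinearMap.smul_apply, map_smul, smul_add, smul_assoc]

theorem coder_zero : coder 0 = 0 := by
  have h := coder_smul 0 0
  rwa [zero_smul, zero_smul] at h

theorem letterBracket_letterD_letterW :
    letterBracket (letterOp letterD) letterW = (-2 : ℚ) • letterOp letterD := hom_ext fun w => by
  rw [letterBracket, LinearMap.sub_apply, LinearMap.comp_apply, LinearMap.comp_apply,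
    coder_letterW_word, map_smul, LinearMap.smul_apply]
  rcases w with _ | ⟨a, _ | ⟨b, w⟩⟩
  · rw [← one_def', letterOp_one]
    simp
  · rw [letterOp_singleton, letterD, Finsupp.linearCombination_single, letterW, wt]
    simp only [Finsupp.smul_single, smul_eq_mul, ← Finsupp.single_sub, List.map_cons, List.map_nil,
      List.sum_cons, List.sum_nil]
    congr 1
    push_cast
    ring
  · rw [letterOp_cons_cons]
    simp

theorem derDelta_comp_letterOp (θ : Letter → LetterSpan) :
    derDelta ∘ₗ coder (letterOp θ) - coder (letterOp θ) ∘ₗ derDelta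
      = coder (letterBracket letter1 θ) - (1 / 2 : ℚ) •
        (suffixOp (eps2 ∘ₗ coder (letterOp θ)) + suffixOp (eps3 ∘ₗ coder (letterOp θ))
          + coder (letterBracket (letter4 + letter5) θ)) := by
  rw [derDelta_eq_coder, ← coder_comp_letterOp, ← coder_comp_letterOp, ← suffixOp_comp_letterOp,
    ← suffixOp_comp_letterOp]
  simp only [LinearMap.sub_comp, LinearMap.comp_sub, LinearMap.smul_comp, LinearMap.comp_smul,
    LinearMap.add_comp, LinearMap.comp_add]
  module

theorem derDelta_comp_derD : derDelta ∘ₗ derD - derD ∘ₗ derDelta = derW := by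
  rw [derD_eq_coder, derDelta_comp_letterOp, letterBracket_letter1_letterD, eps2_letterD,
    eps3_letterD, letterBracket_letter45_letterD, suffixOp_zero, coder_zero, derW_eq_coder]
  simp

theorem derDelta_comp_derW : derDelta ∘ₗ derW - derW ∘ₗ derDelta = (2 : ℚ) • derDelta := by
  have h : letterBracket (letter4 + letter5) letterW = (2 : ℚ) • (letter4 + letter5) := by
    rw [smul_add, ← letterBracket_letter4_letterW, ← letterBracket_letter5_letterW, letterBracket,
      letterBracket, letterBracket, LinearMap.add_comp, LinearMap.comp_add]
    abel
  rw [derW_eq_coder, derDelta_comp_letterOp, letterBracket_letter1_letterW, eps2_letterW,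
    eps3_letterW, h, suffixOp_smul, suffixOp_smul, coder_smul, coder_smul, derDelta_eq_coder]
  module

theorem derD_comp_derW : derD ∘ₗ derW - derW ∘ₗ derD = (-2 : ℚ) • derD := by
  rw [derD_eq_coder, derW_eq_coder, coder_comp_letterOp, letterBracket_letterD_letterW, coder_smul]

/-! ### Derivations -/

theorem IsStuffleDerivation.add {S T : QA →ₗ[ℚ] QA} (hS : IsStuffleDerivation S)
    (hT : IsStuffleDerivation T) : IsStuffleDerivation (S + T) := fun x y => by
  rw [LinearMap.add_apply, LinearMap.add_apply, LinearMap.add_apply, hS, hT]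
  ring

theorem IsStuffleDerivation.smul {T : QA →ₗ[ℚ] QA} (q : ℚ) (hT : IsStuffleDerivation T) :
    IsStuffleDerivation (q • T) := fun x y => by
  rw [LinearMap.smul_apply, LinearMap.smul_apply, LinearMap.smul_apply, hT, smul_add,
    smul_mul_assoc, mul_smul_comm]

theorem IsStuffleDerivation.sub {S T : QA →ₗ[ℚ] QA} (hS : IsStuffleDerivation S)
    (hT : IsStuffleDerivation T) : IsStuffleDerivation (S - T) := fun x y => by
  rw [LinearMap.sub_apply, LinearMap.sub_apply, LinearMap.sub_apply, hS, hT]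
  ring

theorem delta1_isStuffleDerivation : IsStuffleDerivation delta1 := by
  rw [delta1_eq_coder]
  exact coder_isStuffleDerivation letter1_isLetterDerivation

theorem delta2_isStuffleDerivation : IsStuffleDerivation delta2 := by
  rw [delta2_eq_suffixOp]
  exact suffixOp_isStuffleDerivation eps2_mul

theorem delta3_isStuffleDerivation : IsStuffleDerivation delta3 := by
  rw [delta3_eq_suffixOp]
  exact suffixOp_isStuffleDerivation eps3_mul

theorem delta4_isStuffleDerivation : IsStuffleDerivation delta4 := by
  rw [delta4_eq_coder]
  exact coder_isStuffleDerivation letter4_isLetterDerivation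

theorem delta5_isStuffleDerivation : IsStuffleDerivation delta5 := by
  rw [delta5_eq_coder]
  exact coder_isStuffleDerivation letter5_isLetterDerivation

theorem derD_isStuffleDerivation : IsStuffleDerivation derD := by
  rw [derD_eq_coder]
  exact coder_isStuffleDerivation (letterOp_isLetterDerivation letterD_add)

theorem derW_isStuffleDerivation : IsStuffleDerivation derW := by
  rw [derW_eq_coder]
  exact coder_isStuffleDerivation (letterOp_isLetterDerivation letterW_add)

theorem derDelta_isStuffleDerivation : IsStuffleDerivation derDelta := by
  rw [derDelta_eq]
  exact delta1_isStuffleDerivation.sub (.smul _ (((delta2_isStuffleDerivation.add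
    delta3_isStuffleDerivation).add delta4_isStuffleDerivation).add delta5_isStuffleDerivation))

/-- A commutator of swap-equivariant maps is swap-equivariant, and `W = [δ, D]`. -/
theorem derW_isSwapEquivariant : IsSwapEquivariant derW := fun x => by
  rw [← derDelta_comp_derD]
  simp only [LinearMap.sub_apply, LinearMap.comp_apply, derD_isSwapEquivariant _,
    derDelta_isSwapEquivariant _, map_sub]

/-! ### The induced derivations of the quotient -/

/-- Equivariance sends the generator for `w` to the generator for `T w`; the Leibniz rule extends
this to the ideal. -/
theorem map_mem_swapIdeal {T : QA →ₗ[ℚ] QA} (hT : IsStuffleDerivation T)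
    (hs : IsSwapEquivariant T) {x : QA} (hx : x ∈ swapIdeal) : T x ∈ swapIdeal := by
  induction hx using Submodule.span_induction with
  | mem x h =>
    obtain ⟨w, rfl⟩ := h
    rw [map_sub, hs]
    exact Ideal.subset_span ⟨T w, rfl⟩
  | zero => rw [map_zero]; exact zero_mem _
  | add x y _ _ hx hy => rw [map_add]; exact add_mem hx hy
  | smul a x hx h =>
    rw [smul_eq_mul, hT]
    exact add_mem (Ideal.mul_mem_left _ _ hx) (Ideal.mul_mem_left _ _ h)

theorem exists_derivation_FMES {T : QA →ₗ[ℚ] QA} (hT : IsStuffleDerivation T)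
    (hs : IsSwapEquivariant T) : ∃ D : Derivation ℚ FMES FMES,
      ∀ x : QA, D (Ideal.Quotient.mk swapIdeal x) = Ideal.Quotient.mk swapIdeal (T x) := by
  have hsurj : Function.Surjective (Ideal.Quotient.mk swapIdeal) := Ideal.Quotient.mk_surjective
  -- Computed on an arbitrarily chosen preimage; `hF` shows that the choice does not matter.
  let F : FMES → FMES := fun x => Ideal.Quotient.mk swapIdeal (T (Function.surjInv hsurj x))
  have hF : ∀ x, F (Ideal.Quotient.mk swapIdeal x) = Ideal.Quotient.mk swapIdeal (T x) := fun x => by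
    rw [Ideal.Quotient.eq, ← map_sub]
    exact map_mem_swapIdeal hT hs (Ideal.Quotient.eq.1 (Function.surjInv_eq hsurj _))
  let L : FMES →ₗ[ℚ] FMES :=
    { toFun := F
      map_add' := fun x y => by
        obtain ⟨x, rfl⟩ := hsurj x
        obtain ⟨y, rfl⟩ := hsurj y
        rw [← map_add, hF, hF, hF, map_add, map_add]
      map_smul' := fun q x => by
        obtain ⟨x, rfl⟩ := hsurj x
        have h : ∀ y, q • Ideal.Quotient.mk swapIdeal y = Ideal.Quotient.mk swapIdeal (q • y) :=
          fun _ => rfl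
        rw [h, hF, hF, map_smul, RingHom.id_apply, h] }
  refine ⟨Derivation.mk' L fun x y => ?_, hF⟩
  obtain ⟨x, rfl⟩ := hsurj x
  obtain ⟨y, rfl⟩ := hsurj y
  change F _ = _ • F _ + _ • F _
  rw [← map_mul, hF, hF, hF, hT, map_add, map_mul, map_mul, smul_eq_mul, smul_eq_mul, add_comm,
    mul_comm (Ideal.Quotient.mk swapIdeal y)]

/-! ### The Lie algebra homomorphism from `sl₂` -/

section SpecialLinear

variable {L : Type} [LieRing L] [LieAlgebra ℚ L]

/-- The triple `(D, W, -δ)` satisfies the standard relations of `(e, h, f)`, in particular `[D, -δ]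
= W`; this explains the sign of the last term. -/
theorem exists_lieHom_of_triple {D W δ : L} (h1 : ⁅W, D⁆ = (2 : ℚ) • D)
    (h2 : ⁅W, δ⁆ = (-2 : ℚ) • δ) (h3 : ⁅δ, D⁆ = W) :
    ∃ ρ : LieAlgebra.SpecialLinear.sl (Fin 2) ℚ →ₗ⁅ℚ⁆ L,
      ∀ A : LieAlgebra.SpecialLinear.sl (Fin 2) ℚ,
        ρ A = (A.val 0 0) • W + (A.val 0 1) • D - (A.val 1 0) • δ := by
  refine ⟨{ toFun := fun A => (A.val 0 0) • W + (A.val 0 1) • D - (A.val 1 0) • δ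
            map_add' := fun A B => ?_
            map_smul' := fun q A => ?_
            map_lie' := fun {A B} => ?_ }, fun A => rfl⟩
  · change (A.val 0 0 + B.val 0 0) • W + (A.val 0 1 + B.val 0 1) • D
      - (A.val 1 0 + B.val 1 0) • δ = _
    module
  · change (q * A.val 0 0) • W + (q * A.val 0 1) • D - (q * A.val 1 0) • δ = q • (_ + _ - _)
    module
  · have tr : ∀ A : LieAlgebra.SpecialLinear.sl (Fin 2) ℚ, A.val 1 1 = -A.val 0 0 := fun A => by
      have h : Matrix.trace A.val = 0 := LinearMap.mem_ker.1 A.2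
      rw [Matrix.trace_fin_two] at h
      linarith
    have hb : (⁅A, B⁆ : LieAlgebra.SpecialLinear.sl (Fin 2) ℚ).val
        = A.val * B.val - B.val * A.val := rfl
    have h1' : ⁅D, W⁆ = (-2 : ℚ) • D := by rw [← lie_skew, h1, neg_smul]
    have h2' : ⁅δ, W⁆ = (2 : ℚ) • δ := by rw [← lie_skew, h2, neg_smul, neg_neg]
    have h3' : ⁅D, δ⁆ = -W := by rw [← lie_skew, h3]
    simp only [hb, Matrix.sub_apply, Matrix.mul_apply, Fin.sum_univ_two, tr, add_lie, sub_lie,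
      lie_add, lie_sub, smul_lie, lie_smul, lie_self, h1, h2, h3, h1', h2', h3']
    module

end SpecialLinear

end

end FormalMES

theorem mainTheorem3 :
    -- `D`, `W`, `δ` are swap-equivariant derivations of `(ℚ⟨𝓐⟩, *)`
    (FormalMES.IsStuffleDerivation FormalMES.derD ∧
      FormalMES.IsSwapEquivariant FormalMES.derD) ∧
    (FormalMES.IsStuffleDerivation FormalMES.derW ∧
      FormalMES.IsSwapEquivariant FormalMES.derW) ∧
    (FormalMES.IsStuffleDerivation FormalMES.derDelta ∧
      FormalMES.IsSwapEquivariant FormalMES.derDelta) ∧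
    -- explicit formulas on words
    (∀ w : FormalMES.Word, FormalMES.derD (FormalMES.word w) =
      ∑ j ∈ Finset.range w.length, (FormalMES.kk w j : ℚ) •
        FormalMES.repl w j 1 (FormalMES.kk w j + 1) (FormalMES.dd w j + 1)) ∧
    (∀ w : FormalMES.Word, FormalMES.derW (FormalMES.word w) =
      (FormalMES.wt w : ℚ) • FormalMES.word w) ∧
    FormalMES.derDelta = FormalMES.delta1 - (1 / 2 : ℚ) •
      (FormalMES.delta2 + FormalMES.delta3 + FormalMES.delta4 + FormalMES.delta5) ∧
    -- each of the five summands is a derivation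
    FormalMES.IsStuffleDerivation FormalMES.delta1 ∧
    FormalMES.IsStuffleDerivation FormalMES.delta2 ∧
    FormalMES.IsStuffleDerivation FormalMES.delta3 ∧
    FormalMES.IsStuffleDerivation FormalMES.delta4 ∧
    FormalMES.IsStuffleDerivation FormalMES.delta5 ∧
    -- they descend to the quotient and form an `sl₂`-triple there
    ∃ D W δ : Derivation ℚ FormalMES.FMES FormalMES.FMES,
      (∀ x : FormalMES.QA, D (Ideal.Quotient.mk FormalMES.swapIdeal x) =
        Ideal.Quotient.mk FormalMES.swapIdeal (FormalMES.derD x)) ∧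
      (∀ x : FormalMES.QA, W (Ideal.Quotient.mk FormalMES.swapIdeal x) =
        Ideal.Quotient.mk FormalMES.swapIdeal (FormalMES.derW x)) ∧
      (∀ x : FormalMES.QA, δ (Ideal.Quotient.mk FormalMES.swapIdeal x) =
        Ideal.Quotient.mk FormalMES.swapIdeal (FormalMES.derDelta x)) ∧
      ⁅W, D⁆ = (2 : ℚ) • D ∧ ⁅W, δ⁆ = (-2 : ℚ) • δ ∧ ⁅δ, D⁆ = W ∧
      -- the Lie algebra homomorphism from `sl₂` given by the triple
      ∃ ρ : LieAlgebra.SpecialLinear.sl (Fin 2) ℚ →ₗ⁅ℚ⁆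
          Derivation ℚ FormalMES.FMES FormalMES.FMES,
        ∀ A : LieAlgebra.SpecialLinear.sl (Fin 2) ℚ,
          ρ A = (A.val 0 0) • W + (A.val 0 1) • D - (A.val 1 0) • δ := by
  open FormalMES in
  obtain ⟨D, hD⟩ := exists_derivation_FMES derD_isStuffleDerivation derD_isSwapEquivariant
  obtain ⟨W, hW⟩ := exists_derivation_FMES derW_isStuffleDerivation derW_isSwapEquivariant
  obtain ⟨δ, hδ⟩ := exists_derivation_FMES derDelta_isStuffleDerivation derDelta_isSwapEquivariant
  have hWD : ⁅W, D⁆ = (2 : ℚ) • D := Derivation.ext fun x => by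
    obtain ⟨x, rfl⟩ := Ideal.Quotient.mk_surjective x
    -- The relation on words is for the commutator with `W` on the right, hence the change of sign
    -- here and for `δ`.
    have h := congrArg (Ideal.Quotient.mk swapIdeal) (congrArg (fun T => T x) derD_comp_derW)
    rw [Derivation.commutator_apply, Derivation.smul_apply, hD, hW, hW, hD, ← map_sub, ← neg_sub,
      map_neg]
    refine (congrArg Neg.neg h).trans ?_
    rw [← map_neg]
    exact congrArg _ (by rw [LinearMap.smul_apply, neg_smul, neg_neg])
  have hWδ : ⁅W, δ⁆ = (-2 : ℚ) • δ := Derivation.ext fun x => by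
    obtain ⟨x, rfl⟩ := Ideal.Quotient.mk_surjective x
    have h := congrArg (Ideal.Quotient.mk swapIdeal) (congrArg (fun T => T x) derDelta_comp_derW)
    rw [Derivation.commutator_apply, Derivation.smul_apply, hδ, hW, hW, hδ, ← map_sub, ← neg_sub,
      map_neg]
    refine (congrArg Neg.neg h).trans ?_
    rw [← map_neg]
    exact congrArg (Ideal.Quotient.mk swapIdeal) (neg_smul (2 : ℚ) (derDelta x)).symm
  have hδD : ⁅δ, D⁆ = W := Derivation.ext fun x => by
    obtain ⟨x, rfl⟩ := Ideal.Quotient.mk_surjective x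
    rw [Derivation.commutator_apply, hδ, hD, hD, hδ, hW, ← map_sub, ← derDelta_comp_derD]
    rfl
  exact ⟨⟨derD_isStuffleDerivation, derD_isSwapEquivariant⟩,
    ⟨derW_isStuffleDerivation, derW_isSwapEquivariant⟩,
    ⟨derDelta_isStuffleDerivation, derDelta_isSwapEquivariant⟩, derD_word, derW_word, derDelta_eq,
    delta1_isStuffleDerivation, delta2_isStuffleDerivation, delta3_isStuffleDerivation,
    delta4_isStuffleDerivation, delta5_isStuffleDerivation, D, W, δ, hD, hW, hδ, hWD, hWδ, hδD,
    exists_lieHom_of_triple hWD hWδ hδD⟩
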